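/- Let $\ell$ be a prime and let $\Lambda$ be a quotient ring of $\mathbb{Z}_\ell$ which is a domain (so $\Lambda=\mathbb{Z}_\ell$ or $\Lambda=\mathbb{Z}/\ell$). Let $k$ be an algebraically closed field of characteristic $\neq \ell$, and let $K|k$ be a function field (a finitely generated field extension). Write $\mathcal{G}(K,\Lambda) := \operatorname{Hom}(K^\times,\Lambda)\otimes_\Lambda \operatorname{Frac}\Lambda$, a vector space over $\operatorname{Frac}\Lambda$ whose elements are regarded as homomorphisms $K^\times\to\operatorname{Frac}\Lambda$. A pair $f,g\in\mathcal{G}(K,\Lambda)$ is called alternating if $f(x)\cdot g(1-x)=f(1-x)\cdot g(x)$ for all $x\in K\smallsetminus\{0,1\}$; a subset of $\mathcal{G}(K,\Lambda)$ is alternating if any two of its elements form an alternating pair. Valuations are considered up to equivalence. For a valuation $v$ of $K$ with value group $vK$, residue field $Kv$, unit group $\mathrm{U}_v$ and principal units $\mathrm{U}_v^1=1+\mathfrak{m}_v$, and with $vk$ and $kv$ denoting the value group and the residue field of the restriction of $v$ to $k$, put $$\mathcal{I}_v=\{f\in\mathcal{G}(K,\Lambda) : f(x)=0 \text{ for all }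 x\in \mathrm{U}_v\},\qquad \mathcal{D}_v=\{f\in\mathcal{G}(K,\Lambda) : f(x)=0 \text{ for all } x\in \mathrm{U}_v^1\}.$$ A valuation $v$ of $K$ is called quasi-divisorial (for $K|k$) if it is minimal (that is, coarsest) among the valuations of $K$ satisfying the two conditions: (i) $vK/vk\cong\mathbb{Z}$ as abstract groups, and (ii) $\operatorname{trdeg}(K|k)=\operatorname{trdeg}(Kv|kv)+1$. **Theorem.** Assume that $d:=\operatorname{trdeg}(K|k)\geq 2$, and let $\mathcal{I}\subset\mathcal{G}(K,\Lambda)$ be a 1-dimensional subspace. Then the following are equivalent: 1. There exist two $d$-dimensional subspaces $\mathcal{D}_1,\mathcal{D}_2\subset\mathcal{G}(K,\Lambda)$, both alternating, such that $\mathcal{D}_1\cap\mathcal{D}_2=\mathcal{I}$. 2. There exists a quasi-divisorial valuation $v$ of $K|k$ such that $\mathcal{I}_v=\mathcal{I}$. The valuation $v$ in (2) is unique if it exists. Furthermore, if these conditions hold and $h\in\mathcal{I}_v$ is nonzero, then $$\mathcal{D}_v=\{f\in\mathcal{G}(K,\Lambda) : h,f \text{ is an alternating pair}\}.$$ -/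

import Mathlib

open scoped TensorProduct

noncomputable section

namespace QuasiDivisorial

section Pairs

variable (F : Type*) [Field F] (Λ : Type*) [CommRing Λ]

/-- `𝒢(F, Λ) = Hom(Fˣ, Λ) ⊗_Λ Frac Λ`, a vector space over `Frac Λ` (the scalar factor is written
on the left, so that Mathlib's `Frac Λ`-module structure applies). -/
abbrev G : Type _ := FractionRing Λ ⊗[Λ] (Additive Fˣ →+ Λ)

variable {F}

/-- Evaluation of a homomorphism `Fˣ → Λ` at `x`, as a `Λ`-linear map. -/
def evalHom (x : Fˣ) : (Additive Fˣ →+ Λ) →ₗ[Λ] Λ where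
  toFun f := f (Additive.ofMul x)
  map_add' _ _ := rfl
  map_smul' _ _ := rfl

/-- Evaluation of elements of `𝒢(F, Λ)` at `x`, through which they are considered as homomorphisms
`Fˣ → Frac Λ`: it sends `a ⊗ f` to `a · f(x)`. -/
def evalAt (x : Fˣ) : G F Λ →ₗ[FractionRing Λ] FractionRing Λ :=
  (TensorProduct.AlgebraTensorModule.rid Λ (FractionRing Λ) (FractionRing Λ)).toLinearMap ∘ₗ
    (evalHom Λ x).baseChange (FractionRing Λ)

variable {Λ}

/-- `f, g` form an alternating pair: `f(x) g(1 - x) = f(1 - x) g(x)` for all `x ≠ 0, 1`. -/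
def IsAlternatingPair (f g : G F Λ) : Prop :=
  ∀ (x : F) (h0 : x ≠ 0) (h1 : x ≠ 1),
    evalAt Λ (Units.mk0 x h0) f * evalAt Λ (Units.mk0 (1 - x) (sub_ne_zero.mpr h1.symm)) g =
      evalAt Λ (Units.mk0 (1 - x) (sub_ne_zero.mpr h1.symm)) f * evalAt Λ (Units.mk0 x h0) g

/-- A subset of `𝒢(F, Λ)` is alternating if it is pairwise alternating. -/
def IsAlternating (S : Set (G F Λ)) : Prop :=
  ∀ f ∈ S, ∀ g ∈ S, IsAlternatingPair f g

variable (Λ)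

/-- The elements of `𝒢(F, Λ)` that vanish on a given subgroup of `Fˣ`. -/
def vanishingOn (U : Subgroup Fˣ) : Submodule (FractionRing Λ) (G F Λ) :=
  ⨅ x ∈ U, LinearMap.ker (evalAt Λ x)

theorem mem_vanishingOn {U : Subgroup Fˣ} {f : G F Λ} :
    f ∈ vanishingOn Λ U ↔ ∀ x ∈ U, evalAt Λ x f = 0 := by
  simp [vanishingOn]

/-- `𝓘_v`: the elements of `𝒢(F, Λ)` that vanish on the `v`-units. Valuations are considered up to
equivalence, i.e. as valuation subrings. -/
def inertia (v : ValuationSubring F) : Submodule (FractionRing Λ) (G F Λ) :=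
  vanishingOn Λ v.unitGroup

/-- `𝓓_v`: the elements of `𝒢(F, Λ)` that vanish on the principal `v`-units `1 + 𝔪_v`. -/
def decomposition (v : ValuationSubring F) : Submodule (FractionRing Λ) (G F Λ) :=
  vanishingOn Λ v.principalUnitGroup

end Pairs

section Valuations

variable (k : Type*) [Field k] {K : Type*} [Field K] [Algebra k K]

/-- The subgroup `vk` of the value group `vK`. -/
def baseValueGroup (v : ValuationSubring K) : Subgroup (v.ValueGroup)ˣ :=
  (Units.map ((v.valuation : K →* v.ValueGroup).comp (algebraMap k K : k →* K))).range

/-- The inclusion of the valuation ring of `v|_k` into the valuation ring of `v`. -/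
def ringInclusion (v : ValuationSubring K) : v.comap (algebraMap k K) →+* v :=
  (algebraMap k K).restrict (v.comap (algebraMap k K)) v (fun _ hx => hx)

instance isLocalHom_ringInclusion (v : ValuationSubring K) : IsLocalHom (ringInclusion k v) where
  map_nonunit a ha := by
    obtain ⟨b, hb⟩ := ha.exists_right_inv
    have hb' : algebraMap k K (a : k) * (b : K) = 1 := congrArg Subtype.val hb
    have hne : (a : k) ≠ 0 := by
      intro h
      simp [h] at hb'
    have hinv : (a : k)⁻¹ ∈ v.comap (algebraMap k K) := by
      rw [ValuationSubring.mem_comap, map_inv₀, inv_eq_of_mul_eq_one_right hb']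
      exact b.2
    exact IsUnit.of_mul_eq_one ⟨(a : k)⁻¹, hinv⟩ (Subtype.ext (mul_inv_cancel₀ hne))

/-- `trdeg(Kv | kv)`, for the embedding `kv → Kv` of residue fields induced by `k → K`. -/
def residueTrdeg (v : ValuationSubring K) : Cardinal :=
  letI : Algebra (IsLocalRing.ResidueField (v.comap (algebraMap k K)))
      (IsLocalRing.ResidueField v) :=
    (IsLocalRing.ResidueField.map (ringInclusion k v)).toAlgebra
  Algebra.trdeg (IsLocalRing.ResidueField (v.comap (algebraMap k K)))
    (IsLocalRing.ResidueField v)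

/-- The two conditions `vK/vk ≅ ℤ` and `trdeg(K|k) = trdeg(Kv|kv) + 1`. -/
structure IsQDCandidate (v : ValuationSubring K) : Prop where
  valueGroup_iso : Nonempty (((v.ValueGroup)ˣ ⧸ baseValueGroup k v) ≃* Multiplicative ℤ)
  trdeg_eq : Algebra.trdeg k K = residueTrdeg k v + 1

/-- `v` is quasi-divisorial: it is minimal, i.e. coarsest, among the valuations satisfying the two
conditions. A coarser valuation has a larger valuation ring, so minimal valuations are maximal
valuation subrings. -/
def IsQuasiDivisorial (v : ValuationSubring K) : Prop :=
  Maximal (IsQDCandidate k) v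

end Valuations

end QuasiDivisorial

end

/-!
An element of `𝒢(K, Λ)` is handled through its evaluation `ev f : K → Frac Λ`, a logarithmic
function that vanishes on the divisible group `kˣ`. A valuation is a valuation subring, so that
`V ≤ v` says that `v` is coarser than `V`; then `𝓘_v ≤ 𝓘_V` and `𝓓_V ≤ 𝓓_v`.

*Alternating pairs come from valuations.* Let `f, g` be an independent alternating pair. By
`IsAlternatingPair.isCollinear` the map `(f, g)` sends `x`, `y`, `x + y` to collinear points of the
affine plane. An element `x` is rigid if `1 + x` has the value `0` or the value of `x`. Two
non-rigid elements with independent values would make a fractional linear function of `n : ℕ`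
bounded (`map_mul_map_eq_of_nonrigid`). Hence all elements outside of the kernel of a nonzero
combination `h` of `f` and `g` are rigid, and those `x` among them for which `1 + x` has the
value `0` are the elements of positive valuation for a valuation whose units lie in `ker h`
(`IsCoherentPair.exists_valuationSubring`); if `Frac Λ` has two elements, the combination has to be
chosen with more care (`isCoherentPair_of_exponent_two`). If `h` lies in some `𝓘_w`, there is a
coarsest such `w`, and every `f` alternating with `h` lies in `𝓓_w`
(`mem_decomposition_of_isGreatest`). An alternating space `D` of dimension at least `2` therefore
lies in some `𝓓_V`, and meets `𝓘_V` in codimension at most `1`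
(`exists_valuation_of_isAlternating`).

*Counting.* Elements with independent values modulo `k` (`ValIndep`) and elements with independent
residues (`ResIndep`) together are algebraically independent over `k`, and if the former are units
for a coarser valuation, all of them have independent residues there
(`ValIndep.resIndep_sumElim`). Elements of `𝓘_V` that are independent on the units of `v` provide
the former, and an element of `𝓓_V` outside of `𝓘_V` provides an element transcendental in the
residue field. This gives Abhyankar's inequality for `dim 𝓘_V` (`finiteDimensional_inertia`). In
case of equality `vK / vk` is free of finite rank (`finite_relValueGroup`), which turns the
dimension `d - 1` of the residue field into the first condition on a quasi-divisorial valuation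
(`isQDCandidate_of_resIndep`).

*From subspaces to valuations.* Let `D₁ ∩ D₂` be the line spanned by `h`, and let `V₁, V₂` be the
valuations attached to `D₁, D₂`. For incomparable `V₁, V₂` the function `h` vanishes on the units
of `V₁ ⊔ V₂`, by weak approximation (`exists_mul_principal_units`); for comparable ones, `h` must
lie in the larger of `𝓘_{V₁}, 𝓘_{V₂}`, by counting dimensions. In both cases the coarsest `v` with
`h ∈ 𝓘_v` exists. It is coarser than `V₁` and `V₂`, and counting shows that `𝓘_v` is contained in
`D₁` and in `D₂`, and that the residue field has dimension `d - 1`.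

*From valuations to subspaces.* If the residues of `t 0, …, t (d - 2)` are independent at a
quasi-divisorial `v`, then refining `v` along the residue field gives two valuations with value
groups of rank `d`, one with `t 0` and one with `t 0 - 1` of positive value. Their inertia spaces
are alternating of dimension `d`, and intersect in `𝓘_v` (`IsQDCandidate.exists_isAlternating`).

Finally, a quasi-divisorial `v` is the coarsest valuation with `h ∈ 𝓘_v`, for any nonzero
`h ∈ 𝓘_v` (`IsQuasiDivisorial.isGreatest`). This gives the uniqueness of `v` and the description of
`𝓓_v`.
-/

open scoped nonZeroDivisors

namespace QuasiDivisorial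

/-! ### Approximation for two incomparable valuation rings -/

section

variable {K : Type*} [Field K]

theorem valuation_inv_lt_one {A : ValuationSubring K} {x : K} (hx : x ∉ A) :
    A.valuation x⁻¹ < 1 := by
  rw [← ValuationSubring.valuation_le_one_iff, not_le] at hx
  rw [map_inv₀]
  exact inv_lt_one_of_one_lt₀ hx

theorem mem_of_valuation_lt_one {A : ValuationSubring K} {x : K} (hx : A.valuation x < 1) :
    x ∈ A :=
  A.mem_of_valuation_le_one x hx.le

theorem valuation_one_add {A : ValuationSubring K} {x : K} (hx : A.valuation x < 1) :
    A.valuation (1 + x) = 1 := by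
  rw [Valuation.map_add_eq_of_lt_left, map_one]
  rwa [map_one]

theorem mem_of_valuation_eq_one {A : ValuationSubring K} {x : K} (hx : A.valuation x = 1) :
    x ∈ A :=
  A.mem_of_valuation_le_one x hx.le

/-- The valuation ring generated by two valuation rings consists of the products of their
elements. -/
theorem exists_mul_of_mem_sup {A B : ValuationSubring K} {c : K} (hc : c ∈ A ⊔ B) :
    ∃ a ∈ A, ∃ b ∈ B, c = a * b := by
  have one_add : ∀ α ∈ A, ∀ β ∈ B, ∃ a ∈ A, ∃ b ∈ B, α * β + 1 = a * b := by
    intro α hα β hβ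
    by_cases h1 : α * β ∈ A
    · exact ⟨_, A.add_mem _ _ h1 A.one_mem, 1, B.one_mem, by ring⟩
    · have h0 : α * β ≠ 0 := fun h => h1 (h ▸ A.zero_mem)
      by_cases h2 : α * β ∈ B
      · exact ⟨1, A.one_mem, _, B.add_mem _ _ h2 B.one_mem, by ring⟩
      · refine ⟨α, hα, β * (1 + (α * β)⁻¹), B.mul_mem _ _ hβ
          (mem_of_valuation_eq_one (valuation_one_add (valuation_inv_lt_one h2))), ?_⟩
        have := left_ne_zero_of_mul h0
        have := right_ne_zero_of_mul h0
        field_simp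
  have add : ∀ α ∈ A, ∀ β ∈ B, ∃ a ∈ A, ∃ b ∈ B, α + β = a * b := by
    intro α hα β hβ
    by_cases h1 : α ∈ B
    · exact ⟨1, A.one_mem, _, B.add_mem _ _ h1 hβ, by ring⟩
    by_cases h2 : β ∈ A
    · exact ⟨_, A.add_mem _ _ hα h2, 1, B.one_mem, by ring⟩
    have hβ0 : β ≠ 0 := fun h => h2 (h ▸ A.zero_mem)
    refine ⟨1 + α / β, A.add_mem _ _ A.one_mem ?_, β, hβ, by field_simp; ring⟩
    rw [div_eq_mul_inv]
    exact A.mul_mem _ _ hα (mem_of_valuation_lt_one (valuation_inv_lt_one h2))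
  have key : ∀ {x y : K}, (∃ a ∈ A, ∃ b ∈ B, x = a * b) → (∃ a ∈ A, ∃ b ∈ B, y = a * b) →
      ∃ a ∈ A, ∃ b ∈ B, x * y = a * b := by
    rintro _ _ ⟨a, ha, b, hb, rfl⟩ ⟨a', ha', b', hb', rfl⟩
    exact ⟨a * a', A.mul_mem _ _ ha ha', b * b', B.mul_mem _ _ hb hb', by ring⟩
  let S : Subring K :=
    { carrier := {c | ∃ a ∈ A, ∃ b ∈ B, c = a * b}
      mul_mem' := fun hx hy => key hx hy
      one_mem' := ⟨1, A.one_mem, 1, B.one_mem, by ring⟩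
      zero_mem' := ⟨0, A.zero_mem, 0, B.zero_mem, by ring⟩
      neg_mem' := by
        rintro _ ⟨a, ha, b, hb, rfl⟩
        exact ⟨-a, A.neg_mem _ ha, b, hb, by ring⟩
      add_mem' := by
        -- Divide by the smaller coefficient on each side; the two coefficients may be compared
        -- in the same or in opposite order.
        have aux : ∀ {a b a' b' : K}, a ∈ A → b ∈ B → a' ∈ A → b' ∈ B → b' ≠ 0 → b / b' ∈ B →
            a ≠ 0 → a' ≠ 0 → ∃ x ∈ A, ∃ y ∈ B, a * b + a' * b' = x * y := by
          intro a b a' b' ha hb ha' hb' hb0 hbb ha0 ha0'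
          rcases A.mem_or_inv_mem (a / a') with h | h
          · obtain ⟨x, hx, y, hy, e⟩ := one_add _ h _ hbb
            obtain ⟨x', hx', y', hy', e'⟩ := key ⟨a', ha', b', hb', rfl⟩ ⟨x, hx, y, hy, e⟩
            exact ⟨x', hx', y', hy', by rw [← e']; field_simp⟩
          · rw [inv_div] at h
            obtain ⟨x, hx, y, hy, e⟩ := add _ h _ hbb
            obtain ⟨x', hx', y', hy', e'⟩ := key ⟨a, ha, b', hb', rfl⟩ ⟨x, hx, y, hy, e⟩
            exact ⟨x', hx', y', hy', by rw [← e']; field_simp; ring⟩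
        rintro _ _ ⟨a, ha, b, hb, rfl⟩ ⟨a', ha', b', hb', rfl⟩
        by_cases h1 : a * b = 0
        · exact ⟨a', ha', b', hb', by rw [h1, zero_add]⟩
        by_cases h2 : a' * b' = 0
        · exact ⟨a, ha, b, hb, by rw [h2, add_zero]⟩
        rcases B.mem_or_inv_mem (b / b') with h | h
        · exact aux ha hb ha' hb' (right_ne_zero_of_mul h2) h (left_ne_zero_of_mul h1)
            (left_ne_zero_of_mul h2)
        · rw [inv_div] at h
          obtain ⟨x, hx, y, hy, e⟩ := aux ha' hb' ha hb (right_ne_zero_of_mul h1) h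
            (left_ne_zero_of_mul h2) (left_ne_zero_of_mul h1)
          exact ⟨x, hx, y, hy, by rw [← e, add_comm]⟩ }
  have hAS : A.toSubring ≤ S := fun a ha => ⟨a, ha, 1, B.one_mem, by ring⟩
  have hle : A ⊔ B ≤ ValuationSubring.ofLE A S hAS :=
    sup_le (fun a ha => ⟨a, ha, 1, B.one_mem, by ring⟩)
      (fun b hb => ⟨1, A.one_mem, b, hb, by ring⟩)
  exact hle hc

/-- Given elements `c, c'` of the valuation ring generated by two incomparable valuation rings,
there is an element that is as large as necessary for the first and as small as necessary for the
second valuation. -/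
theorem exists_separating {A B : ValuationSubring K} (hAB : ¬ A ≤ B) (hBA : ¬ B ≤ A) {c c' : K}
    (hc : c ∈ A ⊔ B) (hc' : c' ∈ A ⊔ B) :
    ∃ u : K, u ≠ 0 ∧ A.valuation u⁻¹ < 1 ∧ A.valuation (c * u⁻¹) < 1 ∧ B.valuation u < 1 ∧
      B.valuation (u * c') < 1 := by
  obtain ⟨a, haA, haB⟩ := SetLike.not_le_iff_exists.mp hAB
  obtain ⟨b, hbB, hbA⟩ := SetLike.not_le_iff_exists.mp hBA
  have ha0 : a ≠ 0 := fun h => haB (h ▸ B.zero_mem)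
  have hb0 : b ≠ 0 := fun h => hbA (h ▸ A.zero_mem)
  have hA1 := (A.valuation_le_one_iff _).mpr haA
  have hB1 := (B.valuation_le_one_iff _).mpr hbB
  have hA2 := valuation_inv_lt_one hbA
  have hB2 := valuation_inv_lt_one haB
  -- `u₀ = b / a` works for `c = c' = 1`.
  have u0A : A.valuation (b / a)⁻¹ < 1 := by
    rw [inv_div, div_eq_mul_inv, map_mul]
    exact mul_lt_one_of_nonneg_of_lt_one_right hA1 zero_le hA2
  have u0B : B.valuation (b / a) < 1 := by
    rw [div_eq_mul_inv, map_mul]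
    exact mul_lt_one_of_nonneg_of_lt_one_right hB1 zero_le hB2
  have u00 : b / a ≠ 0 := div_ne_zero hb0 ha0
  have stepA : ∃ u : K, u ≠ 0 ∧ A.valuation u⁻¹ < 1 ∧ A.valuation (c * u⁻¹) < 1 ∧
      B.valuation u < 1 := by
    by_cases hcA : c ∈ A
    · refine ⟨b / a, u00, u0A, ?_, u0B⟩
      rw [map_mul]
      exact mul_lt_one_of_nonneg_of_lt_one_right ((A.valuation_le_one_iff _).mpr hcA) zero_le u0A
    · obtain ⟨x, hx, y, hy, rfl⟩ := exists_mul_of_mem_sup hc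
      have h0 : x * y ≠ 0 := fun h => hcA (h ▸ A.zero_mem)
      have hx0 := left_ne_zero_of_mul h0
      have hy0 := right_ne_zero_of_mul h0
      have h1 : A.valuation (x * y * (y * (b / a))⁻¹) < 1 := by
        have : x * y * (y * (b / a))⁻¹ = x * (b / a)⁻¹ := by field_simp
        rw [this, map_mul]
        exact mul_lt_one_of_nonneg_of_lt_one_right ((A.valuation_le_one_iff _).mpr hx) zero_le u0A
      refine ⟨y * (b / a), mul_ne_zero hy0 u00, ?_, h1, ?_⟩
      · have : (y * (b / a))⁻¹ = (x * y)⁻¹ * (x * y * (y * (b / a))⁻¹) := by field_simp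
        rw [this, map_mul]
        exact mul_lt_one_of_nonneg_of_lt_one_right (valuation_inv_lt_one hcA).le zero_le h1
      · rw [map_mul]
        exact mul_lt_one_of_nonneg_of_lt_one_right ((B.valuation_le_one_iff _).mpr hy) zero_le u0B
  have stepB : ∃ u : K, u ≠ 0 ∧ A.valuation u⁻¹ < 1 ∧ B.valuation (u * c') < 1 ∧
      B.valuation u < 1 := by
    by_cases hcB : c' ∈ B
    · refine ⟨b / a, u00, u0A, ?_, u0B⟩
      rw [map_mul, mul_comm]
      exact mul_lt_one_of_nonneg_of_lt_one_right ((B.valuation_le_one_iff _).mpr hcB) zero_le u0B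
    · obtain ⟨x, hx, y, hy, rfl⟩ := exists_mul_of_mem_sup hc'
      have h0 : x * y ≠ 0 := fun h => hcB (h ▸ B.zero_mem)
      have hx0 := left_ne_zero_of_mul h0
      have hy0 := right_ne_zero_of_mul h0
      have h1 : B.valuation (x⁻¹ * (b / a) * (x * y)) < 1 := by
        have : x⁻¹ * (b / a) * (x * y) = y * (b / a) := by field_simp
        rw [this, map_mul]
        exact mul_lt_one_of_nonneg_of_lt_one_right ((B.valuation_le_one_iff _).mpr hy) zero_le u0B
      refine ⟨x⁻¹ * (b / a), mul_ne_zero (inv_ne_zero hx0) u00, ?_, h1, ?_⟩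
      · rw [mul_inv, inv_inv, map_mul]
        exact mul_lt_one_of_nonneg_of_lt_one_right ((A.valuation_le_one_iff _).mpr hx) zero_le u0A
      · have : x⁻¹ * (b / a) = (x * y)⁻¹ * (x⁻¹ * (b / a) * (x * y)) := by field_simp
        rw [this, map_mul]
        exact mul_lt_one_of_nonneg_of_lt_one_right (valuation_inv_lt_one hcB).le zero_le h1
  obtain ⟨u, hu0, hu1, hu2, hu3⟩ := stepA
  obtain ⟨w, hw0, hw1, hw2, hw3⟩ := stepB
  refine ⟨u * w, mul_ne_zero hu0 hw0, ?_, ?_, ?_, ?_⟩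
  · rw [mul_inv, map_mul]
    exact mul_lt_one_of_nonneg_of_lt_one_right hu1.le zero_le hw1
  · rw [mul_inv, ← mul_assoc, map_mul]
    exact mul_lt_one_of_nonneg_of_lt_one_right hu2.le zero_le hw1
  · rw [map_mul]
    exact mul_lt_one_of_nonneg_of_lt_one_right hu3.le zero_le hw3
  · rw [mul_assoc, map_mul]
    exact mul_lt_one_of_nonneg_of_lt_one_right hu3.le zero_le hw2

/-- Weak approximation: every unit of the valuation ring generated by two incomparable valuation
rings `A` and `B` is the product of a principal unit for `A` and one for `B`. -/
theorem exists_mul_principal_units {A B : ValuationSubring K} (hAB : ¬ A ≤ B) (hBA : ¬ B ≤ A)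
    {x : K} (hx : (A ⊔ B).valuation x = 1) :
    ∃ a b : K, A.valuation (a - 1) < 1 ∧ B.valuation (b - 1) < 1 ∧ x = a * b := by
  have hx0 : x ≠ 0 := by rintro rfl; simp at hx
  have hxm : x ∈ A ⊔ B := mem_of_valuation_eq_one hx
  have hxi : x⁻¹ ∈ A ⊔ B := mem_of_valuation_eq_one (by rw [map_inv₀, hx, inv_one])
  obtain ⟨u, hu0, hu1, hu2, hu3, hu4⟩ := exists_separating hAB hBA
    (c := x - 1) (c' := (x - 1) * x⁻¹) (sub_mem hxm (one_mem _))
    (mul_mem (sub_mem hxm (one_mem _)) hxi)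
  have hA : A.valuation (1 + u⁻¹) = 1 := valuation_one_add hu1
  have hB : B.valuation (1 + u) = 1 := valuation_one_add hu3
  have h1u : 1 + u ≠ 0 := by intro h; rw [h] at hB; simp at hB
  -- `a = 1 + e (x - 1)` with `e = 1 / (1 + u)`, close to `0` for `A` and to `1` for `B`.
  have hA' : A.valuation ((1 + (x - 1) / (1 + u)) - 1) < 1 := by
    have : (1 + (x - 1) / (1 + u)) - 1 = (x - 1) * u⁻¹ * (1 + u⁻¹)⁻¹ := by
      have : (1 + u⁻¹) = (1 + u) / u := by field_simp; ring
      rw [this]; field_simp; ring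
    rw [this, map_mul, map_inv₀, hA, inv_one, mul_one]
    exact hu2
  have hB' : B.valuation ((1 + (x - 1) / (1 + u)) / x - 1) < 1 := by
    have : (1 + (x - 1) / (1 + u)) / x - 1 = - (u * ((x - 1) * x⁻¹)) * (1 + u)⁻¹ := by
      field_simp; ring
    rw [this, map_mul, Valuation.map_neg, map_inv₀, hB, inv_one, mul_one]
    exact hu4
  set a := 1 + (x - 1) / (1 + u) with ha
  have hb : B.valuation (a / x) = 1 := by
    have := valuation_one_add hB'
    rwa [add_sub_cancel] at this
  have ha0 : a ≠ 0 := by rintro h; rw [h] at hb; simp at hb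
  refine ⟨a, x / a, hA', ?_, by field_simp⟩
  have : x / a - 1 = - (a / x - 1) * (a / x)⁻¹ := by field_simp; ring
  rw [this, map_mul, Valuation.map_neg, map_inv₀, hb, inv_one, mul_one]
  exact hB'

end

/-! ### Valuation rings from rigid elements -/

section

variable {K : Type*} [Field K]

/-- An even logarithmic function on `K`: a homomorphism from the multiplicative group of `K` to an
additive group which vanishes at `-1`. The value at `0` is irrelevant. -/
structure IsLog {A : Type*} [AddCommGroup A] (f : K → A) : Prop where
  map_mul : ∀ x y, x ≠ 0 → y ≠ 0 → f (x * y) = f x + f y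
  map_neg_one : f (-1) = 0

namespace IsLog

variable {A : Type*} [AddCommGroup A] {f : K → A} (hf : IsLog f)
include hf

theorem map_one : f 1 = 0 := by
  have := hf.map_mul 1 1 one_ne_zero one_ne_zero
  simpa using this

theorem map_inv {x : K} (hx : x ≠ 0) : f x⁻¹ = -f x := by
  have := hf.map_mul x x⁻¹ hx (inv_ne_zero hx)
  rw [mul_inv_cancel₀ hx, hf.map_one] at this
  exact (neg_eq_of_add_eq_zero_right this.symm).symm

theorem map_div {x y : K} (hx : x ≠ 0) (hy : y ≠ 0) : f (x / y) = f x - f y := by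
  rw [div_eq_mul_inv, hf.map_mul _ _ hx (inv_ne_zero hy), hf.map_inv hy, sub_eq_add_neg]

theorem map_neg (x : K) : f (-x) = f x := by
  by_cases hx : x = 0
  · simp [hx]
  · rw [← neg_one_mul, hf.map_mul _ _ (neg_ne_zero.mpr one_ne_zero) hx, hf.map_neg_one, zero_add]

end IsLog

variable {A B : Type*} [AddCommGroup A] [AddCommGroup B]

/-- A pair of logarithmic functions `φ`, `h` with `ker φ ⊆ ker h` such that all elements outside of
`ker h` are rigid for `ker φ`. -/
structure IsRigidPair (φ : K → A) (h : K → B) : Prop where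
  log_left : IsLog φ
  log_right : IsLog h
  ker_le : ∀ x, x ≠ 0 → φ x = 0 → h x = 0
  rigid : ∀ x, x ≠ 0 → h x ≠ 0 → φ (1 + x) = 0 ∨ φ (1 + x) = φ x

/-- The elements `x` outside of `ker h` with `1 + x ∈ ker φ`. They will turn out to be the elements
of positive valuation outside of `ker h`. -/
def Small (φ : K → A) (h : K → B) (x : K) : Prop :=
  x ≠ 0 ∧ h x ≠ 0 ∧ φ (1 + x) = 0

namespace IsRigidPair

variable {φ : K → A} {h : K → B} (H : IsRigidPair φ h)
include H

theorem map_ne_zero {x : K} (hx : x ≠ 0) (hhx : h x ≠ 0) : φ x ≠ 0 :=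
  fun e => hhx (H.ker_le x hx e)

theorem map_left_eq {x y : K} (hx : x ≠ 0) (hy : y ≠ 0) (e : φ x = φ y) : h x = h y := by
  have := H.ker_le (x / y) (div_ne_zero hx hy) (by rw [H.log_left.map_div hx hy, e, sub_self])
  rw [H.log_right.map_div hx hy] at this
  exact sub_eq_zero.mp this

theorem one_add_ne_zero {x : K} (hhx : h x ≠ 0) : 1 + x ≠ 0 := by
  intro e
  rw [add_comm, add_eq_zero_iff_eq_neg] at e
  exact hhx (e ▸ H.log_right.map_neg_one)

theorem add_ne_zero {a b : K} (hab : h a ≠ h b) : a + b ≠ 0 := by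
  intro e
  rw [add_eq_zero_iff_eq_neg] at e
  rw [e, H.log_right.map_neg] at hab
  exact hab rfl

theorem map_add {a b : K} (ha : a ≠ 0) (hb : b ≠ 0) (hab : h a ≠ h b) :
    φ (a + b) = φ a ∨ φ (a + b) = φ b := by
  have h1 : h (b / a) ≠ 0 := by
    rw [H.log_right.map_div hb ha]; exact sub_ne_zero.mpr hab.symm
  have h2 : φ (a + b) = φ a + φ (1 + b / a) := by
    rw [← H.log_left.map_mul _ _ ha (H.one_add_ne_zero h1)]
    congr 1; field_simp
  rcases H.rigid _ (div_ne_zero hb ha) h1 with e | e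
  · left; rw [h2, e, add_zero]
  · right; rw [h2, e, H.log_left.map_div hb ha]; abel

theorem small_inv_iff {x : K} (hx : x ≠ 0) (hhx : h x ≠ 0) :
    Small φ h x⁻¹ ↔ φ (1 + x) = φ x := by
  have h1 : φ (1 + x⁻¹) = φ (1 + x) - φ x := by
    rw [← H.log_left.map_div (H.one_add_ne_zero hhx) hx]
    congr 1; field_simp; ring
  have h2 : h x⁻¹ ≠ 0 := by rw [H.log_right.map_inv hx]; exact neg_ne_zero.mpr hhx
  simp only [Small, h1, sub_eq_zero]
  exact ⟨fun h => h.2.2, fun e => ⟨inv_ne_zero hx, h2, e⟩⟩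

theorem small_or_inv {x : K} (hx : x ≠ 0) (hhx : h x ≠ 0) : Small φ h x ∨ Small φ h x⁻¹ := by
  rw [H.small_inv_iff hx hhx]
  exact (H.rigid x hx hhx).imp (fun e => ⟨hx, hhx, e⟩) id

theorem not_small_inv {x : K} (hx : Small φ h x) : ¬ Small φ h x⁻¹ := by
  rw [H.small_inv_iff hx.1 hx.2.1, hx.2.2]
  exact (H.map_ne_zero hx.1 hx.2.1).symm

theorem one_add_small_right {x : K} (hx : Small φ h x) : h (1 + x) = 0 :=
  H.ker_le _ (H.one_add_ne_zero hx.2.1) hx.2.2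

/-- The product of two small elements differs from `1` by an element of `ker φ` or of the class of
either factor: `1 - x y` is both `(1 + x) - x (1 + y)` and `(1 + y) - y (1 + x)`. -/
theorem map_one_sub_mul {x y : K} (hx : Small φ h x) (hy : Small φ h y) :
    φ (1 - x * y) = 0 ∨ φ (1 - x * y) = φ x := by
  have e : 1 - x * y = (1 + x) + -(x * (1 + y)) := by ring
  have hx1 := H.one_add_ne_zero hx.2.1
  have hy1 := H.one_add_ne_zero hy.2.1
  have e2 : h (x * (1 + y)) = h x := by
    rw [H.log_right.map_mul _ _ hx.1 hy1, H.one_add_small_right hy, add_zero]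
  have e3 : φ (x * (1 + y)) = φ x := by
    rw [H.log_left.map_mul _ _ hx.1 hy1, hy.2.2, add_zero]
  have := H.map_add hx1 (neg_ne_zero.mpr (mul_ne_zero hx.1 hy1))
    (by rw [H.log_right.map_neg, e2, H.one_add_small_right hx]; exact hx.2.1.symm)
  rwa [← e, H.log_left.map_neg, e3, hx.2.2] at this

theorem map_one_sub_mul_eq_zero {x y : K} (hx : Small φ h x) (hy : Small φ h y)
    (hne : φ x ≠ φ y) : φ (1 - x * y) = 0 := by
  rcases H.map_one_sub_mul hx hy with e | e
  · exact e
  rcases H.map_one_sub_mul hy hx with e' | e' <;> rw [mul_comm] at e'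
  · exact e'
  · exact absurd (e.symm.trans e') hne

theorem small_neg_mul {x y : K} (hx : Small φ h x) (hy : Small φ h y) (hxy : h (x * y) ≠ 0) :
    Small φ h (-(x * y)) := by
  have h0 := mul_ne_zero hx.1 hy.1
  refine ⟨neg_ne_zero.mpr h0, by rwa [H.log_right.map_neg], ?_⟩
  rw [← sub_eq_add_neg]
  by_contra hne
  have e1 := (H.map_one_sub_mul hx hy).resolve_left hne
  have e2 := (H.rigid (-(x * y)) (neg_ne_zero.mpr h0)
    (by rwa [H.log_right.map_neg])).resolve_left (by rwa [← sub_eq_add_neg])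
  rw [← sub_eq_add_neg, e1, H.log_left.map_neg, H.log_left.map_mul _ _ hx.1 hy.1,
    left_eq_add] at e2
  exact H.map_ne_zero hy.1 hy.2.1 e2

end IsRigidPair

/-- The closure properties of the small elements from which the valuation ring is built. -/
structure IsCoherentPair (φ : K → A) (h : K → B) : Prop extends IsRigidPair φ h where
  neg_small : ∀ x, Small φ h x → Small φ h (-x)
  mul_small : ∀ x y, Small φ h x → Small φ h y → h (x * y) = 0 →
    ∀ z, Small φ h z → Small φ h (x * y * z)
  one_add_small : ∀ x, Small φ h x → ∀ z, Small φ h z → Small φ h ((1 + x) * z)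
  one_add_unit : ∀ x, x ≠ 0 → 1 + x ≠ 0 → φ x = 0 → φ (1 + x) = 0 →
    (∀ z, Small φ h z → Small φ h (x * z)) → ∀ z, Small φ h z → Small φ h ((1 + x) * z)

namespace IsCoherentPair

variable {φ : K → A} {h : K → B} (H : IsCoherentPair φ h)
include H

theorem small_mul {x y : K} (hx : Small φ h x) (hy : Small φ h y) (hxy : h (x * y) ≠ 0) :
    Small φ h (x * y) := by
  simpa using H.neg_small _ (H.small_neg_mul hx hy hxy)

/-- The valuation ring of a coherent pair consists of `0`, the small elements, and the elements of
`ker h` that preserve the set of small elements under multiplication. -/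
theorem exists_valuationSubring :
    ∃ v : ValuationSubring K, ∀ x, v.valuation x = 1 → h x = 0 := by
  set O : K → Prop := fun x => x = 0 ∨ Small φ h x ∨
    (x ≠ 0 ∧ h x = 0 ∧ ∀ z, Small φ h z → Small φ h (x * z)) with hO
  have mul_mem : ∀ {x y : K}, O x → O y → O (x * y) := by
    rintro x y (rfl | hx | ⟨hx0, hx, hx'⟩) (rfl | hy | ⟨hy0, hy, hy'⟩)
    · left; ring
    · left; ring
    · left; ring
    · left; ring
    · by_cases hxy : h (x * y) = 0
      · exact Or.inr (Or.inr ⟨mul_ne_zero hx.1 hy.1, hxy, H.mul_small x y hx hy hxy⟩)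
      · exact Or.inr (Or.inl (H.small_mul hx hy hxy))
    · exact Or.inr (Or.inl (mul_comm y x ▸ hy' x hx))
    · left; ring
    · exact Or.inr (Or.inl (hx' y hy))
    · refine Or.inr (Or.inr ⟨mul_ne_zero hx0 hy0, ?_, fun z hz => ?_⟩)
      · rw [H.log_right.map_mul _ _ hx0 hy0, hx, hy, add_zero]
      · rw [mul_assoc]; exact hx' _ (hy' _ hz)
  have mem_or_inv : ∀ x : K, O x ∨ O x⁻¹ := by
    intro x
    by_cases hx : x = 0
    · exact Or.inl (Or.inl hx)
    by_cases hhx : h x = 0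
    · have hhx' : h x⁻¹ = 0 := by rw [H.log_right.map_inv hx, hhx, neg_zero]
      by_contra! hcon
      have h1 : ¬ ∀ z, Small φ h z → Small φ h (x * z) := fun e =>
        hcon.1 (Or.inr (Or.inr ⟨hx, hhx, e⟩))
      have h2 : ¬ ∀ z, Small φ h z → Small φ h (x⁻¹ * z) := fun e =>
        hcon.2 (Or.inr (Or.inr ⟨inv_ne_zero hx, hhx', e⟩))
      push Not at h1 h2
      obtain ⟨y, hy, hxy⟩ := h1
      obtain ⟨z, hz, hxz⟩ := h2
      have hxyh : h (x * y) ≠ 0 := by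
        rw [H.log_right.map_mul _ _ hx hy.1, hhx, zero_add]; exact hy.2.1
      have a := (H.small_or_inv (mul_ne_zero hx hy.1) hxyh).resolve_left hxy
      -- `y * (x * y)⁻¹ = x⁻¹` is a product of two small elements.
      have := mul_mem (Or.inr (Or.inl hy)) (Or.inr (Or.inl a))
      have hy0 := hy.1
      rw [show y * (x * y)⁻¹ = x⁻¹ by field_simp] at this
      exact hcon.2 this
    · exact (H.small_or_inv hx hhx).imp (fun e => Or.inr (Or.inl e)) (fun e => Or.inr (Or.inl e))
  have neg_mem : ∀ {x : K}, O x → O (-x) := by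
    rintro x (rfl | hx | ⟨hx0, hx, hx'⟩)
    · left; simp
    · exact Or.inr (Or.inl (H.neg_small x hx))
    · refine Or.inr (Or.inr ⟨neg_ne_zero.mpr hx0, by rwa [H.log_right.map_neg], fun z hz => ?_⟩)
      rw [neg_mul]; exact H.neg_small _ (hx' z hz)
  have one_mem : O 1 := Or.inr (Or.inr ⟨one_ne_zero, H.log_right.map_one, by simp⟩)
  have one_add : ∀ {x : K}, O x → O (1 + x) := by
    rintro x (rfl | hx | ⟨hx0, hx, hx'⟩)
    · simpa using one_mem
    · exact Or.inr (Or.inr ⟨H.one_add_ne_zero hx.2.1, H.one_add_small_right hx,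
        H.one_add_small x hx⟩)
    · by_cases h1x : 1 + x = 0
      · exact Or.inl h1x
      by_cases hh : h (1 + x) = 0
      · refine Or.inr (Or.inr ⟨h1x, hh, ?_⟩)
        by_cases hφ : φ x = 0 ∧ φ (1 + x) = 0
        · exact H.one_add_unit x hx0 h1x hφ.1 hφ.2 hx'
        intro z hz
        have hzx := hx' z hz
        have hz' : h ((1 + x) * z) = h z := by
          rw [H.log_right.map_mul _ _ h1x hz.1, hh, zero_add]
        have hm : (1 + x) * z ≠ 0 := mul_ne_zero h1x hz.1
        refine ⟨hm, by rw [hz']; exact hz.2.1, ?_⟩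
        by_contra hne
        -- `1 + (1 + x) z` lies in three different cosets.
        have e1 := H.map_add (H.one_add_ne_zero hz.2.1) hzx.1
          (by rw [H.one_add_small_right hz]; exact hzx.2.1.symm)
        have e2 := H.map_add (H.one_add_ne_zero hzx.2.1) hz.1
          (by rw [H.one_add_small_right hzx]; exact hz.2.1.symm)
        have e3 := H.rigid _ hm (by rw [hz']; exact hz.2.1)
        rw [show 1 + z + x * z = 1 + (1 + x) * z by ring, hz.2.2] at e1
        rw [show 1 + x * z + z = 1 + (1 + x) * z by ring, hzx.2.2] at e2
        have e1 := e1.resolve_left hne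
        have e2 := e2.resolve_left hne
        have e3 := e3.resolve_left hne
        rw [H.log_left.map_mul _ _ hx0 hz.1] at e1
        rw [H.log_left.map_mul _ _ h1x hz.1] at e3
        exact hφ ⟨by rwa [e2, right_eq_add] at e1, by rwa [e2, right_eq_add] at e3⟩
      · refine Or.inr (Or.inl ?_)
        refine (H.small_or_inv h1x hh).resolve_right fun hr => hh ?_
        have := (H.neg_small _ hr).2.2
        rw [show 1 + -(1 + x)⁻¹ = x / (1 + x) by field_simp; ring,
          H.log_left.map_div hx0 h1x, sub_eq_zero] at this
        rw [← H.map_left_eq hx0 h1x this, hx]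
  have add_mem : ∀ {x y : K}, O x → O y → O (x + y) := by
    intro x y hx hy
    by_cases hx0 : x = 0
    · rwa [hx0, zero_add]
    by_cases hy0 : y = 0
    · rwa [hy0, add_zero]
    rcases mem_or_inv (x / y) with e | e
    · have := mul_mem hy (one_add e)
      rwa [show y * (1 + x / y) = x + y by field_simp; ring] at this
    · rw [inv_div] at e
      have := mul_mem hx (one_add e)
      rwa [show x * (1 + y / x) = x + y by field_simp] at this
  let v : ValuationSubring K :=
    { carrier := {x | O x}
      mul_mem' := mul_mem
      one_mem' := one_mem
      add_mem' := add_mem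
      zero_mem' := Or.inl rfl
      neg_mem' := neg_mem
      mem_or_inv_mem' := mem_or_inv }
  have hmem : ∀ x, x ∈ v ↔ O x := fun x => Iff.rfl
  refine ⟨v, fun x hx => ?_⟩
  have h0 : x ≠ 0 := by rintro rfl; simp at hx
  have h1 : O x := (hmem x).mp (mem_of_valuation_eq_one hx)
  have h2 : O x⁻¹ := (hmem _).mp (mem_of_valuation_eq_one (by rw [map_inv₀, hx, inv_one]))
  rcases h1 with h1 | h1 | h1
  · exact absurd h1 h0
  · rcases h2 with h2 | h2 | h2
    · exact absurd h2 (inv_ne_zero h0)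
    · exact absurd h2 (H.not_small_inv h1)
    · rw [H.log_right.map_inv h0, neg_eq_zero] at h2
      exact h2.2.1
  · exact h1.2.1

end IsCoherentPair

/-- If the target of `h` has no `2`-torsion, then rigidity suffices. -/
theorem IsRigidPair.isCoherentPair_of_two_torsion_free {φ : K → A} {h : K → B}
    (H : IsRigidPair φ h) (h2 : ∀ b : B, b + b = 0 → b = 0) : IsCoherentPair φ h := by
  have neg_small : ∀ x, Small φ h x → Small φ h (-x) := by
    intro x hx
    have hnx : h (-x) ≠ 0 := by rw [H.log_right.map_neg]; exact hx.2.1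
    refine ⟨neg_ne_zero.mpr hx.1, hnx, ?_⟩
    by_contra hne
    have e1 := (H.rigid _ (neg_ne_zero.mpr hx.1) hnx).resolve_left hne
    have hxx : h (-(x * x)) ≠ 0 := by
      rw [H.log_right.map_neg, H.log_right.map_mul _ _ hx.1 hx.1]
      exact fun e => hx.2.1 (h2 _ e)
    have e2 := H.rigid _ (neg_ne_zero.mpr (mul_ne_zero hx.1 hx.1)) hxx
    rw [show 1 + -(x * x) = (1 + x) * (1 + -x) by ring, H.log_left.map_mul _ _
      (H.one_add_ne_zero hx.2.1) (H.one_add_ne_zero hnx), e1, hx.2.2, H.log_left.map_neg,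
      H.log_left.map_neg, H.log_left.map_mul _ _ hx.1 hx.1, zero_add, left_eq_add, or_self] at e2
    exact H.map_ne_zero hx.1 hx.2.1 e2
  have small_mul : ∀ {x y : K}, Small φ h x → Small φ h y → h (x * y) ≠ 0 → Small φ h (x * y) := by
    intro x y hx hy hxy
    simpa using neg_small _ (H.small_neg_mul hx hy hxy)
  have log_mul := H.log_right.map_mul
  have mul_small : ∀ x y, Small φ h x → Small φ h y → h (x * y) = 0 →
      ∀ z, Small φ h z → Small φ h (x * y * z) := by
    intro x y hx hy hxy z hz
    have hxyz : h (x * y * z) ≠ 0 := by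
      rw [log_mul _ _ (mul_ne_zero hx.1 hy.1) hz.1, hxy, zero_add]; exact hz.2.1
    by_cases hxz : h (x * z) = 0
    · by_cases hyz : h (y * z) = 0
      · rw [log_mul _ _ hx.1 hy.1] at hxy
        rw [log_mul _ _ hx.1 hz.1] at hxz
        rw [log_mul _ _ hy.1 hz.1] at hyz
        refine absurd (h2 _ ?_) hx.2.1
        have : h x + h x = (h x + h y) + (h x + h z) - (h y + h z) := by abel
        rw [this, hxy, hxz, hyz]; simp
      · have e : x * y * z = x * (y * z) := by ring
        rw [e] at hxyz ⊢
        exact small_mul hx (small_mul hy hz hyz) hxyz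
    · have e : x * y * z = (x * z) * y := by ring
      rw [e] at hxyz ⊢
      exact small_mul (small_mul hx hz hxz) hy hxyz
  have one_add_aux : ∀ x, Small φ h x → ∀ z, Small φ h z → h (x * z) ≠ 0 →
      Small φ h ((1 + x) * z) := by
    intro x hx z hz hxz
    have hx1 := H.one_add_ne_zero hx.2.1
    have e0 : h ((1 + x) * z) = h z := by
      rw [log_mul _ _ hx1 hz.1, H.one_add_small_right hx, zero_add]
    have e0' : φ ((1 + x) * z) = φ z := by
      rw [H.log_left.map_mul _ _ hx1 hz.1, hx.2.2, zero_add]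
    refine ⟨mul_ne_zero hx1 hz.1, by rw [e0]; exact hz.2.1, ?_⟩
    by_contra hne
    have e1 := H.map_add (H.one_add_ne_zero hz.2.1) (mul_ne_zero hx.1 hz.1)
      (by rw [H.one_add_small_right hz]; exact hxz.symm)
    have e2 := H.rigid _ (mul_ne_zero hx1 hz.1) (by rw [e0]; exact hz.2.1)
    rw [show 1 + z + x * z = 1 + (1 + x) * z by ring, hz.2.2] at e1
    have e1 := e1.resolve_left hne
    rw [e2.resolve_left hne, e0', H.log_left.map_mul _ _ hx.1 hz.1, right_eq_add] at e1
    exact H.map_ne_zero hx.1 hx.2.1 e1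
  refine { H with neg_small := neg_small, mul_small := mul_small, one_add_small := ?_,
                  one_add_unit := ?_ }
  · intro x hx z hz
    by_cases hxz : h (x * z) = 0
    · have hx1 := H.one_add_ne_zero hx.2.1
      have e0 : h ((1 + x) * z) = h z := by
        rw [log_mul _ _ hx1 hz.1, H.one_add_small_right hx, zero_add]
      refine (H.small_or_inv (mul_ne_zero hx1 hz.1) (by rw [e0]; exact hz.2.1)).resolve_right ?_
      -- Otherwise the argument applies to `x` and `w = ((1 + x) z)⁻¹`.
      intro hw
      have hxw : h (x * ((1 + x) * z)⁻¹) ≠ 0 := by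
        rw [log_mul _ _ hx.1 hw.1, H.log_right.map_inv (mul_ne_zero hx1 hz.1), e0]
        rw [log_mul _ _ hx.1 hz.1] at hxz
        intro e
        refine hx.2.1 (h2 _ ?_)
        have : h x + h x = (h x + h z) + (h x + -h z) := by abel
        rw [this, hxz, e, add_zero]
      have := one_add_aux x hx _ hw hxw
      have hz0 := hz.1
      rw [show (1 + x) * ((1 + x) * z)⁻¹ = z⁻¹ by field_simp] at this
      exact H.not_small_inv hz this
    · exact one_add_aux x hx z hz hxz
  · intro x hx0 h1x hφ hφ1 hx z hz
    have hxz := hx z hz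
    have e0 : h ((1 + x) * z) = h z := by
      rw [log_mul _ _ h1x hz.1, H.ker_le _ h1x hφ1, zero_add]
    have e0' : φ ((1 + x) * z) = φ z := by
      rw [H.log_left.map_mul _ _ h1x hz.1, hφ1, zero_add]
    have hm := mul_ne_zero h1x hz.1
    have hhm : h ((1 + x) * z) ≠ 0 := by rw [e0]; exact hz.2.1
    refine ⟨hm, hhm, ?_⟩
    by_contra hne
    have e2 := (H.rigid _ hm hhm).resolve_left hne
    rw [e0'] at e2
    have e3 : h (1 + (1 + x) * z) = h z :=
      H.map_left_eq (H.one_add_ne_zero hhm) hz.1 e2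
    have e4 : h (x * z * z) = h z + h z := by
      rw [log_mul _ _ hxz.1 hz.1, log_mul _ _ hx0 hz.1, H.ker_le _ hx0 hφ, zero_add]
    have e4' : φ (x * z * z) = φ z + φ z := by
      rw [H.log_left.map_mul _ _ hxz.1 hz.1, H.log_left.map_mul _ _ hx0 hz.1, hφ, zero_add]
    -- Expand `(1 + z) (1 + x z) ∈ ker φ`.
    have e5 := H.map_add (H.one_add_ne_zero hhm) (mul_ne_zero hxz.1 hz.1)
      (by rw [e3, e4]; simpa using hz.2.1)
    rw [show 1 + (1 + x) * z + x * z * z = (1 + z) * (1 + x * z) by ring,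
      H.log_left.map_mul _ _ (H.one_add_ne_zero hz.2.1) (H.one_add_ne_zero hxz.2.1), hz.2.2,
      hxz.2.2, e2, e4', add_zero] at e5
    rcases e5 with e5 | e5
    · exact H.map_ne_zero hz.1 hz.2.1 e5.symm
    · refine hz.2.1 (h2 _ ?_)
      rw [← e4]
      exact H.ker_le _ (mul_ne_zero hxz.1 hz.1) (by rw [e4', ← e5])

end

/-! ### Rigidity in exponent two -/

section

variable {K : Type*} [Field K]

variable {A B : Type*} [AddCommGroup A] [AddCommGroup B]

/-- A class `c` is degenerate if the product of two small elements of this class does not exceed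
the small elements of the other classes. When all non-trivial classes are rigid, at most one class
is degenerate, and outside of it small elements behave as expected. -/
def IsDegenerate (φ : K → A) (c : A) : Prop :=
  ∃ p q, Small φ φ p ∧ Small φ φ q ∧ φ p = c ∧ φ q = c ∧
    ∀ u, Small φ φ u → φ u ≠ c → Small φ φ (u / (p * q))

theorem eq_of_add_eq_zero_of_exponent_two (h2 : ∀ a : A, a + a = 0) {a b : A}
    (hab : a + b = 0) : a = b := by
  rw [add_eq_zero_iff_eq_neg.mp hab, neg_eq_of_add_eq_zero_left (h2 b)]

/-- For `u` in another class than the large element `m`, the sum `1 + u + m` is in the class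
of `m`. -/
theorem map_one_add_small_add_large {φ : K → A} (H : IsRigidPair φ φ) {u m : K}
    (hu : Small φ φ u) (hm : Small φ φ m⁻¹) (hne : φ u ≠ φ m) : φ (1 + u + m) = φ m := by
  have hm0 : m ≠ 0 := fun e => hm.1 (by rw [e, inv_zero])
  have hmφ : φ m ≠ 0 := by
    have := hm.2.1
    rw [H.log_left.map_inv hm0] at this
    exact neg_ne_zero.mp this
  have e := (H.small_inv_iff hm0 hmφ).mp hm
  have e1 := H.map_add (H.one_add_ne_zero hu.2.1) hm0 (by rw [hu.2.2]; exact hmφ.symm)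
  have e2 := H.map_add (H.one_add_ne_zero hmφ) hu.1 (by rw [e]; exact hne.symm)
  rw [show 1 + m + u = 1 + u + m by ring, e] at e2
  rw [hu.2.2] at e1
  refine e1.resolve_left fun e0 => ?_
  rw [e0] at e2
  exact e2.elim hmφ.symm hu.2.1.symm

section

variable {φ : K → A} (H : IsRigidPair φ φ) (h2 : ∀ a : A, a + a = 0)
include H h2

theorem small_neg_mul_of_ne {x y : K} (hx : Small φ φ x) (hy : Small φ φ y) (hxy : φ x ≠ φ y) :
    Small φ φ (-(x * y)) := by
  refine H.small_neg_mul hx hy fun e => hxy ?_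
  rw [H.log_left.map_mul _ _ hx.1 hy.1] at e
  exact eq_of_add_eq_zero_of_exponent_two h2 e

theorem IsDegenerate.eq {c c' : A} (hc : IsDegenerate φ c) (hc' : IsDegenerate φ c') : c = c' := by
  by_contra hne
  obtain ⟨p, q, hp, hq, rfl, hqc, h⟩ := hc
  obtain ⟨p', q', hp', hq', rfl, hqc', h'⟩ := hc'
  have aux : ∀ {p q p' q' : K}, Small φ φ p → Small φ φ p' → Small φ φ q' → φ q' = φ p' →
      φ p ≠ φ p' → Small φ φ (p / (p' * q')) → Small φ φ (-(p / p')) := by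
    intro p q p' q' hp hp' hq' e hne hs
    have hq0 := hq'.1
    have e1 : φ (p / (p' * q')) = φ p := by
      rw [H.log_left.map_div hp.1 (mul_ne_zero hp'.1 hq'.1), H.log_left.map_mul _ _ hp'.1 hq'.1,
        e, h2, sub_zero]
    have := small_neg_mul_of_ne H h2 hs hq' (by rw [e1, e]; exact hne)
    rwa [show p / (p' * q') * q' = p / p' by field_simp] at this
  have e1 := aux (q := q) hp hp' hq' hqc' hne (h' p hp hne)
  have e2 := aux (q := q) hp' hp hq hqc (Ne.symm hne) (h p' hp' (Ne.symm hne))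
  refine H.not_small_inv e1 ?_
  rwa [inv_neg, inv_div]

/-- Four small elements of the same class with product `1` make this class degenerate. -/
theorem isDegenerate_of_mul_eq_one {x y z w : K} (hx : Small φ φ x) (hy : Small φ φ y)
    (hz : Small φ φ z) (hw : Small φ φ w) (hxy : φ x = φ y) (hxz : φ x = φ z) (hxw : φ x = φ w)
    (h1 : x * y * z * w = 1) : IsDegenerate φ (φ x) := by
  refine ⟨x, y, hx, hy, rfl, hxy.symm, fun u hu hux => ?_⟩
  have e1 := small_neg_mul_of_ne H h2 hu hz (by rwa [← hxz])
  have e2 := small_neg_mul_of_ne H h2 e1 hw (by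
    rw [H.log_left.map_neg, H.log_left.map_mul _ _ hu.1 hz.1, ← hxz, ← hxw]
    simpa using H.map_ne_zero hu.1 hu.2.1)
  rw [show u / (x * y) = -(-(u * z) * w) by
    rw [div_eq_iff (mul_ne_zero hx.1 hy.1)]; linear_combination (-u) * h1]
  exact e2

/-- If all non-trivial classes are rigid and `η` kills the degenerate class, then `φ` and `η ∘ φ`
form a coherent pair. -/
theorem isCoherentPair_of_exponent_two (η : A →+ B) (hη : ∀ c, IsDegenerate φ c → η c = 0) :
    IsCoherentPair φ (fun x => η (φ x)) := by
  have hs : ∀ {x}, Small φ (fun x => η (φ x)) x → Small φ φ x := fun {x} hx =>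
    ⟨hx.1, fun e => hx.2.1 (by simp [e]), hx.2.2⟩
  have log_mul := H.log_left.map_mul
  have eqz := @eq_of_add_eq_zero_of_exponent_two A _ h2
  have neg : ∀ a : A, -a = a := fun a => neg_eq_of_add_eq_zero_left (h2 a)
  -- Elements of a given class are small as soon as their inverses are not.
  have of_not_inv : ∀ {x}, x ≠ 0 → η (φ x) ≠ 0 → ¬ Small φ φ x⁻¹ →
      Small φ (fun x => η (φ x)) x := by
    intro x hx hηx hn
    have := (H.small_or_inv hx (fun e => hηx (by simp [e]))).resolve_right hn
    exact ⟨hx, hηx, this.2.2⟩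
  refine
    { log_left := H.log_left
      log_right := ⟨fun x y hx hy => by simp [log_mul x y hx hy],
        by simp [H.log_left.map_neg_one]⟩
      ker_le := fun x _ e => by simp [e]
      rigid := fun x hx hηx => H.rigid x hx fun e => hηx (by simp [e])
      neg_small := ?_
      mul_small := ?_
      one_add_small := ?_
      one_add_unit := ?_ }
  -- Otherwise `x` and `(-x)⁻¹` are both small, and `x (-x)⁻¹ x (-x)⁻¹ = 1`.
  · intro x hx
    refine of_not_inv (neg_ne_zero.mpr hx.1) (by rw [H.log_left.map_neg]; exact hx.2.1) ?_
    intro hinv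
    have e : φ x = φ (-x)⁻¹ := by
      rw [H.log_left.map_inv (neg_ne_zero.mpr hx.1), H.log_left.map_neg, neg]
    refine hx.2.1 (hη _ (isDegenerate_of_mul_eq_one H h2 (hs hx) hinv (hs hx) hinv e rfl e ?_))
    have := hx.1
    field_simp
  -- Otherwise `x`, `y`, `z` and `(x y z)⁻¹` are small elements of the same class.
  · intro x y hx hy hxy z hz
    have hxy0 := mul_ne_zero hx.1 hy.1
    have hx0 := hx.1
    have hy0 := hy.1
    have hz0 := hz.1
    refine of_not_inv (mul_ne_zero hxy0 hz.1) (by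
      rw [log_mul _ _ hxy0 hz.1, _root_.map_add, hxy, zero_add]; exact hz.2.1) ?_
    intro hw
    -- If two of the elements `a`, `b` of a quadruple with product one are in different classes,
    -- then `1 - c d = 1 - (a b)⁻¹` is in the class of `a b`.
    have aux : ∀ {a b c d : K}, Small φ φ a → Small φ φ b → Small φ φ c → Small φ φ d →
        a * b * c * d = 1 → φ a ≠ φ b → φ a + φ b = φ c := by
      intro a b c d ha hb hc hd h1 hne
      have hab0 := mul_ne_zero ha.1 hb.1
      have hab : φ (a * b) ≠ 0 := by
        rw [log_mul _ _ ha.1 hb.1]; exact fun e => hne (eqz e)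
      have e0 := H.map_one_sub_mul_eq_zero ha hb hne
      have e1 : 1 - c * d = -((1 - a * b) / (a * b)) := by
        rw [eq_inv_of_mul_eq_one_right (show a * b * (c * d) = 1 by rw [← h1]; ring)]
        rw [sub_div, div_self hab0, one_div]
        ring
      have e2 : φ (1 - c * d) = φ (a * b) := by
        rw [e1, H.log_left.map_neg, H.log_left.map_div _ hab0, e0, zero_sub, neg]
        intro e
        rw [sub_eq_zero] at e
        exact hab (e ▸ H.log_left.map_one)
      rw [← log_mul _ _ ha.1 hb.1, ← e2]
      exact (H.map_one_sub_mul hc hd).resolve_left (by rwa [e2])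
    have h1 : x * y * z * (x * y * z)⁻¹ = 1 := mul_inv_cancel₀ (mul_ne_zero hxy0 hz.1)
    have e1 : φ x = φ y := by
      by_contra hne
      have := aux (hs hx) (hs hy) (hs hz) hw h1 hne
      rw [← log_mul _ _ hx.1 hy.1] at this
      exact hz.2.1 (by simp only at hxy ⊢; rw [← this, hxy])
    have e2 : φ x = φ z := by
      by_contra hne
      have := aux (hs hx) (hs hz) (hs hy) hw (by rw [← h1]; ring) hne
      rw [← e1, add_eq_left] at this
      exact (hs hz).2.1 this
    have e3 : φ x = φ (x * y * z)⁻¹ := by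
      rw [H.log_left.map_inv (mul_ne_zero hxy0 hz.1), log_mul _ _ hxy0 hz.1,
        log_mul _ _ hx.1 hy.1, ← e1, h2, zero_add, neg, e2]
    exact hx.2.1 (hη _ (isDegenerate_of_mul_eq_one H h2 (hs hx) (hs hy) (hs hz) hw e1 e2 e3 h1))
  -- Otherwise `x` and `z` are in the same class, and the class of `1 + u + (1 + x) z` shows that
  -- `u / (z x)` is small for every small `u` in another class.
  · intro x hx z hz
    have hx1 := H.one_add_ne_zero (hs hx).2.1
    have hm0 := mul_ne_zero hx1 hz.1
    have hx0 := hx.1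
    have hz0 := hz.1
    have e0 : φ ((1 + x) * z) = φ z := by rw [log_mul _ _ hx1 hz.1, hx.2.2, zero_add]
    refine of_not_inv hm0 (by rw [e0]; exact hz.2.1) fun hw => ?_
    have hxz : φ x = φ z := by
      by_contra hne
      have hxz0 : φ (x * z) ≠ 0 := by
        rw [log_mul _ _ hx.1 hz.1]; exact fun e => hne (eqz e)
      have e1 := H.map_add (H.one_add_ne_zero (hs hz).2.1) (mul_ne_zero hx.1 hz.1)
        (by rw [hz.2.2]; exact hxz0.symm)
      have e2 := (H.small_inv_iff hm0 (by rw [e0]; exact (hs hz).2.1)).mp hw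
      rw [show 1 + z + x * z = 1 + (1 + x) * z by ring, e2, e0, hz.2.2,
        log_mul _ _ hx.1 hz.1, right_eq_add] at e1
      exact e1.elim (hs hz).2.1 (hs hx).2.1
    refine hz.2.1 (hη _ ⟨z, x, hs hz, hs hx, rfl, hxz, fun u hu hne => ?_⟩)
    have hu0 := hu.1
    have hzx0 : φ (z * x) = 0 := by rw [log_mul _ _ hz.1 hx.1, hxz, h2]
    have hdiv : φ (u / (z * x)) = φ u := by
      rw [H.log_left.map_div hu.1 (mul_ne_zero hz.1 hx.1), hzx0, sub_zero]
    refine (H.small_or_inv (div_ne_zero hu.1 (mul_ne_zero hz.1 hx.1))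
      (by rw [hdiv]; exact hu.2.1)).resolve_right fun hinv => ?_
    have e1 : φ (u + z * x) = φ u := by
      have := log_mul u _ hu.1 (H.one_add_ne_zero hinv.2.1)
      rw [hinv.2.2, add_zero] at this
      rw [← this]; congr 1; field_simp
    have e2 := map_one_add_small_add_large H hu hw (by rwa [e0])
    have e3 := H.map_add (a := 1 + z) (b := u + z * x) (H.one_add_ne_zero (hs hz).2.1)
      (H.add_ne_zero (by rw [hzx0]; exact hu.2.1)) (by rw [hz.2.2, e1]; exact hu.2.1.symm)
    rw [show 1 + z + (u + z * x) = 1 + u + (1 + x) * z by ring, e2, e0, hz.2.2, e1] at e3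
    exact e3.elim (hs hz).2.1 (Ne.symm hne)
  -- Otherwise `u / z` is small for every small `u` in another class, hence so is `u / (z z)`.
  · intro x hx0 hx1 hφ hφ1 hx z hz
    have hm0 := mul_ne_zero hx1 hz.1
    have hz0 := hz.1
    have e0 : φ ((1 + x) * z) = φ z := by rw [log_mul _ _ hx1 hz.1, hφ1, zero_add]
    refine of_not_inv hm0 (by rw [e0]; exact hz.2.1) fun hw => ?_
    have hxz := hx z hz
    have step : ∀ u, Small φ φ u → φ u ≠ φ z → Small φ φ (u / z) ∧ φ (u / z) ≠ φ z := by
      intro u hu hne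
      have hu0 := hu.1
      have hdiv : φ (u / z) = φ u + φ z := by
        rw [H.log_left.map_div hu.1 hz.1, sub_eq_add_neg, neg]
      refine ⟨(H.small_or_inv (div_ne_zero hu.1 hz.1) (by
        rw [hdiv]; exact fun e => hne (eqz e))).resolve_right fun hinv => ?_, by
        rw [hdiv, Ne, add_eq_right]; exact hu.2.1⟩
      have e1 : φ (u + z) = φ u := by
        have := log_mul u _ hu.1 (H.one_add_ne_zero hinv.2.1)
        rw [hinv.2.2, add_zero] at this
        rw [← this]; congr 1; field_simp
      have e2 := map_one_add_small_add_large H hu hw (by rwa [e0])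
      have e3 := H.map_add (a := 1 + x * z) (b := u + z) (H.one_add_ne_zero (hs hxz).2.1)
        (H.add_ne_zero hne) (by rw [hxz.2.2, e1]; exact hu.2.1.symm)
      rw [show 1 + x * z + (u + z) = 1 + u + (1 + x) * z by ring, e2, e0, hxz.2.2, e1] at e3
      exact e3.elim (hs hz).2.1 (Ne.symm hne)
    refine hz.2.1 (hη _ ⟨z, z, hs hz, hs hz, rfl, rfl, fun u hu hne => ?_⟩)
    have := (step _ (step u hu hne).1 (step u hu hne).2).1
    rwa [div_div] at this

end

end

/-! ### Collinear pairs of logarithmic functions -/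

section

variable {K : Type*} [Field K]

variable {F : Type*} [Field F]

/-- The values of `(f, g)` at `x`, `y` and `x + y` are collinear points of the affine plane
over `F`. -/
def IsCollinear (f g : K → F) : Prop :=
  ∀ x y, x ≠ 0 → y ≠ 0 → x + y ≠ 0 →
    (f x - f (x + y)) * (g y - g (x + y)) = (f y - f (x + y)) * (g x - g (x + y))

/-- The point `(f z, g z)` of the affine plane has homogeneous coordinates `(u : v : w)`, for the
embedding of the affine plane as the plane of vectors with coordinate sum `1`. -/
def HasCoords (f g : K → F) (z : K) (u v w : F) : Prop :=
  z ≠ 0 ∧ ∃ c, 1 - f z - g z = c * u ∧ f z = c * v ∧ g z = c * w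

theorem HasCoords.neg {f g : K → F} (hf : IsLog f) (hg : IsLog g) {z : K} {u v w : F}
    (h : HasCoords f g z u v w) : HasCoords f g (-z) u v w := by
  obtain ⟨h0, c, h1, h2, h3⟩ := h
  exact ⟨neg_ne_zero.mpr h0, c, by rw [hf.map_neg, hg.map_neg, h1],
    by rw [hf.map_neg, h2], by rw [hg.map_neg, h3]⟩

/-- Collinearity in homogeneous coordinates. -/
theorem HasCoords.det_eq_zero {f g : K → F} (hcol : IsCollinear f g) {z z' : K}
    {u v w u' v' w' : F} (h : HasCoords f g z u v w) (h' : HasCoords f g z' u' v' w')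
    (h0 : z + z' ≠ 0) :
    (1 - f (z + z') - g (z + z')) * (v * w' - v' * w) - f (z + z') * (u * w' - u' * w) +
      g (z + z') * (u * v' - u' * v) = 0 := by
  obtain ⟨hz, c, h1, h2, h3⟩ := h
  obtain ⟨hz', c', h1', h2', h3'⟩ := h'
  have hc : c * (u + v + w) = 1 := by linear_combination -h1 - h2 - h3
  have hc' : c' * (u' + v' + w') = 1 := by linear_combination -h1' - h2' - h3'
  have hc0 := left_ne_zero_of_mul (hc.trans_ne one_ne_zero)
  have hc0' := left_ne_zero_of_mul (hc'.trans_ne one_ne_zero)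
  have key := hcol z z' hz hz' h0
  rw [h2, h3, h2', h3'] at key
  refine (mul_eq_zero.mp ?_).resolve_left (mul_ne_zero hc0 hc0')
  have e1 : c * u = 1 - c * v - c * w := by linear_combination hc
  have e1' : c' * u' = 1 - c' * v' - c' * w' := by linear_combination hc'
  linear_combination key - f (z + z') * (c' * w') * e1 + f (z + z') * (c * w) * e1' +
    g (z + z') * (c' * v') * e1 - g (z + z') * (c * v) * e1'

section

variable {f g : K → F} (hf : IsLog f) (hg : IsLog g) (hcol : IsCollinear f g)
include hf hg hcol

/-- If on two sides of the triangle of lines through `1`, `x`, `y` there is a value of `(f, g)`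
different from the vertices, then on the line through `1` and `x` the function `f` is given by a
fractional linear function. The values at the points `n + x` and `n + x + y` are determined
inductively as intersections of two lines. -/
theorem map_natCast_add_of_collinear (hnat : ∀ n : ℕ, (n : K) ≠ 0 → f n = 0 ∧ g n = 0) {x y : K}
    (hx : x ≠ 0) (hy : y ≠ 0) (hfx : f x = 1) (hgx : g x = 0) (hfy : f y = 0) (hgy : g y = 1)
    {a b : F} (ha0 : a ≠ 0) (ha1 : a ≠ 1) (hb0 : b ≠ 0) (hb1 : b ≠ 1) (hf1x : f (1 + x) = a)
    (hg1x : g (1 + x) = 0) (hf1y : f (1 + y) = 0) (hg1y : g (1 + y) = b) (n : ℕ) :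
    (n + a / (1 - a)) * f (n + x) = a / (1 - a) := by
  have ha : 1 - a ≠ 0 := sub_ne_zero.mpr ha1.symm
  have hb : 1 - b ≠ 0 := sub_ne_zero.mpr hb1.symm
  have hxn : ∀ n : ℕ, (n : K) + x ≠ 0 := by
    intro n e
    have hxe : x = -n := by linear_combination e
    have h0 : (n : K) ≠ 0 := fun h => hx (by rw [hxe, h, neg_zero])
    rw [hxe, hf.map_neg, (hnat n h0).1] at hfx
    exact zero_ne_one hfx
  have hyn : 1 + y ≠ 0 := by
    intro e
    have hye : y = -1 := by linear_combination e
    rw [hye, hg.map_neg_one] at hgy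
    exact zero_ne_one hgy
  have hxy : x + y ≠ 0 := by
    intro e
    have hxe : x = -y := by linear_combination e
    rw [hxe, hf.map_neg, hfy] at hfx
    exact zero_ne_one hfx
  obtain ⟨x0, hx0⟩ : ∃ x0, x0 = a / (1 - a) := ⟨_, rfl⟩
  obtain ⟨y0, hy0⟩ : ∃ y0, y0 = b / (1 - b) := ⟨_, rfl⟩
  rw [← hx0]
  have hx00 : x0 ≠ 0 := hx0 ▸ div_ne_zero ha0 ha
  have hy00 : y0 ≠ 0 := hy0 ▸ div_ne_zero hb0 hb
  have G1 : HasCoords f g 1 1 0 0 := ⟨one_ne_zero, 1, by rw [hf.map_one, hg.map_one]; ring,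
    by rw [hf.map_one]; ring, by rw [hg.map_one]; ring⟩
  have Gx : HasCoords f g x 0 x0 0 := ⟨hx, 1 / x0, by rw [hfx, hgx]; ring,
    by rw [hfx]; field_simp, by rw [hgx]; ring⟩
  have Gy : HasCoords f g y 0 0 y0 := ⟨hy, 1 / y0, by rw [hfy, hgy]; ring,
    by rw [hfy]; ring, by rw [hgy]; field_simp⟩
  have G1x : HasCoords f g (1 + x) 1 x0 0 := ⟨by simpa using hxn 1, 1 - a, by
    rw [hf1x, hg1x]; ring, by rw [hf1x, hx0]; field_simp, by rw [hg1x]; ring⟩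
  have G1y : HasCoords f g (1 + y) 1 0 y0 := ⟨hyn, 1 - b, by
    rw [hf1y, hg1y]; ring, by rw [hf1y]; ring, by rw [hg1y, hy0]; field_simp⟩
  have hpxy : 1 - f (x + y) - g (x + y) = 0 := by
    have := Gx.det_eq_zero hcol Gy hxy
    have h2 : (1 - f (x + y) - g (x + y)) * (x0 * y0) = 0 := by linear_combination this
    exact (mul_eq_zero.mp h2).resolve_right (mul_ne_zero hx00 hy00)
  have hxyn : ∀ n : ℕ, (n : K) + x + y ≠ 0 := by
    intro n e
    have hxe : x + y = -n := by linear_combination e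
    have h0 : (n : K) ≠ 0 := fun h => hxy (by rw [hxe, h, neg_zero])
    rw [hxe, hf.map_neg, hg.map_neg, (hnat n h0).1, (hnat n h0).2] at hpxy
    simp at hpxy
  have h1xy : 1 + x + y ≠ 0 := by simpa using hxyn 1
  have G1xy : HasCoords f g (1 + x + y) 1 x0 y0 := by
    have e1 := G1x.det_eq_zero hcol Gy h1xy
    have e2 := G1y.det_eq_zero hcol Gx (by rwa [add_right_comm])
    rw [add_right_comm] at e2
    refine ⟨h1xy, _, (mul_one _).symm, ?_, ?_⟩
    · refine mul_right_cancel₀ hy00 ?_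
      linear_combination -e1
    · refine mul_right_cancel₀ hx00 ?_
      linear_combination e2
  have Gxy : HasCoords f g (x + y) 0 x0 y0 := by
    have e1 := G1xy.det_eq_zero hcol (G1.neg hf hg) (by
      rwa [show 1 + x + y + -1 = x + y by ring])
    rw [show 1 + x + y + -1 = x + y by ring] at e1
    refine ⟨hxy, f (x + y) / x0, by rw [hpxy]; ring, by field_simp, ?_⟩
    field_simp
    linear_combination -e1
  have main : ∀ n : ℕ, HasCoords f g (n + x) n x0 0 ∧ HasCoords f g (n + x + y) n x0 y0 := by
    intro n
    induction n with
    | zero => simpa using ⟨Gx, Gxy⟩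
    | succ n ih =>
      obtain ⟨i1, i2⟩ := ih
      have n1 := hxyn (n + 1)
      have n2 := hxn (n + 1)
      push_cast at n1 n2 ⊢
      have E : HasCoords f g ((n : K) + 1 + x + y) (n + 1) x0 y0 := by
        have e1 := i2.det_eq_zero hcol G1
          (by rwa [show (n : K) + x + y + 1 = n + 1 + x + y by ring])
        have e2 := i1.det_eq_zero hcol G1y
          (by rwa [show (n : K) + x + (1 + y) = n + 1 + x + y by ring])
        rw [show (n : K) + x + y + 1 = n + 1 + x + y by ring] at e1
        rw [show (n : K) + x + (1 + y) = n + 1 + x + y by ring] at e2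
        refine ⟨n1, f ((n : K) + 1 + x + y) / x0, ?_, by field_simp, ?_⟩
        · rw [div_mul_eq_mul_div, eq_div_iff hx00]
          refine mul_right_cancel₀ hy00 ?_
          linear_combination e2 - e1
        · field_simp
          linear_combination -e1
      refine ⟨?_, E⟩
      have e1 := E.det_eq_zero hcol (Gy.neg hf hg)
        (by rwa [show (n : K) + 1 + x + y + -y = n + 1 + x by ring])
      have e2 := i1.det_eq_zero hcol G1
          (by rwa [show (n : K) + x + 1 = n + 1 + x by ring])
      rw [show (n : K) + 1 + x + y + -y = n + 1 + x by ring] at e1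
      rw [show (n : K) + x + 1 = n + 1 + x by ring] at e2
      have hg0 : g ((n : K) + 1 + x) = 0 := by
        refine (mul_eq_zero.mp ?_).resolve_right hx00
        linear_combination -e2
      refine ⟨n2, f ((n : K) + 1 + x) / x0, ?_, by field_simp, by rw [hg0]; ring⟩
      rw [div_mul_eq_mul_div, eq_div_iff hx00]
      refine mul_right_cancel₀ hy00 ?_
      linear_combination e1
  obtain ⟨-, c, h1, h2, h3⟩ := (main n).1
  rw [h2]
  linear_combination x0 * (-h1 - h2 - h3)

/-- Non-rigid elements with independent values under `(f, g)` do not exist, provided that `f` and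
`g` satisfy a boundedness condition. -/
theorem map_mul_map_eq_of_nonrigid (hnat : ∀ n : ℕ, (n : K) ≠ 0 → f n = 0 ∧ g n = 0)
    (hbdd : ∀ α β t : F, t ≠ 0 → (∃ n : ℕ, ∀ z : K, z ≠ 0 → (n + t) * (α * f z + β * g z) ≠ t) ∨
      (∃ n : ℕ, ∀ z : K, z ≠ 0 → (n + t⁻¹) * (α * f z + β * g z) ≠ t⁻¹)) {x y : K}
    (hx : x ≠ 0) (hy : y ≠ 0) {a b : F} (ha0 : a ≠ 0) (ha1 : a ≠ 1) (hb0 : b ≠ 0) (hb1 : b ≠ 1)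
    (hf1x : f (1 + x) = a * f x) (hg1x : g (1 + x) = a * g x) (hf1y : f (1 + y) = b * f y)
    (hg1y : g (1 + y) = b * g y) : f x * g y = g x * f y := by
  by_contra hne
  have hΔ : f x * g y - g x * f y ≠ 0 := sub_ne_zero.mpr hne
  set Δ := f x * g y - g x * f y with hΔdef
  -- In new coordinates, `x` and `y` have the values `(1, 0)` and `(0, 1)`.
  have lin : ∀ α β : F, IsLog (fun z => α * f z + β * g z) := fun α β =>
    ⟨fun p q hp hq => by simp only [hf.map_mul p q hp hq, hg.map_mul p q hp hq]; ring,
      by simp only [hf.map_neg_one, hg.map_neg_one]; ring⟩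
  have lincol : ∀ α β γ δ : F,
      IsCollinear (fun z => α * f z + β * g z) (fun z => γ * f z + δ * g z) := by
    intro α β γ δ p q hp hq hpq
    linear_combination (α * δ - β * γ) * hcol p q hp hq hpq
  have linnat : ∀ α β : F, ∀ n : ℕ, (n : K) ≠ 0 → α * f n + β * g n = 0 := by
    intro α β n hn
    rw [(hnat n hn).1, (hnat n hn).2]; ring
  have ha : 1 - a ≠ 0 := sub_ne_zero.mpr ha1.symm
  have hfx1 : g y / Δ * f x + -f y / Δ * g x = 1 := by field_simp; rw [hΔdef]; ring
  have e1x : 1 + x ≠ 0 := by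
    intro e
    have hxe : x = -1 := by linear_combination e
    apply hΔ
    rw [hΔdef, hxe, hf.map_neg_one, hg.map_neg_one]; ring
  rcases hbdd (g y / Δ) (-f y / Δ) (a / (1 - a)) (div_ne_zero ha0 ha) with ⟨n, hn⟩ | ⟨n, hn⟩
  · have key := map_natCast_add_of_collinear (lin (g y / Δ) (-f y / Δ)) (lin (-g x / Δ) (f x / Δ))
      (lincol _ _ _ _) (fun n h => ⟨linnat _ _ n h, linnat _ _ n h⟩) hx hy hfx1
      (by ring) (by ring) (by field_simp; rw [hΔdef]; ring) ha0 ha1 hb0 hb1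
      (by rw [hf1x, hg1x]; linear_combination a * hfx1) (by rw [hf1x, hg1x]; ring)
      (by rw [hf1y, hg1y]; ring) (by rw [hf1y, hg1y]; field_simp; rw [hΔdef]; ring) n
    have h0 : (n : K) + x ≠ 0 := by
      intro e
      have hxe : x = -n := by linear_combination e
      have h0 : (n : K) ≠ 0 := fun h => hx (by rw [hxe, h, neg_zero])
      apply hΔ
      rw [hΔdef, hxe, hf.map_neg, hg.map_neg, (hnat n h0).1, (hnat n h0).2]; ring
    exact hn _ h0 key
  · have hi := inv_ne_zero hx
    have hfi : ∀ α β : F, α * f x⁻¹ + β * g x⁻¹ = -(α * f x + β * g x) := by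
      intro α β
      rw [hf.map_inv hx, hg.map_inv hx]; ring
    have h1i : (1 : K) + x⁻¹ = (1 + x) / x := by field_simp; ring
    have hfi1 : ∀ α β : F, α * f (1 + x⁻¹) + β * g (1 + x⁻¹) =
        (a - 1) * (α * f x + β * g x) := by
      intro α β
      rw [h1i, hf.map_div e1x hx, hg.map_div e1x hx, hf1x, hg1x]; ring
    have hinv : (a / (1 - a))⁻¹ = (1 - a) / (1 - (1 - a)) := by rw [inv_div, sub_sub_cancel]
    have key := map_natCast_add_of_collinear (lin (-g y / Δ) (f y / Δ))
      (lin (-g x / Δ) (f x / Δ)) (lincol _ _ _ _) (fun n h => ⟨linnat _ _ n h, linnat _ _ n h⟩)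
      hi hy (by rw [hfi]; linear_combination hfx1) (by rw [hfi]; ring) (by ring)
      (by field_simp; rw [hΔdef]; ring) (a := 1 - a) ha (by simpa using ha0) hb0 hb1
      (by rw [hfi1]; linear_combination (1 - a) * hfx1) (by rw [hfi1]; ring)
      (by rw [hf1y, hg1y]; ring) (by rw [hf1y, hg1y]; field_simp; rw [hΔdef]; ring) n
    rw [← hinv] at key
    have h0 : (n : K) + x⁻¹ ≠ 0 := by
      intro e
      have hxe : x⁻¹ = -n := by linear_combination e
      have h0 : (n : K) ≠ 0 := fun h => hi (by rw [hxe, h, neg_zero])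
      have h1 := hf.map_inv hx
      have h2 := hg.map_inv hx
      rw [hxe, hf.map_neg, (hnat n h0).1] at h1
      rw [hxe, hg.map_neg, (hnat n h0).2] at h2
      apply hΔ
      rw [hΔdef]
      linear_combination g y * h1 - f y * h2
    refine hn _ (inv_ne_zero h0) (Eq.trans ?_ key)
    rw [hf.map_inv h0, hg.map_inv h0]
    ring

end

end

/-! ### The coefficient ring -/

section

/-- The properties of a quotient domain `Λ` of `ℤ_ℓ` used below: `Λ` is separated for the `ℓ`-adic
topology, the natural numbers are dense in it, and it is a valuation ring. -/
structure IsAdic (ℓ : ℕ) (Λ : Type*) [CommRing Λ] [IsDomain Λ] : Prop where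
  prime : ℓ.Prime
  separated : ∀ t : Λ, (∀ N : ℕ, ∃ s, t = (ℓ : Λ) ^ N * s) → t = 0
  dense : ∀ (t : Λ) (N : ℕ), ∃ (n : ℕ) (s : Λ), n + t = (ℓ : Λ) ^ N * s
  valuationRing : ValuationRing Λ

theorem isAdic_of_surjective (ℓ : ℕ) [Fact ℓ.Prime] (Λ : Type*) [CommRing Λ] [IsDomain Λ]
    [Algebra ℤ_[ℓ] Λ] (hΛ : Function.Surjective (algebraMap ℤ_[ℓ] Λ)) : IsAdic ℓ Λ where
  prime := Fact.out
  separated t ht := by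
    have := isNoetherianRing_of_surjective ℤ_[ℓ] Λ (algebraMap ℤ_[ℓ] Λ) hΛ
    have := IsLocalRing.of_surjective' (algebraMap ℤ_[ℓ] Λ) hΛ
    have hne : Ideal.span {(ℓ : Λ)} ≠ ⊤ := by
      rw [Ne, Ideal.span_singleton_eq_top]
      intro hu
      obtain ⟨b, hb⟩ := hu.exists_right_inv
      obtain ⟨s, rfl⟩ := hΛ b
      have h1 : algebraMap ℤ_[ℓ] Λ (1 - ℓ * s) = 0 := by simp [hb]
      have h2 : IsUnit (1 - (ℓ : ℤ_[ℓ]) * s) := by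
        refine (IsLocalRing.isUnit_or_isUnit_one_sub_self ((ℓ : ℤ_[ℓ]) * s)).resolve_left ?_
        intro h
        exact PadicInt.prime_p.not_isUnit (isUnit_of_mul_isUnit_left h)
      have := h2.map (algebraMap ℤ_[ℓ] Λ)
      rw [h1] at this
      exact not_isUnit_zero this
    have h := Ideal.iInf_pow_eq_bot_of_isLocalRing _ hne
    have : t ∈ ⨅ i : ℕ, Ideal.span {(ℓ : Λ)} ^ i := by
      rw [Ideal.mem_iInf]
      intro N
      obtain ⟨s, hs⟩ := ht N
      rw [Ideal.span_singleton_pow, Ideal.mem_span_singleton]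
      exact ⟨s, hs⟩
    rwa [h] at this
  dense t N := by
    obtain ⟨z, rfl⟩ := hΛ t
    have := PadicInt.appr_spec N (-z)
    rw [Ideal.mem_span_singleton] at this
    obtain ⟨s, hs⟩ := this
    refine ⟨(-z).appr N, algebraMap ℤ_[ℓ] Λ (-s), ?_⟩
    have h := congrArg (algebraMap ℤ_[ℓ] Λ) hs
    simp only [map_sub, map_neg, map_mul, map_pow, map_natCast] at h ⊢
    linear_combination -h
  valuationRing := Function.Surjective.valuationRing (algebraMap ℤ_[ℓ] Λ) hΛ

namespace IsAdic

variable {ℓ : ℕ} {Λ : Type*} [CommRing Λ] [IsDomain Λ] (hΛ : IsAdic ℓ Λ)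
include hΛ

theorem eq_zero_or_one_of_two_eq_zero (h2 : (2 : FractionRing Λ) = 0) (a : FractionRing Λ) :
    a = 0 ∨ a = 1 := by
  have h2' : (2 : Λ) = 0 := by
    apply IsFractionRing.injective Λ (FractionRing Λ)
    rw [map_ofNat, map_zero, h2]
  have key : ∀ t : Λ, t = 0 ∨ t = 1 := by
    intro t
    rcases hΛ.prime.eq_two_or_odd' with rfl | ⟨m, hm⟩
    · obtain ⟨n, s, h⟩ := hΛ.dense t 1
      rw [pow_one, Nat.cast_ofNat, h2', zero_mul] at h
      rcases Nat.even_or_odd' n with ⟨m, rfl | rfl⟩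
      · left; push_cast at h; linear_combination h - m * h2'
      · right; push_cast at h; linear_combination h - (m + 1) * h2'
    · have h1 : (ℓ : Λ) = 1 := by rw [hm]; push_cast; linear_combination m * h2'
      left
      exact hΛ.separated t fun N => ⟨t, by rw [h1]; simp⟩
  obtain ⟨p, q, hq, rfl⟩ := IsFractionRing.div_surjective (A := Λ) a
  rcases key p with rfl | rfl
  · left; simp
  · right
    rcases key q with rfl | rfl
    · exact absurd hq zero_notMem_nonZeroDivisors
    · simp

/-- No fractional linear function of `n : ℕ` of a certain kind is bounded. -/
theorem exists_forall_ne (S : Set (FractionRing Λ)) (r : Λ) (hr : r ≠ 0)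
    (hS : ∀ s ∈ S, ∃ l : Λ, algebraMap Λ (FractionRing Λ) r * s = algebraMap Λ _ l)
    (t : FractionRing Λ) (ht : t ≠ 0) :
    (∃ n : ℕ, ∀ s ∈ S, (n + t) * s ≠ t) ∨ (∃ n : ℕ, ∀ s ∈ S, (n + t⁻¹) * s ≠ t⁻¹) := by
  have key : ∀ t : FractionRing Λ, t ≠ 0 → IsLocalization.IsInteger Λ t →
      ∃ n : ℕ, ∀ s ∈ S, (n + t) * s ≠ t := by
    rintro _ ht ⟨t, rfl⟩
    by_contra! hcon
    have : r * t = 0 := hΛ.separated _ fun N => by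
      obtain ⟨n, s, hs⟩ := hΛ.dense t N
      obtain ⟨z, hz, h⟩ := hcon n
      obtain ⟨l, hl⟩ := hS z hz
      refine ⟨s * l, IsFractionRing.injective Λ (FractionRing Λ) ?_⟩
      have hs' := congrArg (algebraMap Λ (FractionRing Λ)) hs
      simp only [map_mul, map_add, map_natCast, map_pow] at hs' ⊢
      rw [← hl, ← h]
      linear_combination algebraMap Λ (FractionRing Λ) r * z * hs'
    rcases mul_eq_zero.mp this with h | h
    · exact hr h
    · exact ht (by rw [h, map_zero])
  have := hΛ.valuationRing
  exact (ValuationRing.isInteger_or_isInteger Λ t).imp (key t ht) (key _ (inv_ne_zero ht))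

end IsAdic

/-! ### Elements of `𝒢(K, Λ)` as logarithmic functions -/

section

variable {K : Type*} [Field K] {Λ : Type*} [CommRing Λ]

open Classical in
/-- The value of an element of `𝒢(K, Λ)` at an element of `K`, with value `0` at `0`. -/
noncomputable def ev (f : G K Λ) (x : K) : FractionRing Λ :=
  if h : x ≠ 0 then evalAt Λ (Units.mk0 x h) f else 0

theorem ev_of_ne_zero (f : G K Λ) {x : K} (hx : x ≠ 0) : ev f x = evalAt Λ (Units.mk0 x hx) f :=
  dif_pos hx

theorem ev_units (f : G K Λ) (x : Kˣ) : ev f (x : K) = evalAt Λ x f := by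
  rw [ev_of_ne_zero f x.ne_zero]; congr; simp

theorem ev_add (f g : G K Λ) (x : K) : ev (f + g) x = ev f x + ev g x := by
  unfold ev; split_ifs <;> simp

theorem ev_smul (a : FractionRing Λ) (f : G K Λ) (x : K) : ev (a • f) x = a * ev f x := by
  unfold ev; split_ifs <;> simp

theorem ev_zero (x : K) : ev (0 : G K Λ) x = 0 := by
  unfold ev; split_ifs <;> simp

theorem ev_sum {ι : Type*} (s : Finset ι) (a : ι → FractionRing Λ) (f : ι → G K Λ) (x : K) :
    ev (∑ i ∈ s, a i • f i) x = ∑ i ∈ s, a i * ev (f i) x := by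
  classical
  induction s using Finset.induction_on with
  | empty => simp [ev_zero]
  | insert i s hi ih => rw [Finset.sum_insert hi, Finset.sum_insert hi, ev_add, ev_smul, ih]

theorem evalAt_tmul (x : Kˣ) (a : FractionRing Λ) (φ : Additive Kˣ →+ Λ) :
    evalAt Λ x (a ⊗ₜ φ) = algebraMap Λ (FractionRing Λ) (φ (Additive.ofMul x)) * a := by
  simp [evalAt, evalHom, Algebra.smul_def]

theorem ev_mul (f : G K Λ) {x y : K} (hx : x ≠ 0) (hy : y ≠ 0) :
    ev f (x * y) = ev f x + ev f y := by
  rw [ev_of_ne_zero f hx, ev_of_ne_zero f hy, ev_of_ne_zero f (mul_ne_zero hx hy)]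
  rw [Units.mk0_mul]
  induction f using TensorProduct.induction_on with
  | zero => simp
  | tmul a φ => simp only [evalAt_tmul, ofMul_mul, map_add]; ring
  | add f g hf hg => simp only [map_add, hf, hg]; ring

theorem ev_one (f : G K Λ) : ev f 1 = 0 := by
  have := ev_mul f (one_ne_zero (α := K)) one_ne_zero
  rwa [mul_one, left_eq_add] at this

theorem ev_inv (f : G K Λ) {x : K} (hx : x ≠ 0) : ev f x⁻¹ = -ev f x := by
  have h := ev_mul f hx (inv_ne_zero hx)
  rw [mul_inv_cancel₀ hx, ev_one] at h
  exact (neg_eq_of_add_eq_zero_right h.symm).symm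

theorem ev_prod (f : G K Λ) {ι : Type*} (s : Finset ι) (x : ι → K) (hx : ∀ i ∈ s, x i ≠ 0) :
    ev f (∏ i ∈ s, x i) = ∑ i ∈ s, ev f (x i) := by
  classical
  induction s using Finset.induction_on with
  | empty => simpa using ev_one f
  | insert a s ha ih =>
    have hs : ∀ i ∈ s, x i ≠ 0 := fun i hi => hx i (by simp [hi])
    rw [Finset.prod_insert ha, Finset.sum_insert ha, ev_mul f (hx a (by simp))
      (Finset.prod_ne_zero_iff.2 hs), ih hs]

theorem ev_pow (f : G K Λ) {x : K} (hx : x ≠ 0) (n : ℕ) : ev f (x ^ n) = n * ev f x := by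
  simpa using ev_prod f (Finset.range n) (fun _ => x) (by simp [hx])

theorem ev_zpow (f : G K Λ) {x : K} (hx : x ≠ 0) (n : ℤ) : ev f (x ^ n) = n * ev f x := by
  obtain ⟨m, rfl | rfl⟩ := n.eq_nat_or_neg
  · simpa using ev_pow f hx m
  · rw [zpow_neg, ev_inv f (zpow_ne_zero _ hx), zpow_natCast, ev_pow f hx]
    simp

theorem isAlternatingPair_iff {f g : G K Λ} : IsAlternatingPair f g ↔
    ∀ x : K, x ≠ 0 → x ≠ 1 → ev f x * ev g (1 - x) = ev f (1 - x) * ev g x := by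
  refine forall_congr' fun x => forall_congr' fun h0 => forall_congr' fun h1 => ?_
  have h1' : 1 - x ≠ 0 := sub_ne_zero.mpr h1.symm
  rw [ev_of_ne_zero f h0, ev_of_ne_zero f h1', ev_of_ne_zero g h0, ev_of_ne_zero g h1']

theorem mem_inertia_iff {v : ValuationSubring K} {f : G K Λ} :
    f ∈ inertia Λ v ↔ ∀ x, v.valuation x = 1 → ev f x = 0 := by
  rw [inertia, mem_vanishingOn]
  constructor
  · intro h x hx
    have h0 : x ≠ 0 := by rintro rfl; simp at hx
    rw [ev_of_ne_zero f h0]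
    exact h _ hx
  · intro h x hx
    rw [← ev_units]
    exact h _ hx

theorem mem_decomposition_iff {v : ValuationSubring K} {f : G K Λ} :
    f ∈ decomposition Λ v ↔ ∀ x, v.valuation (x - 1) < 1 → ev f x = 0 := by
  rw [decomposition, mem_vanishingOn]
  constructor
  · intro h x hx
    have h0 : x ≠ 0 := by rintro rfl; simp at hx
    rw [ev_of_ne_zero f h0]
    exact h _ hx
  · intro h x hx
    rw [← ev_units]
    exact h _ hx

theorem inertia_le_decomposition (v : ValuationSubring K) : inertia Λ v ≤ decomposition Λ v := by
  intro f hf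
  rw [mem_inertia_iff] at hf
  rw [mem_decomposition_iff]
  intro x hx
  apply hf
  have := valuation_one_add hx
  rwa [add_sub_cancel] at this

theorem valuation_eq_one_of_le {v w : ValuationSubring K} (hvw : v ≤ w) {x : K}
    (hx : v.valuation x = 1) : w.valuation x = 1 := by
  rw [← ValuationSubring.mapOfLE_valuation_apply v w hvw, hx, map_one]

theorem valuation_lt_one_of_le {v w : ValuationSubring K} (hvw : v ≤ w) {x : K}
    (hx : w.valuation x < 1) : v.valuation x < 1 :=
  ValuationSubring.nonunits_le_nonunits.mpr hvw hx

theorem inertia_anti {v w : ValuationSubring K} (hvw : v ≤ w) : inertia Λ w ≤ inertia Λ v := by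
  intro f hf
  rw [mem_inertia_iff] at hf ⊢
  exact fun x hx => hf x (valuation_eq_one_of_le hvw hx)

variable [IsDomain Λ]

theorem exists_smul_eq_tmul (f : G K Λ) : ∃ (r : Λ) (φ : Additive Kˣ →+ Λ), r ≠ 0 ∧
    algebraMap Λ (FractionRing Λ) r • f = (1 : FractionRing Λ) ⊗ₜ φ := by
  obtain ⟨⟨φ, s⟩, h⟩ := IsLocalizedModule.surj Λ⁰
    (TensorProduct.mk Λ (FractionRing Λ) (Additive Kˣ →+ Λ) 1) f
  refine ⟨s, φ, nonZeroDivisors.ne_zero s.2, ?_⟩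
  rw [algebraMap_smul]
  exact h

theorem ev_bounded (f : G K Λ) : ∃ r : Λ, r ≠ 0 ∧ ∀ x, ∃ l : Λ,
    algebraMap Λ (FractionRing Λ) r * ev f x = algebraMap Λ _ l := by
  obtain ⟨r, φ, hr, h⟩ := exists_smul_eq_tmul f
  refine ⟨r, hr, fun x => ?_⟩
  by_cases hx : x = 0
  · exact ⟨0, by simp [ev, hx]⟩
  · rw [← ev_smul, h, ev_of_ne_zero _ hx, evalAt_tmul]
    exact ⟨_, mul_one _⟩

theorem ev_injective {f : G K Λ} (h : ∀ x, x ≠ 0 → ev f x = 0) : f = 0 := by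
  obtain ⟨r, φ, hr, hφ⟩ := exists_smul_eq_tmul f
  have : φ = 0 := by
    ext x
    apply IsFractionRing.injective Λ (FractionRing Λ)
    have := congrArg (evalAt Λ x) hφ
    rw [← ev_units, ev_smul, h _ x.ne_zero, evalAt_tmul] at this
    simpa using this.symm
  rw [this, TensorProduct.tmul_zero] at hφ
  refine (smul_eq_zero.mp hφ).resolve_left ?_
  simpa using hr

variable {ℓ : ℕ} (hΛ : IsAdic ℓ Λ) {k : Type*} [Field k] [IsAlgClosed k] [Algebra k K]
include hΛ

/-- Since the multiplicative group of an algebraically closed field is divisible, the elements of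
`𝒢(K, Λ)` vanish on it. -/
theorem ev_algebraMap (f : G K Λ) (c : k) : ev f (algebraMap k K c) = 0 := by
  by_cases hc : c = 0
  · simp [ev, hc]
  obtain ⟨r, hr, h⟩ := ev_bounded f
  obtain ⟨l, hl⟩ := h (algebraMap k K c)
  have : l = 0 := hΛ.separated l fun N => by
    obtain ⟨b, hb⟩ := IsAlgClosed.exists_pow_nat_eq c
      (pow_pos hΛ.prime.pos N : 0 < ℓ ^ N)
    have hb0 : b ≠ 0 := by
      rintro rfl
      rw [zero_pow (pow_ne_zero N hΛ.prime.ne_zero)] at hb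
      exact hc hb.symm
    obtain ⟨s, hs⟩ := h (algebraMap k K b)
    refine ⟨s, IsFractionRing.injective Λ (FractionRing Λ) ?_⟩
    rw [← hl, ← hb, map_pow, ev_pow f (by simpa using hb0)]
    simp only [map_mul, map_pow, map_natCast, ← hs]
    push_cast
    ring
  rw [this, map_zero] at hl
  exact (mul_eq_zero.mp hl).resolve_left (by simpa using hr)

theorem isLog_ev (k : Type*) [Field k] [IsAlgClosed k] [Algebra k K] (f : G K Λ) :
    IsLog (ev f) where
  map_mul _ _ hx hy := ev_mul f hx hy
  map_neg_one := by simpa using ev_algebraMap hΛ f (-1 : k)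

end

end

/-! ### Alternating pairs and valuations -/

section

variable {K : Type*} [Field K] {Λ : Type*} [CommRing Λ]

theorem IsAlternatingPair.isCollinear {f g : G K Λ} (hfg : IsAlternatingPair f g) [IsDomain Λ] :
    IsCollinear (ev f) (ev g) := by
  intro x y hx hy hxy
  rw [isAlternatingPair_iff] at hfg
  have h1 : x / (x + y) ≠ 1 := by
    rw [Ne, div_eq_one_iff_eq hxy]; simpa using hy
  have h2 : 1 - x / (x + y) = y / (x + y) := by field_simp; ring
  have hdiv : ∀ (f : G K Λ) {z : K}, z ≠ 0 → ev f (z / (x + y)) = ev f z - ev f (x + y) := by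
    intro f z hz
    rw [eq_sub_iff_add_eq, ← ev_mul f (div_ne_zero hz hxy) hxy, div_mul_cancel₀ _ hxy]
  have := hfg _ (div_ne_zero hx hxy) h1
  rw [h2, hdiv f hx, hdiv f hy, hdiv g hx, hdiv g hy] at this
  exact this

theorem isAlternatingPair_of_mem {v : ValuationSubring K} {f g : G K Λ} (hf : f ∈ inertia Λ v)
    (hg : g ∈ decomposition Λ v) (hfneg : ev f (-1) = 0) (hgneg : ev g (-1) = 0) :
    IsAlternatingPair f g := by
  rw [isAlternatingPair_iff]
  rw [mem_inertia_iff] at hf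
  rw [mem_decomposition_iff] at hg
  intro x h0 h1
  have h1' : 1 - x ≠ 0 := sub_ne_zero.mpr h1.symm
  rcases lt_trichotomy (v.valuation x) 1 with h | h | h
  · have e : v.valuation (-x) < 1 := by rwa [Valuation.map_neg]
    have h3 : v.valuation (1 - x) = 1 := by rw [sub_eq_add_neg]; exact valuation_one_add e
    rw [hf _ h3, hg (1 - x) (by rw [sub_sub_cancel_left]; exact e)]; ring
  · rcases (v.valuation.map_sub 1 x).lt_or_eq with h3 | h3
    · rw [map_one, h, max_self] at h3
      rw [hf _ h, hg x (by rwa [Valuation.map_sub_swap])]; ring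
    · rw [map_one, h, max_self] at h3
      rw [hf _ h, hf _ h3]; ring
  · have hxi : v.valuation x⁻¹ < 1 := by rw [map_inv₀]; exact inv_lt_one_of_one_lt₀ h
    have hxi' : v.valuation (-x⁻¹) < 1 := by rwa [Valuation.map_neg]
    have e : 1 - x = -1 * x * (1 + -x⁻¹) := by field_simp; ring
    have h3 := valuation_one_add hxi'
    have h30 : 1 + -x⁻¹ ≠ 0 := by intro e; rw [e] at h3; simp at h3
    have hm1 : (-1 : K) ≠ 0 := neg_ne_zero.mpr one_ne_zero
    have e1 : ev f (1 - x) = ev f x := by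
      rw [e, ev_mul f (mul_ne_zero hm1 h0) h30, ev_mul f hm1 h0, hfneg, hf _ h3]; ring
    have e2 : ev g (1 - x) = ev g x := by
      rw [e, ev_mul g (mul_ne_zero hm1 h0) h30, ev_mul g hm1 h0, hgneg,
        hg (1 + -x⁻¹) (by rwa [add_sub_cancel_left])]; ring
    rw [e1, e2]

/-- Independent valuation rings: an element of both decomposition spaces vanishes on the units of
the valuation ring generated by them. -/
theorem mem_inertia_sup {A B : ValuationSubring K} (hAB : ¬ A ≤ B) (hBA : ¬ B ≤ A) {f : G K Λ}
    (hA : f ∈ decomposition Λ A) (hB : f ∈ decomposition Λ B) : f ∈ inertia Λ (A ⊔ B) := by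
  rw [mem_inertia_iff]
  rw [mem_decomposition_iff] at hA hB
  intro x hx
  obtain ⟨a, b, ha, hb, rfl⟩ := exists_mul_principal_units hAB hBA hx
  have h0 : a * b ≠ 0 := by intro e; rw [e] at hx; simp at hx
  rw [ev_mul f (left_ne_zero_of_mul h0) (right_ne_zero_of_mul h0), hA a ha, hB b hb, add_zero]

theorem mem_inertia_sup_of_mem {A B : ValuationSubring K} {f : G K Λ} (hA : f ∈ inertia Λ A)
    (hB : f ∈ inertia Λ B) : f ∈ inertia Λ (A ⊔ B) := by
  by_cases hAB : A ≤ B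
  · rwa [sup_eq_right.mpr hAB]
  by_cases hBA : B ≤ A
  · rwa [sup_eq_left.mpr hBA]
  exact mem_inertia_sup hAB hBA (inertia_le_decomposition A hA) (inertia_le_decomposition B hB)

/-- If `f` lies in some inertia space, then there is a coarsest valuation with this property. -/
theorem exists_isGreatest_inertia {f : G K Λ} (h : ∃ v, f ∈ inertia Λ v) :
    ∃ v, IsGreatest {w : ValuationSubring K | f ∈ inertia Λ w} v := by
  obtain ⟨v₀, hv₀⟩ := h
  have dir : ∀ {x y : K}, (∃ w, f ∈ inertia Λ w ∧ x ∈ w) → (∃ w, f ∈ inertia Λ w ∧ y ∈ w) →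
      ∃ w : ValuationSubring K, f ∈ inertia Λ w ∧ x ∈ w ∧ y ∈ w := by
    rintro x y ⟨w, hw, hx⟩ ⟨w', hw', hy⟩
    exact ⟨w ⊔ w', mem_inertia_sup_of_mem hw hw', (le_sup_left : w ≤ w ⊔ w') hx,
      (le_sup_right : w' ≤ w ⊔ w') hy⟩
  let v : ValuationSubring K :=
    { carrier := {x | ∃ w : ValuationSubring K, f ∈ inertia Λ w ∧ x ∈ w}
      mul_mem' := fun hx hy => by
        obtain ⟨w, hw, hx, hy⟩ := dir hx hy
        exact ⟨w, hw, w.mul_mem _ _ hx hy⟩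
      one_mem' := ⟨v₀, hv₀, v₀.one_mem⟩
      add_mem' := fun hx hy => by
        obtain ⟨w, hw, hx, hy⟩ := dir hx hy
        exact ⟨w, hw, w.add_mem _ _ hx hy⟩
      zero_mem' := ⟨v₀, hv₀, v₀.zero_mem⟩
      neg_mem' := fun ⟨w, hw, hx⟩ => ⟨w, hw, w.neg_mem _ hx⟩
      mem_or_inv_mem' := fun x => (v₀.mem_or_inv_mem x).imp (fun h => ⟨v₀, hv₀, h⟩)
        (fun h => ⟨v₀, hv₀, h⟩) }
  have hmem : ∀ x, x ∈ v ↔ ∃ w : ValuationSubring K, f ∈ inertia Λ w ∧ x ∈ w := fun _ => Iff.rfl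
  refine ⟨v, ?_, fun w hw x hx => (hmem x).mpr ⟨w, hw, hx⟩⟩
  change f ∈ inertia Λ v
  rw [mem_inertia_iff]
  intro x hx
  have hx' : v.valuation x⁻¹ = 1 := by rw [map_inv₀, hx, inv_one]
  obtain ⟨w, hw, h1, h2⟩ := dir ((hmem x).mp (mem_of_valuation_eq_one hx))
    ((hmem _).mp (mem_of_valuation_eq_one hx'))
  rw [mem_inertia_iff] at hw
  refine hw x (le_antisymm ((w.valuation_le_one_iff x).mpr h1) ?_)
  rw [← w.valuation_le_one_iff, map_inv₀] at h2
  have h0 : w.valuation x ≠ 0 := by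
    rw [Valuation.ne_zero_iff]; rintro rfl; simp at hx
  exact (inv_le_one₀ (zero_lt_iff.mpr h0)).mp h2

/-- If `v` is the coarsest valuation with `h` in its inertia space, then everything alternating
with `h` lies in the decomposition space of `v`. By the choice of `v`, every element of positive
valuation in `ker h` is larger than some element of positive valuation outside of `ker h`. -/
theorem mem_decomposition_of_isGreatest [IsDomain Λ] {h f : G K Λ} {v : ValuationSubring K}
    (hv : IsGreatest {w : ValuationSubring K | h ∈ inertia Λ w} v)
    (hf : IsAlternatingPair h f) : f ∈ decomposition Λ v := by
  have hI := mem_inertia_iff.mp hv.1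
  rw [isAlternatingPair_iff] at hf
  have unit : ∀ {x}, v.valuation x < 1 → v.valuation (1 - x) = 1 := fun {x} hx => by
    rw [sub_eq_add_neg]; exact valuation_one_add (by rwa [Valuation.map_neg])
  have keyA : ∀ x, x ≠ 0 → v.valuation x < 1 → ev h x ≠ 0 → ev f (1 - x) = 0 := by
    intro x h0 hx hhx
    have := hf x h0 (by rintro rfl; simp at hx)
    rw [hI _ (unit hx), zero_mul] at this
    exact (mul_eq_zero.mp this).resolve_left hhx
  have keyB : ∀ x, x ≠ 0 → v.valuation x < 1 → ev h x = 0 →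
      ∃ y, y ≠ 0 ∧ v.valuation y < 1 ∧ v.valuation (x / y) < 1 ∧ ev h y ≠ 0 := by
    intro x h0 hx hhx
    have hxv := mem_of_valuation_lt_one hx
    let S : Subring K :=
      { carrier := {y | ∃ n : ℕ, x ^ n * y ∈ v}
        mul_mem' := by
          rintro a b ⟨n, hn⟩ ⟨m, hm⟩
          refine ⟨n + m, ?_⟩
          rw [show x ^ (n + m) * (a * b) = (x ^ n * a) * (x ^ m * b) by ring]
          exact v.mul_mem _ _ hn hm
        one_mem' := ⟨0, by simp⟩
        zero_mem' := ⟨0, by simp⟩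
        neg_mem' := by
          rintro a ⟨n, hn⟩
          exact ⟨n, by rw [mul_neg]; exact v.neg_mem _ hn⟩
        add_mem' := by
          rintro a b ⟨n, hn⟩ ⟨m, hm⟩
          refine ⟨n + m, ?_⟩
          rw [show x ^ (n + m) * (a + b) = x ^ m * (x ^ n * a) + x ^ n * (x ^ m * b) by ring]
          exact v.add_mem _ _ (v.mul_mem _ _ (pow_mem hxv m) hn)
            (v.mul_mem _ _ (pow_mem hxv n) hm) }
    have hvS : v.toSubring ≤ S := fun y hy => ⟨0, by simpa using hy⟩
    set w := ValuationSubring.ofLE v S hvS with hw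
    have hmem : ∀ y, y ∈ w ↔ ∃ n : ℕ, x ^ n * y ∈ v := fun _ => Iff.rfl
    have hnot : h ∉ inertia Λ w := by
      intro hcon
      have h1 : x⁻¹ ∈ w := (hmem _).mpr ⟨1, by rw [pow_one, mul_inv_cancel₀ h0]; exact v.one_mem⟩
      have h2 := hv.2 hcon h1
      rw [← v.valuation_le_one_iff, map_inv₀] at h2
      exact not_lt_of_ge h2 ((one_lt_inv₀ (by
        rw [zero_lt_iff, Valuation.ne_zero_iff]; exact h0)).mpr hx)
    rw [mem_inertia_iff] at hnot
    push Not at hnot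
    obtain ⟨y₀, hy₀, hhy₀⟩ := hnot
    have hy₀0 : y₀ ≠ 0 := by rintro rfl; simp at hy₀
    -- After inverting if necessary, `y` is integral.
    obtain ⟨y, hy0, hyv, hyw, hhy⟩ : ∃ y, y ≠ 0 ∧ y ∈ v ∧ y⁻¹ ∈ w ∧ ev h y ≠ 0 := by
      rcases v.mem_or_inv_mem y₀ with e | e
      · exact ⟨y₀, hy₀0, e, mem_of_valuation_eq_one (by rw [map_inv₀, hy₀, inv_one]), hhy₀⟩
      · refine ⟨y₀⁻¹, inv_ne_zero hy₀0, e, ?_, ?_⟩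
        · rw [inv_inv]; exact mem_of_valuation_eq_one hy₀
        · rw [ev_inv h hy₀0]; exact neg_ne_zero.mpr hhy₀
    have hex : ∃ n : ℕ, x ^ n * y⁻¹ ∈ v := (hmem _).mp hyw
    classical
    have hn := Nat.find_spec hex
    have hmin := fun m => @Nat.find_min _ _ hex m
    obtain ⟨n, hn'⟩ : ∃ n, n = Nat.find hex := ⟨_, rfl⟩
    rw [← hn'] at hn
    rcases n with _ | n
    · refine absurd (hI y ?_) hhy
      refine le_antisymm ((v.valuation_le_one_iff _).mpr hyv) ?_
      rw [pow_zero, one_mul, ← v.valuation_le_one_iff, map_inv₀] at hn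
      exact (inv_le_one₀ (by rw [zero_lt_iff, Valuation.ne_zero_iff]; exact hy0)).mp hn
    · have hlt : x ^ n * y⁻¹ ∉ v := hmin n (by omega)
      have hlog : ∀ m : ℕ, ev h (x ^ m) = 0 := by
        intro m
        induction m with
        | zero => rw [pow_zero]; exact hI 1 (map_one _)
        | succ m ih => rw [pow_succ, ev_mul h (pow_ne_zero m h0) h0, ih, hhx, add_zero]
      have hxn := pow_ne_zero n h0
      have hz0 : (x ^ n * y⁻¹) ≠ 0 := mul_ne_zero hxn (inv_ne_zero hy0)
      have hz : ev h (x ^ n * y⁻¹)⁻¹ ≠ 0 := by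
        rw [ev_inv h hz0, ev_mul h hxn (inv_ne_zero hy0), hlog, ev_inv h hy0]
        simpa using hhy
      refine ⟨(x ^ n * y⁻¹)⁻¹, inv_ne_zero hz0, valuation_inv_lt_one hlt, ?_, hz⟩
      have hquot : x / (x ^ n * y⁻¹)⁻¹ = x ^ (n + 1) * y⁻¹ := by field_simp; ring
      refine lt_of_le_of_ne ((v.valuation_le_one_iff _).mpr (by rwa [hquot])) fun e => ?_
      have := hI _ e
      rw [div_eq_mul_inv, ev_mul h h0 (by simpa using hz0), hhx, zero_add, inv_inv] at this
      rw [ev_inv h hz0, this, neg_zero] at hz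
      exact hz rfl
  rw [mem_decomposition_iff]
  intro x' hx'
  obtain ⟨x, rfl⟩ : ∃ x, x' = 1 - x := ⟨1 - x', by ring⟩
  have hx : v.valuation x < 1 := by
    rwa [sub_sub_cancel_left, Valuation.map_neg] at hx'
  by_cases h0 : x = 0
  · rw [h0, sub_zero, ev_one]
  by_cases hhx : ev h x = 0
  · obtain ⟨y, hy0, hy, hxy, hhy⟩ := keyB x h0 hx hhx
    have h1y := unit hy
    have h1y0 : 1 - y ≠ 0 := by intro e; rw [e] at h1y; simp at h1y
    have hu := unit hxy
    have hu0 : 1 - x / y ≠ 0 := by intro e; rw [e] at hu; simp at hu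
    -- `z = -y u` with a unit `u`.
    set z := -1 * y * ((1 - x / y) * (1 - y)⁻¹) with hz
    have hvu : v.valuation ((1 - x / y) * (1 - y)⁻¹) = 1 := by
      rw [map_mul, map_inv₀, hu, h1y]; simp
    have hm1 : (-1 : K) ≠ 0 := neg_ne_zero.mpr one_ne_zero
    have hz0 : z ≠ 0 := mul_ne_zero (mul_ne_zero hm1 hy0) (mul_ne_zero hu0 (inv_ne_zero h1y0))
    have hvz : v.valuation z < 1 := by
      rw [hz, map_mul, map_mul, hvu, Valuation.map_neg]; simpa using hy
    have hhz : ev h z ≠ 0 := by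
      rw [hz, ev_mul h (mul_ne_zero hm1 hy0) (mul_ne_zero hu0 (inv_ne_zero h1y0)),
        ev_mul h hm1 hy0, hI _ hvu, hI (-1) (by simp)]
      simpa using hhy
    have hprod : 1 - x = (1 - y) * (1 - z) := by
      rw [hz]; field_simp; ring
    have hvz1 := unit hvz
    have h1z0 : 1 - z ≠ 0 := by intro e; rw [e] at hvz1; simp at hvz1
    rw [hprod, ev_mul f h1y0 h1z0, keyA y hy0 hy hhy, keyA z hz0 hvz hhz, add_zero]
  · exact keyA x h0 hx hhx

end

/-! ### Alternating spaces and valuations -/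

section

variable {K : Type*} [Field K] {Λ : Type*} [CommRing Λ] [IsDomain Λ]

/-- If every plane in `D` contains a nonzero `h ∈ I (γ h)`, and these `I (γ h)` form a chain, then
one of them contains a hyperplane of `D`. For alternating spaces, `γ h` is the coarsest valuation
with `h` in its inertia space. -/
theorem exists_finrank_le_finrank_inf_add_one {F V ι : Type*} [Field F] [AddCommGroup V]
    [Module F V] (D : Submodule F V) [Module.Finite F D] (hrank : 2 ≤ Module.finrank F D)
    (I : ι → Submodule F V) (γ : V → ι)
    (hpair : ∀ f ∈ D, ∀ g ∈ D, (∀ a b : F, a • f + b • g = 0 → a = 0 ∧ b = 0) →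
      ∃ a b : F, a • f + b • g ≠ 0 ∧ a • f + b • g ∈ I (γ (a • f + b • g)))
    (hchain : ∀ h ∈ D, h ≠ 0 → h ∈ I (γ h) → ∀ h' ∈ D, h' ≠ 0 → h' ∈ I (γ h') →
      I (γ h) ≤ I (γ h') ∨ I (γ h') ≤ I (γ h)) :
    ∃ h ∈ D, h ≠ 0 ∧ h ∈ I (γ h) ∧ Module.finrank F D ≤ Module.finrank F ↥(D ⊓ I (γ h)) + 1 ∧
      ∀ h' ∈ D, h' ∈ I (γ h') → h' ∈ I (γ h) := by
  have hsub : ∀ W : Submodule F V, W ≤ D → 2 ≤ Module.finrank F W →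
      ∃ h ∈ W, h ≠ 0 ∧ h ∈ I (γ h) := by
    intro W hW hr
    have : Module.Finite F W := Submodule.finiteDimensional_of_le hW
    have : Nontrivial W := Module.nontrivial_of_finrank_pos (R := F) (by omega)
    obtain ⟨f, hf⟩ := exists_ne (0 : W)
    obtain ⟨g, hg⟩ := exists_linearIndependent_pair_of_one_lt_finrank (R := F) (by omega) hf
    have hind := LinearIndependent.pair_iff.mp hg
    obtain ⟨a, b, h0, hab⟩ := hpair f (hW f.2) g (hW g.2) fun a b e =>
      hind a b (Subtype.ext (by simpa using e))
    exact ⟨_, W.add_mem (W.smul_mem a f.2) (W.smul_mem b g.2), h0, hab⟩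
  let S : Set V := {h | h ∈ D ∧ h ≠ 0 ∧ h ∈ I (γ h)}
  have hS : S.Nonempty := by
    obtain ⟨h, hh⟩ := hsub D le_rfl hrank
    exact ⟨h, hh⟩
  have hfin : ∀ W : Submodule F V, Module.Finite F ↥(D ⊓ W) := fun W =>
    Submodule.finiteDimensional_of_le inf_le_left
  have hle : ∀ W : Submodule F V, Module.finrank F ↥(D ⊓ W) ≤ Module.finrank F D := fun W =>
    Submodule.finrank_mono inf_le_left
  -- Choose `h` with `D ⊓ I (γ h)` of maximal dimension.
  obtain ⟨h, hhS, hmax⟩ := (measure fun h =>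
    Module.finrank F D - Module.finrank F ↥(D ⊓ I (γ h))).wf.has_min S hS
  have hall : ∀ h' ∈ D, h' ∈ I (γ h') → h' ∈ I (γ h) := by
    intro h' hD' hI'
    by_cases h0 : h' = 0
    · rw [h0]; exact zero_mem _
    rcases hchain h hhS.1 hhS.2.1 hhS.2.2 h' hD' h0 hI' with hc | hc
    · have hm := hmax h' ⟨hD', h0, hI'⟩
      have h1 := hle (I (γ h))
      have h2 := hle (I (γ h'))
      have hm' : ¬ (Module.finrank F D - Module.finrank F ↥(D ⊓ I (γ h')) <
        Module.finrank F D - Module.finrank F ↥(D ⊓ I (γ h))) := hm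
      have := hfin (I (γ h'))
      have e := Submodule.eq_of_le_of_finrank_le (inf_le_inf_left D hc) (by omega)
      have : h' ∈ D ⊓ I (γ h) := e ▸ ⟨hD', hI'⟩
      exact this.2
    · exact hc hI'
  refine ⟨h, hhS.1, hhS.2.1, hhS.2.2, ?_, hall⟩
  by_contra! hlt
  have hfi := hfin (I (γ h))
  set E := D ⊓ I (γ h) with hE
  -- A complement of `E` in `D` would contain another element of this kind.
  obtain ⟨W, hW⟩ := Submodule.exists_isCompl (E.comap D.subtype)
  have hrk := Submodule.finrank_add_eq_of_isCompl hW
  have hEr : Module.finrank F (E.comap D.subtype) = Module.finrank F E :=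
    (Submodule.comapSubtypeEquivOfLe (p := E) (q := D) inf_le_left).finrank_eq
  have hWr : Module.finrank F (W.map D.subtype) = Module.finrank F W :=
    Submodule.finrank_map_subtype_eq D W
  obtain ⟨x, hxW, hx0, hx⟩ := hsub (W.map D.subtype) (Submodule.map_subtype_le D W) (by omega)
  obtain ⟨y, hy, rfl⟩ := hxW
  refine hx0 ?_
  have hyE : y ∈ E.comap D.subtype := ⟨y.2, hall _ y.2 hx⟩
  have := (Submodule.disjoint_def.mp hW.disjoint) y hyE hy
  rw [this]; simp

section

variable {ℓ : ℕ} (hΛ : IsAdic ℓ Λ) (k : Type*) [Field k] [IsAlgClosed k] [Algebra k K]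
include hΛ k

/-- For two independent elements `f`, `g` forming an alternating pair, a non-zero combination of
them vanishes on the units of some valuation. -/
theorem exists_mem_inertia_of_isAlternatingPair {f g : G K Λ} (hfg : IsAlternatingPair f g)
    (hind : ∀ α β : FractionRing Λ, α • f + β • g = 0 → α = 0 ∧ β = 0) :
    ∃ α β : FractionRing Λ, α • f + β • g ≠ 0 ∧
      ∃ v : ValuationSubring K, α • f + β • g ∈ inertia Λ v := by
  have hcol := hfg.isCollinear
  have hf := isLog_ev hΛ k f
  have hg := isLog_ev hΛ k g
  have hcomb : ∀ α β : FractionRing Λ, ∀ x, ev (α • f + β • g) x = α * ev f x + β * ev g x :=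
    fun α β x => by rw [ev_add, ev_smul, ev_smul]
  have hnat : ∀ n : ℕ, (n : K) ≠ 0 → ev f n = 0 ∧ ev g n = 0 := fun n _ => by
    rw [← map_natCast (algebraMap k K)]
    exact ⟨ev_algebraMap hΛ f _, ev_algebraMap hΛ g _⟩
  set φ : K → FractionRing Λ × FractionRing Λ := fun x => (ev f x, ev g x) with hφ
  have hφlog : IsLog φ := ⟨fun x y hx hy => Prod.ext (hf.map_mul x y hx hy) (hg.map_mul x y hx hy),
    Prod.ext hf.map_neg_one hg.map_neg_one⟩
  have hproj : ∀ x, x ≠ 0 → φ x ≠ 0 → ∃ a : FractionRing Λ, φ (1 + x) = a • φ x := by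
    intro x hx hφx
    have h1x : 1 + x ≠ 0 := by
      intro e
      have hxe : x = -1 := by linear_combination e
      exact hφx (hxe ▸ hφlog.map_neg_one)
    have h := hcol 1 x one_ne_zero hx h1x
    rw [hf.map_one, hg.map_one] at h
    by_cases hfx : ev f x = 0
    · have hgx : ev g x ≠ 0 := fun e => hφx (Prod.ext hfx e)
      refine ⟨ev g (1 + x) / ev g x, Prod.ext ?_ ?_⟩
      · simp only [hφ, Prod.smul_mk, smul_eq_mul, hfx, mul_zero]
        rw [hfx] at h
        refine (mul_eq_zero.mp ?_).resolve_right hgx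
        linear_combination -h
      · simp only [hφ, Prod.smul_mk, smul_eq_mul]; field_simp
    · refine ⟨ev f (1 + x) / ev f x, Prod.ext ?_ ?_⟩
      · simp only [hφ, Prod.smul_mk, smul_eq_mul]; field_simp
      · simp only [hφ, Prod.smul_mk, smul_eq_mul]
        field_simp
        linear_combination h
  -- It suffices to kill a suitable class `c`.
  have finish : ∀ c : FractionRing Λ × FractionRing Λ, c ≠ 0 →
      IsCoherentPair φ (fun x => c.1 * ev g x - c.2 * ev f x) →
      ∃ α β : FractionRing Λ, α • f + β • g ≠ 0 ∧
        ∃ v : ValuationSubring K, α • f + β • g ∈ inertia Λ v := by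
    intro c hc H
    refine ⟨-c.2, c.1, fun e => ?_, ?_⟩
    · obtain ⟨h1, h2⟩ := hind _ _ e
      exact hc (Prod.ext h2 (by simpa using h1))
    · obtain ⟨v, hv⟩ := H.exists_valuationSubring
      refine ⟨v, mem_inertia_iff.mpr fun x hx => ?_⟩
      rw [hcomb, ← hv x hx]; ring
  have hlin : ∀ c : FractionRing Λ × FractionRing Λ,
      IsLog (fun x => c.1 * ev g x - c.2 * ev f x) := fun c =>
    ⟨fun x y hx hy => by simp only [hf.map_mul x y hx hy, hg.map_mul x y hx hy]; ring,
      by simp only [hf.map_neg_one, hg.map_neg_one]; ring⟩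
  have hker : ∀ c : FractionRing Λ × FractionRing Λ, ∀ x, φ x = 0 →
      c.1 * ev g x - c.2 * ev f x = 0 := fun c x e => by
    have h1 : ev f x = 0 := congrArg Prod.fst e
    have h2 : ev g x = 0 := congrArg Prod.snd e
    rw [h1, h2]; ring
  by_cases h2 : (2 : FractionRing Λ) = 0
  · have hexp : ∀ a : FractionRing Λ × FractionRing Λ, a + a = 0 := fun a => by
      have h : ∀ b : FractionRing Λ, b + b = 0 := fun b => by rw [← two_mul, h2, zero_mul]
      exact Prod.ext (h _) (h _)
    have H : IsRigidPair φ φ := by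
      refine ⟨hφlog, hφlog, fun _ _ e => e, fun x hx hφx => ?_⟩
      obtain ⟨a, ha⟩ := hproj x hx hφx
      rcases hΛ.eq_zero_or_one_of_two_eq_zero h2 a with rfl | rfl
      · left; simpa using ha
      · right; simpa using ha
    obtain ⟨c, hc, hcb⟩ : ∃ c : FractionRing Λ × FractionRing Λ, c ≠ 0 ∧
        ∀ c', IsDegenerate φ c' → c' = c := by
      by_cases hex : ∃ c, IsDegenerate φ c
      · obtain ⟨c, hc⟩ := hex
        refine ⟨c, ?_, fun c' hc' => hc'.eq H hexp hc⟩
        obtain ⟨p, q, hp, -, rfl, -⟩ := hc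
        exact hp.2.1
      · exact ⟨(1, 0), by simp, fun c hc => absurd ⟨c, hc⟩ hex⟩
    refine finish c hc ?_
    let η : FractionRing Λ × FractionRing Λ →+ FractionRing Λ :=
      (AddMonoidHom.mulLeft c.1).comp (AddMonoidHom.snd _ _) -
        (AddMonoidHom.mulLeft c.2).comp (AddMonoidHom.fst _ _)
    exact isCoherentPair_of_exponent_two H hexp η fun c' hc' => by
      rw [hcb c' hc']
      simp [η, mul_comm]
  · have htf : ∀ a : FractionRing Λ, a + a = 0 → a = 0 := fun a ha => by
      rw [← two_mul] at ha
      exact (mul_eq_zero.mp ha).resolve_left h2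
    have hbdd : ∀ α β t : FractionRing Λ, t ≠ 0 →
        (∃ n : ℕ, ∀ z : K, z ≠ 0 → (n + t) * (α * ev f z + β * ev g z) ≠ t) ∨
        (∃ n : ℕ, ∀ z : K, z ≠ 0 → (n + t⁻¹) * (α * ev f z + β * ev g z) ≠ t⁻¹) := by
      intro α β t ht
      obtain ⟨r, hr, hb⟩ := ev_bounded (α • f + β • g)
      have := hΛ.exists_forall_ne (Set.range (ev (α • f + β • g))) r hr
        (by rintro _ ⟨x, rfl⟩; exact hb x) t ht
      refine this.imp ?_ ?_ <;> rintro ⟨n, hn⟩ <;> refine ⟨n, fun z _ => ?_⟩ <;> rw [← hcomb] <;>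
        exact hn _ ⟨z, rfl⟩
    obtain ⟨c, hc, hcr⟩ : ∃ c : FractionRing Λ × FractionRing Λ, c ≠ 0 ∧ ∀ x, x ≠ 0 →
        c.1 * ev g x - c.2 * ev f x ≠ 0 → φ (1 + x) = 0 ∨ φ (1 + x) = φ x := by
      by_cases hex : ∃ x, x ≠ 0 ∧ φ x ≠ 0 ∧ φ (1 + x) ≠ 0 ∧ φ (1 + x) ≠ φ x
      · obtain ⟨x, hx, hφx, hne0, hne1⟩ := hex
        refine ⟨φ x, hφx, fun y hy hhy => ?_⟩
        have hφy : φ y ≠ 0 := fun e => hhy (hker _ _ e)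
        obtain ⟨a, ha⟩ := hproj x hx hφx
        obtain ⟨b, hb⟩ := hproj y hy hφy
        by_contra! hcon
        refine hhy (sub_eq_zero.mpr ?_)
        exact map_mul_map_eq_of_nonrigid hf hg hcol hnat hbdd hx hy (a := a) (b := b)
          (by rintro rfl; exact hne0 (by rw [ha, zero_smul]))
          (by rintro rfl; exact hne1 (by rw [ha, one_smul]))
          (by rintro rfl; exact hcon.1 (by rw [hb, zero_smul]))
          (by rintro rfl; exact hcon.2 (by rw [hb, one_smul]))
          (congrArg Prod.fst ha) (congrArg Prod.snd ha) (congrArg Prod.fst hb)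
          (congrArg Prod.snd hb)
      · push Not at hex
        refine ⟨(1, 0), by simp, fun x hx hhx => or_iff_not_imp_left.mpr fun h => hex x hx ?_ h⟩
        exact fun e => hhx (hker _ _ e)
    refine finish c hc (IsRigidPair.isCoherentPair_of_two_torsion_free
      ⟨hφlog, hlin c, fun x _ e => hker c x e, hcr⟩ htf)

/-- An alternating space of finite dimension at least `2` is contained in the decomposition space
of a valuation whose inertia space meets it in a subspace of codimension at most `1`. -/
theorem exists_valuation_of_isAlternating (D : Submodule (FractionRing Λ) (G K Λ))
    (hD : IsAlternating (D : Set (G K Λ))) (hrank : 2 ≤ Module.finrank (FractionRing Λ) D) :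
    ∃ V : ValuationSubring K, D ≤ decomposition Λ V ∧
      Module.finrank (FractionRing Λ) D ≤ Module.finrank (FractionRing Λ) ↥(D ⊓ inertia Λ V) + 1 ∧
      ∀ h ∈ D, ∀ w, h ∈ inertia Λ w → h ∈ inertia Λ V := by
  classical
  have hfin : FiniteDimensional (FractionRing Λ) D :=
    FiniteDimensional.of_finrank_pos (lt_of_lt_of_le Nat.two_pos hrank)
  -- The coarsest valuation attached to an element.
  let γ : G K Λ → ValuationSubring K := fun h =>
    if hh : ∃ v, h ∈ inertia Λ v then (exists_isGreatest_inertia hh).choose else ⊤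
  have hγ : ∀ h, (∃ v, h ∈ inertia Λ v) →
      IsGreatest {w : ValuationSubring K | h ∈ inertia Λ w} (γ h) := fun h hh => by
    simp only [γ, dif_pos hh]
    exact (exists_isGreatest_inertia hh).choose_spec
  have hchain : ∀ h ∈ D, h ∈ inertia Λ (γ h) → ∀ h' ∈ D, h' ∈ inertia Λ (γ h') →
      γ h ≤ γ h' ∨ γ h' ≤ γ h := by
    intro h hhD hh h' hhD' hh'
    by_contra! hcon
    have := mem_inertia_sup hcon.1 hcon.2 (inertia_le_decomposition _ hh)
      (mem_decomposition_of_isGreatest (hγ h' ⟨_, hh'⟩) (hD h' hhD' h hhD))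
    exact hcon.2 (le_sup_right.trans ((hγ h ⟨_, hh⟩).2 this))
  obtain ⟨h, hhD, h0, hh, hr, hall⟩ := exists_finrank_le_finrank_inf_add_one D hrank
    (inertia Λ) γ
    (fun f hf g hg hind => by
      obtain ⟨a, b, hab, v, hv⟩ :=
        exists_mem_inertia_of_isAlternatingPair hΛ k (hD f hf g hg) hind
      exact ⟨a, b, hab, (hγ _ ⟨v, hv⟩).1⟩)
    (fun h hhD _ hh h' hhD' _ hh' => (hchain h hhD hh h' hhD' hh').symm.imp
      (fun e => inertia_anti e) (fun e => inertia_anti e))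
  exact ⟨γ h, fun f hf => mem_decomposition_of_isGreatest (hγ h ⟨_, hh⟩) (hD h hhD f hf), hr,
    fun h' hhD' w hw => hall h' hhD' (hγ h' ⟨w, hw⟩).1⟩

end

end

/-! ### Independent values and independent residues -/

section

variable {k : Type*} [Field k] {K : Type*} [Field K] [Algebra k K]

/-- The values of the family `x` are independent modulo the values of `k`: no nontrivial product
`c * ∏ x i ^ n i` with `c` in `k` is a unit of `V`. -/
def ValIndep (k : Type*) [Field k] {K : Type*} [Field K] [Algebra k K] (V : ValuationSubring K)
    {ι : Type*} [Fintype ι] (x : ι → K) : Prop :=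
  (∀ i, x i ≠ 0) ∧
    ∀ (n : ι → ℤ) (c : k), V.valuation (algebraMap k K c * ∏ i, x i ^ n i) = 1 → n = 0

/-- The residues of the family `t` are algebraically independent over the residue field of `k`. In
terms of polynomials over `k`: a primitive polynomial takes a unit value at `t`. -/
def ResIndep (k : Type*) [Field k] {K : Type*} [Field K] [Algebra k K] (V : ValuationSubring K)
    {κ : Type*} (t : κ → K) : Prop :=
  ∀ P : MvPolynomial κ k, (∀ m, V.valuation (algebraMap k K (P.coeff m)) ≤ 1) →
    (∃ m, V.valuation (algebraMap k K (P.coeff m)) = 1) → V.valuation (MvPolynomial.aeval t P) = 1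

theorem coeff_coeff_sumAlgEquiv {R S₁ S₂ : Type*} [CommSemiring R] (P : MvPolynomial (S₁ ⊕ S₂) R)
    (a : S₁ →₀ ℕ) (b : S₂ →₀ ℕ) :
    ((MvPolynomial.sumAlgEquiv R S₁ S₂ P).coeff a).coeff b =
      P.coeff (Finsupp.sumFinsuppAddEquivProdFinsupp.symm (a, b)) := by
  classical
  induction P using MvPolynomial.induction_on' with
  | add p q hp hq => simp only [map_add, MvPolynomial.coeff_add, hp, hq]
  | monomial m r =>
    obtain ⟨⟨a', b'⟩, rfl⟩ := Finsupp.sumFinsuppAddEquivProdFinsupp.symm.surjective m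
    have h : MvPolynomial.sumAlgEquiv R S₁ S₂
        (MvPolynomial.monomial (Finsupp.sumFinsuppAddEquivProdFinsupp.symm (a', b')) r) =
        MvPolynomial.monomial a' (MvPolynomial.monomial b' r) := by
      simp [MvPolynomial.sumAlgEquiv, MvPolynomial.monomial]
    rw [h, MvPolynomial.coeff_monomial, MvPolynomial.coeff_monomial]
    simp only [EmbeddingLike.apply_eq_iff_eq, Prod.mk.injEq]
    split_ifs <;> simp_all

theorem aeval_sumElim_eq_eval₂ {ι κ : Type*} (x : ι → K) (t : κ → K) (P : MvPolynomial (ι ⊕ κ) k) :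
    MvPolynomial.aeval (Sum.elim x t) P =
      MvPolynomial.eval₂ (MvPolynomial.aeval t : MvPolynomial κ k →ₐ[k] K).toRingHom x
        (MvPolynomial.sumAlgEquiv k ι κ P) := by
  induction P using MvPolynomial.induction_on with
  | C a => simp
  | add p q hp hq => simp only [map_add, hp, hq, MvPolynomial.eval₂_add]
  | mul_X p i hp =>
    rw [map_mul, map_mul, MvPolynomial.eval₂_mul, hp]
    cases i <;> simp

/-- The Gauss valuation: after scaling, a nonzero polynomial is primitive. -/
theorem ResIndep.exists_valuation_eq {V : ValuationSubring K} {κ : Type*} {t : κ → K}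
    (ht : ResIndep k V t) {P : MvPolynomial κ k} (hP : P ≠ 0) :
    ∃ m, P.coeff m ≠ 0 ∧ V.valuation (MvPolynomial.aeval t P) =
      V.valuation (algebraMap k K (P.coeff m)) ∧
      ∀ m', V.valuation (algebraMap k K (P.coeff m')) ≤
        V.valuation (algebraMap k K (P.coeff m)) := by
  obtain ⟨m, hm, hmax⟩ := P.support.exists_max_image
    (fun m => V.valuation (algebraMap k K (P.coeff m))) (by simpa using hP)
  have hm0 : P.coeff m ≠ 0 := MvPolynomial.mem_support_iff.1 hm
  have hv0 : V.valuation (algebraMap k K (P.coeff m)) ≠ 0 := by simpa using hm0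
  have hle : ∀ m', V.valuation (algebraMap k K (P.coeff m')) ≤
      V.valuation (algebraMap k K (P.coeff m)) := by
    intro m'
    by_cases h : m' ∈ P.support
    · exact hmax m' h
    · rw [MvPolynomial.notMem_support_iff.1 h]; simp
  refine ⟨m, hm0, ?_, hle⟩
  have h := ht (MvPolynomial.C (P.coeff m)⁻¹ * P) ?_ ?_
  · simp only [map_mul, MvPolynomial.algHom_C, map_inv₀] at h
    rwa [inv_mul_eq_one₀ hv0, eq_comm] at h
  · intro m'
    simp only [MvPolynomial.coeff_C_mul, map_mul, map_inv₀]
    rw [inv_mul_le_iff₀ (zero_lt_iff.2 hv0), mul_one]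
    exact hle m'
  · refine ⟨m, ?_⟩
    simp only [MvPolynomial.coeff_C_mul, map_mul, map_inv₀]
    exact inv_mul_cancel₀ hv0

/-- A sum of elements with distinct values has the value of its largest term. -/
theorem exists_valuation_sum_eq {α : Type*} (V : ValuationSubring K) {s : Finset α}
    (hs : s.Nonempty) (f : α → K)
    (hinj : ∀ a ∈ s, ∀ b ∈ s, V.valuation (f a) = V.valuation (f b) → a = b) :
    ∃ a ∈ s, V.valuation (∑ b ∈ s, f b) = V.valuation (f a) ∧
      ∀ b ∈ s, V.valuation (f b) ≤ V.valuation (f a) := by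
  classical
  obtain ⟨a, ha, hmax⟩ := s.exists_max_image (fun a => V.valuation (f a)) hs
  refine ⟨a, ha, ?_, hmax⟩
  refine V.valuation.map_sum_eq_of_lt ha fun b hb => ?_
  simp only [Finset.mem_sdiff, Finset.mem_singleton] at hb
  exact lt_of_le_of_ne (hmax b hb.1) (fun h => hb.2 (hinj b hb.1 a ha h))

/-- The value of a polynomial in elements with independent values and elements with independent
residues is the maximum of the values `c * ∏ x i ^ m i`, for its coefficients `c`. -/
theorem ValIndep.exists_valuation_eq {V : ValuationSubring K} {ι κ : Type*} [Fintype ι]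
    {x : ι → K} {t : κ → K} (hx : ValIndep k V x) (ht : ResIndep k V t)
    {P : MvPolynomial (ι ⊕ κ) k} (hP : P ≠ 0) :
    ∃ m, P.coeff m ≠ 0 ∧ V.valuation (MvPolynomial.aeval (Sum.elim x t) P) =
      V.valuation (algebraMap k K (P.coeff m) * ∏ i, x i ^ m (Sum.inl i)) ∧
      ∀ m', V.valuation (algebraMap k K (P.coeff m') * ∏ i, x i ^ m' (Sum.inl i)) ≤
        V.valuation (algebraMap k K (P.coeff m) * ∏ i, x i ^ m (Sum.inl i)) := by
  classical
  set Q := MvPolynomial.sumAlgEquiv k ι κ P with hQ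
  have hQ0 : Q ≠ 0 := by simpa [hQ] using hP
  have hsum : MvPolynomial.aeval (Sum.elim x t) P =
      ∑ a ∈ Q.support, MvPolynomial.aeval t (Q.coeff a) * ∏ i, x i ^ a i := by
    rw [aeval_sumElim_eq_eval₂, MvPolynomial.eval₂_eq']
    rfl
  have hprod : ∀ a : ι → ℕ, ∏ i, x i ^ a i ≠ 0 := fun a =>
    Finset.prod_ne_zero_iff.2 fun i _ => pow_ne_zero _ (hx.1 i)
  have key : ∀ a ∈ Q.support, ∃ b, (Q.coeff a).coeff b ≠ 0 ∧
      V.valuation (MvPolynomial.aeval t (Q.coeff a)) =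
        V.valuation (algebraMap k K ((Q.coeff a).coeff b)) ∧
      ∀ b', V.valuation (algebraMap k K ((Q.coeff a).coeff b')) ≤
        V.valuation (algebraMap k K ((Q.coeff a).coeff b)) := fun a ha =>
    ht.exists_valuation_eq (MvPolynomial.mem_support_iff.1 ha)
  choose! β hβ0 hβ hβmax using key
  have hval : ∀ a ∈ Q.support, V.valuation (MvPolynomial.aeval t (Q.coeff a) * ∏ i, x i ^ a i) =
      V.valuation (algebraMap k K ((Q.coeff a).coeff (β a)) * ∏ i, x i ^ a i) := by
    intro a ha
    rw [map_mul, hβ a ha, map_mul]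
  obtain ⟨a, ha, hsa, hmax⟩ := exists_valuation_sum_eq V (s := Q.support)
    (by simpa using hQ0) (fun a => MvPolynomial.aeval t (Q.coeff a) * ∏ i, x i ^ a i) (by
      intro a ha b hb h
      rw [hval a ha, hval b hb] at h
      have hb0 : V.valuation (algebraMap k K ((Q.coeff b).coeff (β b)) * ∏ i, x i ^ b i) ≠ 0 := by
        rw [Valuation.ne_zero_iff]
        exact mul_ne_zero (by simpa using hβ0 b hb) (hprod b)
      have := hx.2 (fun i => (a i : ℤ) - b i)
        ((Q.coeff a).coeff (β a) * ((Q.coeff b).coeff (β b))⁻¹) (by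
          rw [← div_eq_one_iff_eq hb0, ← map_div₀] at h
          rw [← h]
          congr 1
          have : ∏ i, x i ^ ((a i : ℤ) - b i) = (∏ i, x i ^ a i) / ∏ i, x i ^ b i := by
            rw [← Finset.prod_div_distrib]
            exact Finset.prod_congr rfl fun i _ => by
              rw [zpow_sub₀ (hx.1 i), zpow_natCast, zpow_natCast]
          rw [this, map_mul, map_inv₀]
          field_simp)
      ext i
      have := congrFun this i
      simp only [Pi.zero_apply] at this
      omega)
  have hcoeff : ∀ a b, (Q.coeff a).coeff b =
      P.coeff (Finsupp.sumFinsuppAddEquivProdFinsupp.symm (a, b)) :=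
    coeff_coeff_sumAlgEquiv P
  refine ⟨Finsupp.sumFinsuppAddEquivProdFinsupp.symm (a, β a), ?_, ?_, ?_⟩
  · rw [← hcoeff]
    exact hβ0 a ha
  · rw [hsum, hsa, hval a ha, hcoeff]
    simp
  · intro m'
    obtain ⟨⟨a', b'⟩, rfl⟩ := Finsupp.sumFinsuppAddEquivProdFinsupp.symm.surjective m'
    rw [← hcoeff, ← hcoeff]
    simp only [Finsupp.sumFinsuppAddEquivProdFinsupp_symm_inl]
    rw [← hval a ha]
    by_cases ha' : a' ∈ Q.support
    · refine le_trans ?_ (hmax a' ha')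
      rw [hval a' ha', map_mul, map_mul]
      exact mul_le_mul_left (hβmax a' ha' b') _
    · rw [MvPolynomial.notMem_support_iff.1 ha']
      simp

theorem valuation_le_of_le {V v : ValuationSubring K} (hVv : V ≤ v) {a b : K}
    (h : V.valuation a ≤ V.valuation b) : v.valuation a ≤ v.valuation b := by
  rw [← ValuationSubring.mapOfLE_valuation_apply V v hVv,
    ← ValuationSubring.mapOfLE_valuation_apply V v hVv]
  exact ValuationSubring.monotone_mapOfLE V v hVv h

/-- Elements with independent values, together with elements with independent residues, have
independent residues for every coarser valuation for which they are units. -/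
theorem ValIndep.resIndep_sumElim {V v : ValuationSubring K} (hVv : V ≤ v) {ι κ : Type*} [Fintype ι]
    {x : ι → K} {t : κ → K} (hx : ValIndep k V x) (ht : ResIndep k V t)
    (hxv : ∀ i, v.valuation (x i) = 1) : ResIndep k v (Sum.elim x t) := by
  intro P hP hP1
  obtain ⟨m₁, hm₁⟩ := hP1
  have hP0 : P ≠ 0 := by
    rintro rfl
    simp at hm₁
  obtain ⟨m, -, hval, hmax⟩ := hx.exists_valuation_eq ht hP0
  have hprod : ∀ m : ι → ℕ, v.valuation (∏ i, x i ^ m i) = 1 := fun m => by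
    rw [map_prod]
    exact Finset.prod_eq_one fun i _ => by rw [map_pow, hxv i, one_pow]
  have h1 := valuation_le_of_le hVv hval.le
  have h2 := valuation_le_of_le hVv hval.ge
  have h3 := valuation_le_of_le hVv (hmax m₁)
  rw [map_mul, hprod (fun i => m (Sum.inl i)), mul_one] at h1 h2
  rw [map_mul, map_mul, hprod (fun i => m (Sum.inl i)), hprod (fun i => m₁ (Sum.inl i)), hm₁,
    mul_one, mul_one] at h3
  exact le_antisymm (h1.trans (hP m)) (h3.trans h2)

theorem ValIndep.algebraicIndependent {V : ValuationSubring K} {ι κ : Type*} [Fintype ι]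
    {x : ι → K} {t : κ → K} (hx : ValIndep k V x) (ht : ResIndep k V t) :
    AlgebraicIndependent k (Sum.elim x t) := by
  rw [algebraicIndependent_iff]
  intro P hP
  by_contra hP0
  obtain ⟨m, hm, hval, -⟩ := hx.exists_valuation_eq ht hP0
  rw [hP, map_zero, eq_comm, map_eq_zero] at hval
  exact mul_ne_zero (by simpa using hm)
    (Finset.prod_ne_zero_iff.2 fun i _ => pow_ne_zero _ (hx.1 i)) hval

theorem valIndep_of_isEmpty (V : ValuationSubring K) {ι : Type*} [Fintype ι] [IsEmpty ι]
    (x : ι → K) : ValIndep k V x :=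
  ⟨fun i => isEmptyElim i, fun _ _ _ => Subsingleton.elim _ _⟩

theorem resIndep_of_isEmpty (V : ValuationSubring K) {κ : Type*} [IsEmpty κ] (t : κ → K) :
    ResIndep k V t := by
  intro P _ ⟨m, hm⟩
  obtain ⟨c, rfl⟩ := MvPolynomial.C_surjective κ P
  rw [Subsingleton.elim m 0, MvPolynomial.coeff_zero_C] at hm
  rwa [MvPolynomial.aeval_C]

theorem ResIndep.comp {V : ValuationSubring K} {κ κ' : Type*} {t : κ → K} (ht : ResIndep k V t)
    (e : κ' → κ) (he : Function.Injective e) : ResIndep k V (t ∘ e) := by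
  intro P hP ⟨m, hm⟩
  rw [← MvPolynomial.aeval_rename]
  refine ht _ (fun m' => ?_) ⟨m.mapDomain e, ?_⟩
  · by_cases h : (MvPolynomial.rename e P).coeff m' = 0
    · rw [h]; simp
    · obtain ⟨u, rfl, -⟩ := MvPolynomial.coeff_rename_ne_zero e P m' h
      rw [MvPolynomial.coeff_rename_mapDomain e he]
      exact hP u
  · rwa [MvPolynomial.coeff_rename_mapDomain e he]

theorem ResIndep.mono {V v : ValuationSubring K} (hVv : V ≤ v) {κ : Type*} {t : κ → K}
    (ht : ResIndep k V t) : ResIndep k v t :=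
  ((valIndep_of_isEmpty V (Empty.elim)).resIndep_sumElim hVv ht (fun i => i.elim)).comp
    Sum.inr Sum.inr_injective

theorem ResIndep.valuation_eq_one {V : ValuationSubring K} {κ : Type*} {t : κ → K}
    (ht : ResIndep k V t) (i : κ) : V.valuation (t i) = 1 := by
  classical
  have := ht (MvPolynomial.X i) (fun m => ?_) ⟨Finsupp.single i 1, by simp⟩
  · simpa using this
  · rw [MvPolynomial.coeff_X]
    split_ifs <;> simp

/-- Abhyankar's inequality. -/
theorem ValIndep.card_add_card_le {V : ValuationSubring K} {ι κ : Type} [Fintype ι] [Fintype κ]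
    {x : ι → K} {t : κ → K} (hx : ValIndep k V x) (ht : ResIndep k V t) {d : ℕ}
    (hd : Algebra.trdeg k K = d) : Fintype.card ι + Fintype.card κ ≤ d := by
  have := (hx.algebraicIndependent ht).lift_cardinalMk_le_trdeg
  rw [hd, Cardinal.mk_fintype, Fintype.card_sum, Cardinal.lift_natCast,
    Cardinal.lift_natCast] at this
  exact_mod_cast this

end

/-! ### Comparison with the residue field extension -/

section

variable {k : Type*} [Field k] {K : Type*} [Field K] [Algebra k K]

/-- The residue field of `k`, for the restriction of `V` to `k`. -/
abbrev BaseResidueField (k : Type*) [Field k] {K : Type*} [Field K] [Algebra k K]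
    (V : ValuationSubring K) : Type _ :=
  IsLocalRing.ResidueField (V.comap (algebraMap k K))

/-- The embedding of residue fields induced by `k → K`. -/
noncomputable abbrev residueMap (k : Type*) [Field k] {K : Type*} [Field K] [Algebra k K]
    (V : ValuationSubring K) : BaseResidueField k V →+* IsLocalRing.ResidueField V :=
  IsLocalRing.ResidueField.map (ringInclusion k V)

theorem valuation_lt_one_iff_residue {V : ValuationSubring K} (a : V) :
    V.valuation (a : K) < 1 ↔ IsLocalRing.residue V a = 0 := by
  rw [IsLocalRing.residue_eq_zero_iff, ValuationSubring.valuation_lt_one_iff]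

theorem valuation_algebraMap_eq_one_iff {V : ValuationSubring K} (a : V.comap (algebraMap k K)) :
    V.valuation (algebraMap k K a) = 1 ↔ IsLocalRing.residue _ a ≠ 0 := by
  have h1 : residueMap k V (IsLocalRing.residue _ a) =
    IsLocalRing.residue V (ringInclusion k V a) := rfl
  rw [← (residueMap k V).injective.ne_iff, map_zero, h1, Ne, ← valuation_lt_one_iff_residue, not_lt]
  have : V.valuation (algebraMap k K a) ≤ 1 := (V.valuation_le_one_iff _).2 a.2
  exact ⟨fun h => h.ge, fun h => le_antisymm this h⟩

theorem eval₂_residueMap {V : ValuationSubring K} {κ : Type*} (t : κ → V)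
    (P : MvPolynomial κ (V.comap (algebraMap k K))) :
    IsLocalRing.residue V (P.eval₂ (ringInclusion k V) t) =
      (P.map (IsLocalRing.residue _)).eval₂ (residueMap k V)
        (fun i => IsLocalRing.residue V (t i)) := by
  rw [MvPolynomial.eval₂_map]
  exact MvPolynomial.eval₂_comp_left (IsLocalRing.residue V) (ringInclusion k V) t P

theorem aeval_map_subtype {V : ValuationSubring K} {κ : Type*} (t : κ → V)
    (P : MvPolynomial κ (V.comap (algebraMap k K))) :
    MvPolynomial.aeval (fun i => (t i : K)) (P.map (V.comap (algebraMap k K)).subtype) =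
      ((P.eval₂ (ringInclusion k V) t : V) : K) := by
  have := MvPolynomial.eval₂_comp_left V.subtype (ringInclusion k V) t P
  rw [MvPolynomial.aeval_def, MvPolynomial.eval₂_map]
  exact this.symm

theorem exists_map_subtype_eq {V : ValuationSubring K} {κ : Type*} {P : MvPolynomial κ k}
    (hP : ∀ m, V.valuation (algebraMap k K (P.coeff m)) ≤ 1) :
    ∃ Q : MvPolynomial κ (V.comap (algebraMap k K)),
      Q.map (V.comap (algebraMap k K)).subtype = P := by
  change P ∈ Set.range (MvPolynomial.map (V.comap (algebraMap k K)).subtype)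
  rw [MvPolynomial.mem_range_map_iff_coeffs_subset]
  intro a ha
  obtain ⟨m, -, rfl⟩ := MvPolynomial.mem_coeffs_iff.1 ha
  exact ⟨⟨P.coeff m, (V.valuation_le_one_iff _).1 (hP m)⟩, rfl⟩

/-- Independence of residues is algebraic independence in the residue field. -/
theorem resIndep_iff {V : ValuationSubring K} {κ : Type*} (t : κ → V) :
    ResIndep k V (fun i => (t i : K)) ↔
      letI := (residueMap k V).toAlgebra
      AlgebraicIndependent (BaseResidueField k V) (fun i => IsLocalRing.residue V (t i)) := by
  let _ := (residueMap k V).toAlgebra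
  change _ ↔ AlgebraicIndependent (BaseResidueField k V) (fun i => IsLocalRing.residue V (t i))
  rw [algebraicIndependent_iff]
  constructor
  · intro h p hp
    by_contra hp0
    obtain ⟨P, rfl⟩ := MvPolynomial.map_surjective (IsLocalRing.residue (V.comap (algebraMap k K)))
      IsLocalRing.residue_surjective p
    have h1 := h (P.map (V.comap (algebraMap k K)).subtype) (fun m => ?_) ?_
    · rw [aeval_map_subtype] at h1
      have h2 : IsLocalRing.residue V (P.eval₂ (ringInclusion k V) t) = 0 := by
        rw [eval₂_residueMap]
        exact hp
      rw [← valuation_lt_one_iff_residue] at h2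
      exact h2.ne h1
    · rw [MvPolynomial.coeff_map]
      exact (V.valuation_le_one_iff _).2 (P.coeff m).2
    · obtain ⟨m, hm⟩ := MvPolynomial.ne_zero_iff.1 hp0
      refine ⟨m, ?_⟩
      rw [MvPolynomial.coeff_map] at hm ⊢
      exact (valuation_algebraMap_eq_one_iff _).2 hm
  · intro h P hP ⟨m, hm⟩
    obtain ⟨P, rfl⟩ := exists_map_subtype_eq hP
    rw [aeval_map_subtype]
    refine le_antisymm ((V.valuation_le_one_iff _).2 (SetLike.coe_mem _)) (not_lt.1 fun hlt => ?_)
    rw [valuation_lt_one_iff_residue, eval₂_residueMap] at hlt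
    have h0 := h _ hlt
    rw [MvPolynomial.coeff_map] at hm
    refine (valuation_algebraMap_eq_one_iff _).1 hm ?_
    rw [← MvPolynomial.coeff_map, h0, MvPolynomial.coeff_zero]

theorem ResIndep.le_residueTrdeg {V : ValuationSubring K} {n : ℕ} {t : Fin n → K}
    (ht : ResIndep k V t) : (n : Cardinal) ≤ residueTrdeg k V := by
  have hV : ∀ i, t i ∈ V := fun i => mem_of_valuation_eq_one (ht.valuation_eq_one i)
  have h := (resIndep_iff (k := k) (V := V) (fun i => ⟨t i, hV i⟩)).1 ht
  let _ := (residueMap k V).toAlgebra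
  have := AlgebraicIndependent.lift_cardinalMk_le_trdeg h
  simp only [Cardinal.mk_fin, Cardinal.lift_natCast, Cardinal.lift_id'] at this
  exact this

theorem exists_resIndep_of_le_residueTrdeg {V : ValuationSubring K} {n : ℕ}
    (h : (n : Cardinal) ≤ residueTrdeg k V) : ∃ t : Fin n → K, ResIndep k V t := by
  let _ := (residueMap k V).toAlgebra
  obtain ⟨s, hs⟩ := exists_isTranscendenceBasis (BaseResidueField k V) (IsLocalRing.ResidueField V)
  have hc : (n : Cardinal) ≤ Cardinal.mk s := by
    rw [hs.cardinalMk_eq_trdeg]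
    exact h
  have hc' : Cardinal.lift (Cardinal.mk (Fin n)) ≤ Cardinal.lift.{0} (Cardinal.mk s) := by
    simpa using hc
  obtain ⟨e⟩ := Cardinal.lift_mk_le'.1 hc'
  have hind := hs.1.comp e e.injective
  choose r hr using fun i =>
    IsLocalRing.residue_surjective (R := V) (e i : IsLocalRing.ResidueField V)
  refine ⟨fun i => r i, (resIndep_iff r).2 ?_⟩
  simp only [hr]
  exact hind

end

/-! ### Independent elements detected by `𝓘_V` and `𝓓_V` -/

section

variable {k : Type*} [Field k] {K : Type*} [Field K] [Algebra k K]

theorem isAlgClosed_residueField [IsAlgClosed k] (A : ValuationSubring k) :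
    IsAlgClosed (IsLocalRing.ResidueField A) := by
  refine IsAlgClosed.of_exists_root _ fun p hp hirr => ?_
  obtain ⟨P, rfl, hdeg, hP⟩ := Polynomial.lifts_and_natDegree_eq_and_monic
    ((Polynomial.mem_lifts p).2 (Polynomial.map_surjective _ IsLocalRing.residue_surjective p)) hp
  have hdeg' : (P.map (algebraMap A k)).degree ≠ 0 := by
    rw [hP.degree_map, ← hP.degree_map (IsLocalRing.residue A)]
    exact (Polynomial.degree_pos_of_irreducible hirr).ne'
  obtain ⟨r, hr⟩ := IsAlgClosed.exists_root (P.map (algebraMap A k)) hdeg'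
  have hint : IsIntegral A r := ⟨P, hP, by
    rwa [Polynomial.IsRoot, Polynomial.eval_map] at hr⟩
  obtain ⟨a, rfl⟩ := IsIntegrallyClosed.isIntegral_iff.1 hint
  refine ⟨IsLocalRing.residue A a, ?_⟩
  rw [Polynomial.IsRoot, Polynomial.eval_map, Polynomial.eval₂_at_apply] at hr
  rw [Polynomial.eval_map, Polynomial.eval₂_at_apply,
    IsFractionRing.injective A k (hr.trans (map_zero _).symm), map_zero]

variable {Λ : Type*} [CommRing Λ] [IsDomain Λ]

/-- The residue of `u` is transcendental: otherwise it is the residue of a constant, which is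
killed by `f`. -/
theorem resIndep_of_ev_ne_zero {ℓ : ℕ} (hΛ : IsAdic ℓ Λ) [IsAlgClosed k] {V : ValuationSubring K}
    {f : G K Λ} (hf : f ∈ decomposition Λ V) {u : K} (hu : V.valuation u = 1) (hfu : ev f u ≠ 0) :
    ResIndep k V (fun _ : Unit => u) := by
  have := isAlgClosed_residueField (V.comap (algebraMap k K))
  let _ := (residueMap k V).toAlgebra
  refine (resIndep_iff (k := k) (V := V) (fun _ : Unit => ⟨u, mem_of_valuation_eq_one hu⟩)).2 ?_
  rw [algebraicIndependent_unique_type_iff]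
  intro halg
  have hdeg := IsAlgClosed.degree_eq_one_of_irreducible (BaseResidueField k V)
    (minpoly.irreducible halg.isIntegral)
  obtain ⟨a, ha⟩ := minpoly.mem_range_of_degree_eq_one _ _ hdeg
  obtain ⟨a, rfl⟩ := IsLocalRing.residue_surjective a
  have ha' : IsLocalRing.residue V (ringInclusion k V a) =
    IsLocalRing.residue V ⟨u, mem_of_valuation_eq_one hu⟩ := ha
  rw [← sub_eq_zero, ← map_sub, ← valuation_lt_one_iff_residue] at ha'
  have hlt : V.valuation (algebraMap k K a - u) < 1 := ha'
  have hu0 : u ≠ 0 := by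
    rintro rfl
    simp at hu
  have ha0 : algebraMap k K a ≠ 0 := by
    intro h
    rw [h, zero_sub, Valuation.map_neg, hu] at hlt
    exact lt_irrefl _ hlt
  have h1 : ev f (algebraMap k K a * u⁻¹) = 0 := by
    refine mem_decomposition_iff.1 hf _ ?_
    have : algebraMap k K a * u⁻¹ - 1 = (algebraMap k K a - u) * u⁻¹ := by field_simp
    rw [this, map_mul, map_inv₀, hu, inv_one, mul_one]
    exact hlt
  refine hfu ?_
  have h2 := ev_mul f (mul_ne_zero ha0 (inv_ne_zero hu0)) hu0
  rw [inv_mul_cancel_right₀ hu0, ev_algebraMap hΛ, h1, zero_add] at h2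
  exact h2.symm

theorem IsAdic.dvd_of_intCast_eq_zero {ℓ : ℕ} (hΛ : IsAdic ℓ Λ) {n : ℤ}
    (hn : (n : FractionRing Λ) = 0) : (ℓ : ℤ) ∣ n := by
  by_contra h
  have hn' : (n : Λ) = 0 := by
    apply IsFractionRing.injective Λ (FractionRing Λ)
    rwa [map_intCast, map_zero]
  obtain ⟨a, b, hab⟩ := (Nat.prime_iff_prime_int.1 hΛ.prime).irreducible.coprime_iff_not_dvd.2 h
  have h1 : (ℓ : Λ) * a = 1 := by
    have := congrArg (Int.cast : ℤ → Λ) hab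
    push_cast at this
    rw [hn', mul_zero, add_zero] at this
    rw [← this, mul_comm]
  refine one_ne_zero (α := Λ) (hΛ.separated 1 fun N => ⟨(a : Λ) ^ N, ?_⟩)
  rw [← mul_pow, h1, one_pow]

/-- A family in `F^ι` spanning it contains a basis. -/
theorem exists_linearIndependent_of_forall_sum_eq_zero {F ι α : Type*} [Field F] [Fintype ι]
    (S : Set α) (φ : α → ι → F) (h : ∀ c : ι → F, (∀ x ∈ S, ∑ i, c i * φ x i = 0) → c = 0) :
    ∃ x : ι → α, (∀ i, x i ∈ S) ∧ LinearIndependent F (fun i => φ (x i)) := by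
  classical
  have hspan : Submodule.span F (φ '' S) = ⊤ := by
    by_contra hne
    obtain ⟨L, hL0, hL⟩ := Submodule.exists_le_ker_of_lt_top _ (lt_top_iff_ne_top.2 hne)
    refine hL0 ?_
    have hLx : ∀ y, L y = ∑ i, L (Pi.single i 1) * y i := by
      intro y
      conv_lhs => rw [pi_eq_sum_univ' y, map_sum]
      refine Finset.sum_congr rfl fun i _ => ?_
      rw [map_smul, smul_eq_mul, mul_comm]
    have := h (fun i => L (Pi.single i 1)) (fun x hx => by
      rw [← hLx]
      exact hL (Submodule.subset_span ⟨x, hx, rfl⟩))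
    ext i
    simpa using congrFun this i
  obtain ⟨b, hb, hbspan, hbind⟩ := exists_linearIndependent F (φ '' S)
  rw [hspan] at hbspan
  let B := Module.Basis.mk hbind (by simpa using hbspan.ge)
  let e := B.indexEquiv (Pi.basisFun F ι)
  choose x hxS hx using fun i => hb (e.symm i).2
  refine ⟨x, hxS, ?_⟩
  simp only [hx]
  exact hbind.comp _ e.symm.injective

/-- A relation `c * ∏ x i ^ n i ∈ U_V` shows that `ℓ` divides all `n i`; taking an `ℓ`-th root of it
makes descent possible. The case of characteristic `0` is covered. -/
theorem valIndep_of_linearIndependent {ℓ : ℕ} (hΛ : IsAdic ℓ Λ) [IsAlgClosed k]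
    {V : ValuationSubring K} {ι : Type*} [Fintype ι] {f : ι → G K Λ}
    (hf : ∀ i, f i ∈ inertia Λ V) {x : ι → K} (hx0 : ∀ i, x i ≠ 0)
    (hx : LinearIndependent (FractionRing Λ) (fun j i => ev (f i) (x j))) : ValIndep k V x := by
  refine ⟨hx0, ?_⟩
  have key : ∀ (N : ℕ) (n : ι → ℤ) (c : k), V.valuation (algebraMap k K c * ∏ i, x i ^ n i) = 1 →
      ∀ j, (ℓ : ℤ) ^ N ∣ n j := by
    intro N
    induction N with
    | zero => simp
    | succ N ih =>
      intro n c h j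
      have hprod : ∏ i, x i ^ n i ≠ 0 := Finset.prod_ne_zero_iff.2 fun i _ => zpow_ne_zero _ (hx0 i)
      have hc0 : algebraMap k K c ≠ 0 := by
        intro h0
        rw [h0, zero_mul, map_zero] at h
        exact zero_ne_one h
      have hdvd : ∀ j, (ℓ : ℤ) ∣ n j := by
        intro j
        refine hΛ.dvd_of_intCast_eq_zero ?_
        refine Fintype.linearIndependent_iff.1 hx (fun j => (n j : FractionRing Λ)) ?_ j
        ext i
        have h1 := mem_inertia_iff.1 (hf i) _ h
        rw [ev_mul _ hc0 hprod, ev_algebraMap hΛ, zero_add,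
          ev_prod _ _ _ fun i _ => zpow_ne_zero _ (hx0 i)] at h1
        simpa [ev_zpow _ (hx0 _)] using h1
      choose m hm using hdvd
      obtain ⟨c', rfl⟩ := IsAlgClosed.exists_pow_nat_eq c hΛ.prime.pos
      have h2 : (algebraMap k K c' * ∏ i, x i ^ m i) ^ ℓ =
          algebraMap k K (c' ^ ℓ) * ∏ i, x i ^ n i := by
        rw [mul_pow, map_pow, ← Finset.prod_pow]
        congr 1
        refine Finset.prod_congr rfl fun i _ => ?_
        rw [hm i, mul_comm, zpow_mul, zpow_natCast]
      rw [← h2, map_pow, pow_eq_one_iff_of_nonneg zero_le hΛ.prime.ne_zero] at h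
      rw [hm j, pow_succ']
      exact mul_dvd_mul_left _ (ih m c' h j)
  intro n c h
  ext j
  refine Int.eq_zero_of_abs_lt_dvd (key (n j).natAbs n c h j) ?_
  rw [Int.abs_eq_natAbs]
  exact_mod_cast Nat.lt_pow_self hΛ.prime.one_lt

/-- Elements of `𝓘_V` that are linearly independent on the units of `v` give `v`-units with
independent `V`-values. -/
theorem exists_valIndep {ℓ : ℕ} (hΛ : IsAdic ℓ Λ) [IsAlgClosed k]
    {V v : ValuationSubring K} {ι : Type*} [Fintype ι] {f : ι → G K Λ}
    (hf : ∀ i, f i ∈ inertia Λ V)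
    (hind : ∀ c : ι → FractionRing Λ, ∑ i, c i • f i ∈ inertia Λ v → c = 0) :
    ∃ x : ι → K, (∀ i, v.valuation (x i) = 1) ∧ ValIndep k V x := by
  obtain ⟨x, hxv, hx⟩ := exists_linearIndependent_of_forall_sum_eq_zero
    {x : K | v.valuation x = 1} (fun x i => ev (f i) x) (fun c hc => hind c (by
      rw [mem_inertia_iff]
      intro x hx
      rw [ev_sum]
      simpa [ev_smul] using hc x hx))
  refine ⟨x, hxv, valIndep_of_linearIndependent hΛ hf (fun i h0 => ?_) hx⟩
  have := hxv i
  simp [h0] at this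

end

/-! ### The value group modulo the values of the base field -/

section

variable {k : Type*} [Field k] {K : Type*} [Field K] [Algebra k K]

/-- The group `vK / vk`, written additively. -/
abbrev RelValueGroup (k : Type*) [Field k] {K : Type*} [Field K] [Algebra k K]
    (V : ValuationSubring K) : Type _ :=
  Additive ((V.ValueGroup)ˣ ⧸ baseValueGroup k V)

/-- The class in `vK / vk` of the value of an element of `Kˣ`. -/
noncomputable def valClass (k : Type*) [Field k] {K : Type*} [Field K] [Algebra k K]
    (V : ValuationSubring K) : Additive Kˣ →+ RelValueGroup k V :=
  MonoidHom.toAdditive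
    ((QuotientGroup.mk' (baseValueGroup k V)).comp (Units.map (V.valuation : K →* V.ValueGroup)))

theorem valClass_surjective (V : ValuationSubring K) : Function.Surjective (valClass k V) := by
  intro q
  obtain ⟨g, hg⟩ := QuotientGroup.mk'_surjective (baseValueGroup k V) q.toMul
  obtain ⟨x, hx⟩ := V.valuation_surjective (g : V.ValueGroup)
  have hx0 : x ≠ 0 := by
    rintro rfl
    rw [map_zero] at hx
    exact g.ne_zero hx.symm
  refine ⟨Additive.ofMul (Units.mk0 x hx0), ?_⟩
  have : Units.map (V.valuation : K →* V.ValueGroup) (Units.mk0 x hx0) = g := Units.ext hx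
  rw [← ofMul_toMul q, ← hg, ← this]
  rfl

theorem valClass_eq_zero_iff (V : ValuationSubring K) (x : Kˣ) :
    valClass k V (Additive.ofMul x) = 0 ↔ ∃ c : k, V.valuation (algebraMap k K c * x) = 1 := by
  have h1 : valClass k V (Additive.ofMul x) = 0 ↔
      Units.map (V.valuation : K →* V.ValueGroup) x ∈ baseValueGroup k V :=
    QuotientGroup.eq_one_iff _
  rw [h1, baseValueGroup, MonoidHom.mem_range]
  constructor
  · rintro ⟨c, hc⟩
    refine ⟨((c⁻¹ : kˣ) : k), ?_⟩
    have hc' : V.valuation (algebraMap k K c) = V.valuation x := congrArg Units.val hc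
    rw [map_mul, ← hc', ← map_mul, ← map_mul]
    simp
  · rintro ⟨c, hc⟩
    have hc0 : c ≠ 0 := by
      rintro rfl
      simp at hc
    refine ⟨(Units.mk0 c hc0)⁻¹, Units.ext ?_⟩
    change V.valuation (algebraMap k K ((Units.mk0 c hc0)⁻¹ : kˣ)) = V.valuation x
    rw [Units.val_inv_eq_inv_val, Units.val_mk0, map_inv₀, map_inv₀]
    rw [map_mul] at hc
    exact inv_eq_of_mul_eq_one_right hc

theorem valClass_eq_zero_of_valuation_eq_one (V : ValuationSubring K) (x : Kˣ)
    (hx : V.valuation (x : K) = 1) : valClass k V (Additive.ofMul x) = 0 :=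
  (valClass_eq_zero_iff V x).2 ⟨1, by simpa using hx⟩

theorem valClass_eq_of_valuation_eq (V : ValuationSubring K) (x y : Kˣ) {c e : k}
    (he : e ≠ 0) (h : V.valuation (algebraMap k K c * x) = V.valuation (algebraMap k K e * y)) :
    valClass k V (Additive.ofMul x) = valClass k V (Additive.ofMul y) := by
  rw [← sub_eq_zero, ← map_sub, ← ofMul_div, valClass_eq_zero_iff]
  refine ⟨c / e, ?_⟩
  have hne : V.valuation (algebraMap k K e * y) ≠ 0 := by simpa using he
  rw [← div_eq_one_iff_eq hne, ← map_div₀] at h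
  rw [← h, map_div₀, Units.val_div_eq_div_val, div_mul_div_comm]

theorem valIndep_iff (V : ValuationSubring K) {ι : Type*} [Fintype ι] (x : ι → Kˣ) :
    ValIndep k V (fun i => (x i : K)) ↔
      LinearIndependent ℤ (fun i => valClass k V (Additive.ofMul (x i))) := by
  rw [Fintype.linearIndependent_iff]
  have key : ∀ n : ι → ℤ, ∑ i, n i • valClass k V (Additive.ofMul (x i)) = 0 ↔
      ∃ c : k, V.valuation (algebraMap k K c * ∏ i, (x i : K) ^ n i) = 1 := by
    intro n
    have h1 : ∑ i, n i • valClass k V (Additive.ofMul (x i)) =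
        valClass k V (Additive.ofMul (∏ i, x i ^ n i)) := by
      rw [ofMul_prod, map_sum]
      simp only [ofMul_zpow, map_zsmul]
    rw [h1, valClass_eq_zero_iff]
    simp
  simp only [key, ValIndep]
  constructor
  · rintro ⟨-, h⟩ n ⟨c, hc⟩ i
    rw [h n c hc]
    rfl
  · exact fun h => ⟨fun i => (x i).ne_zero, fun n c hc => funext (h n ⟨c, hc⟩)⟩

/-- Since `kˣ` is divisible, `vK / vk` is torsion-free. -/
theorem isTorsionFree_relValueGroup [IsAlgClosed k] (V : ValuationSubring K) :
    Module.IsTorsionFree ℤ (RelValueGroup k V) := by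
  rw [Module.isTorsionFree_iff_smul_eq_zero]
  intro n m h
  by_contra! hne
  obtain ⟨hn, hm⟩ := hne
  obtain ⟨x, rfl⟩ := valClass_surjective V m
  have h' : (n.natAbs : ℤ) • valClass k V x = 0 := by
    rcases Int.natAbs_eq n with h1 | h1
    · rwa [← h1]
    · rw [h1, neg_smul, neg_eq_zero] at h
      exact h
  rw [← map_zsmul, ← ofMul_toMul x, ← ofMul_zpow, valClass_eq_zero_iff] at h'
  obtain ⟨c, hc⟩ := h'
  have hpos : 0 < n.natAbs := Int.natAbs_pos.2 hn
  obtain ⟨c', rfl⟩ := IsAlgClosed.exists_pow_nat_eq c hpos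
  refine hm ?_
  rw [← ofMul_toMul x, valClass_eq_zero_iff]
  refine ⟨c', ?_⟩
  rw [zpow_natCast, Units.val_pow_eq_pow_val, map_pow, ← mul_pow, map_pow,
    pow_eq_one_iff_of_nonneg zero_le hpos.ne'] at hc
  exact hc

/-- Elements whose values lie in distinct classes modulo `vk` and the values of the `x i` are
linearly independent over `k(x, t)`: the terms of a linear combination with polynomial coefficients
have distinct values. -/
theorem ValIndep.linearIndependent {V : ValuationSubring K} {ι κ α : Type*} [Fintype ι]
    {x : ι → Kˣ} {t : κ → K} (hx : ValIndep k V (fun i => (x i : K))) (ht : ResIndep k V t)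
    (y : α → Kˣ) (hy : Function.Injective fun a =>
      (Submodule.span ℤ (Set.range fun i => valClass k V (Additive.ofMul (x i)))).mkQ
        (valClass k V (Additive.ofMul (y a)))) :
    LinearIndependent (Algebra.adjoin k (Set.range (Sum.elim (fun i => (x i : K)) t)))
      (fun a => (y a : K)) := by
  classical
  rw [linearIndependent_iff']
  intro s g hg
  by_contra! hne
  have hP : ∀ a, ∃ P : MvPolynomial (ι ⊕ κ) k,
      MvPolynomial.aeval (Sum.elim (fun i => (x i : K)) t) P = (g a : K) := by
    intro a
    exact (Algebra.adjoin_range_eq_range_aeval k _).le (g a).2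
  choose P hP using hP
  obtain ⟨a₀, ha₀, hga₀⟩ := hne
  set s' := s.filter fun a => g a ≠ 0 with hs'
  have hsum : ∑ a ∈ s', (g a : K) * y a = 0 := by
    rw [← hg, hs', Finset.sum_filter]
    refine Finset.sum_congr rfl fun a _ => ?_
    split_ifs with h
    · rfl
    · rw [not_not.1 h, zero_smul]
  have hP0 : ∀ a ∈ s', P a ≠ 0 := by
    intro a ha h0
    have := hP a
    rw [h0, map_zero] at this
    exact (Finset.mem_filter.1 ha).2 (Subtype.ext this.symm)
  have key : ∀ a ∈ s', ∃ c : k, c ≠ 0 ∧ ∃ m : ι → ℕ,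
      V.valuation (g a : K) = V.valuation (algebraMap k K c * ∏ i, (x i : K) ^ m i) := by
    intro a ha
    obtain ⟨m, hm0, hm, -⟩ := hx.exists_valuation_eq ht (hP0 a ha)
    exact ⟨(P a).coeff m, hm0, fun i => m (Sum.inl i), by rw [← hP a, hm]⟩
  choose! c hc0 m hm using key
  obtain ⟨a, ha, hval, -⟩ := exists_valuation_sum_eq V (s := s')
    ⟨a₀, Finset.mem_filter.2 ⟨ha₀, hga₀⟩⟩ (fun a => (g a : K) * y a) (by
      intro a ha b hb hab
      apply hy
      simp only [Submodule.mkQ_apply]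
      rw [Submodule.Quotient.eq]
      have hz : valClass k V (Additive.ofMul (y a)) - valClass k V (Additive.ofMul (y b)) =
          ∑ i, ((m b i : ℤ) - m a i) • valClass k V (Additive.ofMul (x i)) := by
        have h1 := valClass_eq_of_valuation_eq V ((∏ i, x i ^ m a i) * y a)
          ((∏ i, x i ^ m b i) * y b) (hc0 b hb) (by
            push_cast
            rw [← mul_assoc, ← mul_assoc, map_mul, ← hm a ha, map_mul _ _ (y b : K), ← hm b hb,
              ← map_mul, ← map_mul]
            exact hab)
        simp only [ofMul_mul, ofMul_prod, ofMul_pow, map_add, map_sum, map_nsmul] at h1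
        simp only [sub_smul, Finset.sum_sub_distrib, natCast_zsmul]
        rw [sub_eq_sub_iff_add_eq_add, add_comm, h1, add_comm]
      rw [hz]
      exact Submodule.sum_mem _ fun i _ => Submodule.smul_mem _ _ (Submodule.subset_span ⟨i, rfl⟩))
  rw [hsum, map_zero, eq_comm, map_eq_zero] at hval
  exact mul_ne_zero (fun h => (Finset.mem_filter.1 ha).2 (Subtype.ext h)) (y a).ne_zero hval

theorem finite_quotient_of_forall_card_le {M : Type*} (n : ℕ)
    (h : ∀ q : Fin (n + 1) → M, ¬ Function.Injective q) : Finite M := by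
  by_contra hinf
  rw [not_finite_iff_infinite] at hinf
  exact h (fun i => Infinite.natEmbedding M i)
    ((Infinite.natEmbedding M).injective.comp Fin.val_injective)

theorem finiteDimensional_adjoin_of_isTranscendenceBasis (hK : (⊤ : IntermediateField k K).FG)
    {ι : Type*} {x : ι → K} (hx : IsTranscendenceBasis k x) :
    FiniteDimensional (IntermediateField.adjoin k (Set.range x)) K := by
  have := hx.isAlgebraic_field
  obtain ⟨s, hs⟩ := hK
  have hfin := IntermediateField.finiteDimensional_adjoin
    (K := IntermediateField.adjoin k (Set.range x)) (S := (s : Set K)) fun y _ =>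
      Algebra.IsIntegral.isIntegral y
  have htop : IntermediateField.adjoin (IntermediateField.adjoin k (Set.range x)) (s : Set K) =
      ⊤ := by
    rw [eq_top_iff]
    intro y _
    have hy : y ∈ IntermediateField.adjoin k (s : Set K) := hs ▸ IntermediateField.mem_top
    have hle : IntermediateField.adjoin k (s : Set K) ≤ (IntermediateField.adjoin
        (IntermediateField.adjoin k (Set.range x)) (s : Set K)).restrictScalars k :=
      IntermediateField.adjoin_le_iff.2 (IntermediateField.subset_adjoin _ _)
    exact hle hy
  rw [htop] at hfin
  exact Module.Finite.equiv IntermediateField.topEquiv.toLinearEquiv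

open scoped IntermediateField.algebraAdjoinAdjoin in
/-- Equality in Abhyankar's inequality makes `vK / vk` finitely generated: the values of the `x i`
generate a subgroup whose index is at most the degree of `K` over `k(x, t)`. -/
theorem finite_relValueGroup (hK : (⊤ : IntermediateField k K).FG) {d : ℕ}
    (hd : Algebra.trdeg k K = d) {V : ValuationSubring K} {ι κ : Type} [Fintype ι] [Fintype κ]
    {x : ι → K} {t : κ → K} (hx : ValIndep k V x) (ht : ResIndep k V t)
    (hcard : Fintype.card ι + Fintype.card κ = d) : Module.Finite ℤ (RelValueGroup k V) := by
  have hbasis : IsTranscendenceBasis k (Sum.elim x t) := by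
    refine (hx.algebraicIndependent ht).isTranscendenceBasis_of_lift_trdeg_le_of_finite ?_
    rw [hd, Cardinal.mk_fintype, Fintype.card_sum, hcard]
    simp
  have hfin := finiteDimensional_adjoin_of_isTranscendenceBasis hK hbasis
  lift x to ι → Kˣ using fun i => (hx.1 i).isUnit
  set N := Submodule.span ℤ (Set.range fun i => valClass k V (Additive.ofMul (x i)))
  have : Finite (RelValueGroup k V ⧸ N) := by
    refine finite_quotient_of_forall_card_le (Module.finrank
      (IntermediateField.adjoin k (Set.range (Sum.elim (fun i => (x i : K)) t))) K) fun q hq => ?_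
    choose z hz using fun i => N.mkQ_surjective (q i)
    choose y hy using fun i => valClass_surjective V (z i)
    have h1 := hx.linearIndependent ht (fun i => (y i).toMul) (by
      have h : (fun i => N.mkQ (valClass k V (Additive.ofMul (y i).toMul))) = q :=
        funext fun i => by rw [ofMul_toMul, hy, hz]
      rw [← h] at hq
      exact hq)
    rw [LinearIndependent.iff_fractionRing _
      (IntermediateField.adjoin k (Set.range (Sum.elim (fun i => (x i : K)) t)))] at h1
    have h2 := h1.fintype_card_le_finrank
    rw [Fintype.card_fin] at h2
    exact Nat.not_succ_le_self _ h2
  have : Module.Finite ℤ N := Module.Finite.span_of_finite ℤ (Set.finite_range _)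
  exact Module.Finite.of_submodule_quotient N

end

/-! ### The dimension of `𝓘_V` -/

section

section LinearAlgebra

variable {F W : Type*} [Field F] [AddCommGroup W] [Module F W]

theorem finiteDimensional_and_finrank_le (D : Submodule F W) (n : ℕ)
    (h : ∀ (m : ℕ) (f : Fin m → W), (∀ i, f i ∈ D) → LinearIndependent F f → m ≤ n) :
    FiniteDimensional F D ∧ Module.finrank F D ≤ n := by
  have hrank : Module.rank F D ≤ n := rank_le fun s hs => by
    refine h s.card (fun i => (s.equivFin.symm i : D)) (fun i => SetLike.coe_mem _) ?_
    exact (hs.comp _ s.equivFin.symm.injective).map' D.subtype D.ker_subtype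
  exact ⟨Module.rank_lt_aleph0_iff.1 (hrank.trans_lt (Cardinal.natCast_lt_aleph0)),
    Module.finrank_le_of_rank_le hrank⟩

theorem card_le_finrank_of_linearIndependent {D : Submodule F W} (hD : FiniteDimensional F D)
    {n : ℕ} {f : Fin n → W} (hfD : ∀ i, f i ∈ D) (hf : LinearIndependent F f) :
    n ≤ Module.finrank F D := by
  have h : LinearIndependent F (fun i => (⟨f i, hfD i⟩ : D)) :=
    LinearIndependent.of_comp D.subtype hf
  simpa using h.fintype_card_le_finrank

end LinearAlgebra

variable {k : Type*} [Field k] {K : Type*} [Field K] [Algebra k K]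
  {Λ : Type*} [CommRing Λ]

/-- The element of `𝓘_V` given by a homomorphism on `vK / vk`. -/
noncomputable def ofRelValueGroup {V : ValuationSubring K} (φ : RelValueGroup k V →+ Λ) : G K Λ :=
  (1 : FractionRing Λ) ⊗ₜ (φ.comp (valClass k V))

theorem ev_ofRelValueGroup {V : ValuationSubring K} (φ : RelValueGroup k V →+ Λ) (x : Kˣ) :
    ev (ofRelValueGroup φ) (x : K) =
      algebraMap Λ (FractionRing Λ) (φ (valClass k V (Additive.ofMul x))) := by
  rw [ev_units, ofRelValueGroup, evalAt_tmul, mul_one]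
  rfl

theorem ofRelValueGroup_mem_inertia {V : ValuationSubring K} (φ : RelValueGroup k V →+ Λ) :
    ofRelValueGroup φ ∈ inertia Λ V := by
  rw [mem_inertia_iff]
  intro x hx
  have hx0 : x ≠ 0 := by
    rintro rfl
    simp at hx
  have := ev_ofRelValueGroup φ (Units.mk0 x hx0)
  rwa [valClass_eq_zero_of_valuation_eq_one V _ hx, map_zero, map_zero] at this

variable [IsDomain Λ]

theorem eq_zero_of_mem_inertia_top {f : G K Λ} (hf : f ∈ inertia Λ (⊤ : ValuationSubring K)) :
    f = 0 := by
  refine ev_injective fun x hx => mem_inertia_iff.1 hf x ?_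
  refine le_antisymm ((ValuationSubring.valuation_le_one_iff _ _).2 trivial) ?_
  rw [← inv_le_one₀ (by simpa [zero_lt_iff] using hx), ← map_inv₀]
  exact (ValuationSubring.valuation_le_one_iff _ _).2 trivial

/-- Abhyankar's inequality, for the dimension of `𝓘_V` in place of the rank of `vK / vk`. -/
theorem finiteDimensional_inertia {ℓ : ℕ} (hΛ : IsAdic ℓ Λ) [IsAlgClosed k] {d : ℕ}
    (hd : Algebra.trdeg k K = d) {V : ValuationSubring K} {κ : Type} [Fintype κ] {t : κ → K}
    (ht : ResIndep k V t) : FiniteDimensional (FractionRing Λ) (inertia Λ V) ∧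
      Module.finrank (FractionRing Λ) (inertia Λ V) + Fintype.card κ ≤ d := by
  have hκ := (valIndep_of_isEmpty (k := k) V (Empty.elim)).card_add_card_le ht hd
  rw [Fintype.card_empty, zero_add] at hκ
  have h := finiteDimensional_and_finrank_le (inertia Λ V) (d - Fintype.card κ)
    fun m f hfV hf => by
      obtain ⟨x, -, hx⟩ := exists_valIndep (k := k) hΛ (v := ⊤) hfV fun c hc =>
        funext (Fintype.linearIndependent_iff.1 hf c (eq_zero_of_mem_inertia_top hc))
      have := hx.card_add_card_le ht hd
      rw [Fintype.card_fin] at this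
      exact Nat.le_sub_of_add_le this
  exact ⟨h.1, Nat.add_le_of_le_sub hκ h.2⟩

theorem le_finrank_inertia {V : ValuationSubring K} [IsAlgClosed k]
    (hfin : FiniteDimensional (FractionRing Λ) (inertia Λ V))
    (hM : Module.Finite ℤ (RelValueGroup k V)) {n : ℕ} {x : Fin n → K} (hx : ValIndep k V x) :
    n ≤ Module.finrank (FractionRing Λ) (inertia Λ V) := by
  have := isTorsionFree_relValueGroup (k := k) V
  lift x to Fin n → Kˣ using fun i => (hx.1 i).isUnit
  have hn := ((valIndep_iff V x).1 hx).fintype_card_le_finrank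
  rw [Fintype.card_fin] at hn
  refine hn.trans ?_
  set b := Module.finBasis ℤ (RelValueGroup k V)
  choose y hy using fun i => valClass_surjective V (b i)
  refine card_le_finrank_of_linearIndependent hfin
    (f := fun i => ofRelValueGroup ((Int.castAddHom Λ).comp (b.coord i).toAddMonoidHom))
    (fun i => ofRelValueGroup_mem_inertia _) ?_
  rw [Fintype.linearIndependent_iff]
  intro c hc j
  have h := congrArg (fun f => ev f ((y j).toMul : K)) hc
  simp only [ev_sum, ev_zero, ev_ofRelValueGroup, ofMul_toMul, hy] at h
  simpa [Finsupp.single_apply] using h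

theorem exists_valIndep_unit {ℓ : ℕ} (hΛ : IsAdic ℓ Λ) [IsAlgClosed k] {V : ValuationSubring K}
    {h : G K Λ} (hh : h ∈ inertia Λ V) (h0 : h ≠ 0) :
    ∃ x : Fin 1 → K, ValIndep k V x := by
  obtain ⟨x, -, hx⟩ := exists_valIndep (k := k) hΛ (v := ⊤) (f := fun _ : Fin 1 => h)
    (fun _ => hh) fun c hc => by
      have := eq_zero_of_mem_inertia_top hc
      ext i
      rw [Subsingleton.elim i 0]
      simpa [h0] using this
  exact ⟨x, hx⟩

/-! ### The valuations satisfying the two conditions -/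

theorem isQDCandidate_of_resIndep {ℓ : ℕ} (hΛ : IsAdic ℓ Λ) [IsAlgClosed k]
    (hK : (⊤ : IntermediateField k K).FG) {d : ℕ} (hd : Algebra.trdeg k K = d) (hd0 : 0 < d)
    {V : ValuationSubring K} {t : Fin (d - 1) → K} (ht : ResIndep k V t) {h : G K Λ}
    (hh : h ∈ inertia Λ V) (h0 : h ≠ 0) : IsQDCandidate k V := by
  obtain ⟨x, hx⟩ := exists_valIndep_unit (k := k) hΛ hh h0
  have hM := finite_relValueGroup hK hd hx ht (by simp; omega)
  have := isTorsionFree_relValueGroup (k := k) V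
  constructor
  · have hrank : Module.finrank ℤ (RelValueGroup k V) = 1 := by
      apply le_antisymm
      · set b := Module.finBasis ℤ (RelValueGroup k V)
        choose y hy using fun i => valClass_surjective V (b i)
        have hb : ValIndep k V (fun i => ((y i).toMul : K)) := by
          rw [valIndep_iff]
          simp only [ofMul_toMul, hy]
          exact b.linearIndependent
        have := hb.card_add_card_le ht hd
        rw [Fintype.card_fin, Fintype.card_fin] at this
        omega
      · lift x to Fin 1 → Kˣ using fun i => (hx.1 i).isUnit
        simpa using ((valIndep_iff V x).1 hx).fintype_card_le_finrank
    let e : RelValueGroup k V ≃ₗ[ℤ] ℤ :=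
      LinearEquiv.ofFinrankEq _ _ (by rw [hrank, Module.finrank_self])
    exact ⟨AddEquiv.toMultiplicativeRight e.toAddEquiv⟩
  · have h1 := ht.le_residueTrdeg
    have h2 : residueTrdeg k V < d := by
      by_contra! hle
      obtain ⟨s, hs⟩ := exists_resIndep_of_le_residueTrdeg hle
      have := hx.card_add_card_le hs hd
      simp at this
    obtain ⟨m, hm⟩ := Cardinal.lt_aleph0.1 (h2.trans Cardinal.natCast_lt_aleph0)
    rw [hm] at h1 h2 ⊢
    rw [hd]
    norm_cast at h1 h2 ⊢
    omega

theorem IsQDCandidate.exists_resIndep {d : ℕ} (hd : Algebra.trdeg k K = d)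
    {V : ValuationSubring K} (hV : IsQDCandidate k V) : ∃ t : Fin (d - 1) → K, ResIndep k V t := by
  refine exists_resIndep_of_le_residueTrdeg ?_
  have h := hV.trdeg_eq
  rw [hd] at h
  obtain ⟨m, hm⟩ := Cardinal.lt_aleph0.1
    (lt_of_le_of_lt (le_self_add.trans h.ge) Cardinal.natCast_lt_aleph0)
  rw [hm] at h ⊢
  norm_cast at h ⊢
  omega

theorem IsQDCandidate.exists_valIndep [IsAlgClosed k] {V : ValuationSubring K}
    (hV : IsQDCandidate k V) : ∃ x : Fin 1 → K, ValIndep k V x := by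
  obtain ⟨e⟩ := hV.valueGroup_iso
  have := isTorsionFree_relValueGroup (k := k) V
  obtain ⟨x, hx⟩ := valClass_surjective V (Additive.ofMul (e.symm (Multiplicative.ofAdd 1)))
  refine ⟨fun _ => (x.toMul : K), (valIndep_iff V fun _ => x.toMul).2 ?_⟩
  simp only [ofMul_toMul, hx]
  rw [linearIndependent_unique_iff]
  intro h
  have h' : e.symm (Multiplicative.ofAdd 1) = 1 := h
  rw [map_eq_one_iff e.symm e.symm.injective] at h'
  exact one_ne_zero (ofAdd_eq_one.1 h')

end

/-! ### Refining a valuation along its residue field -/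

section

variable {k : Type*} [Field k] {K : Type*} [Field K] [Algebra k K]

/-- The composite of a valuation of `K` with a valuation of its residue field. -/
def composite (v : ValuationSubring K) (W : ValuationSubring (IsLocalRing.ResidueField v)) :
    ValuationSubring K where
  toSubring := (W.toSubring.comap (IsLocalRing.residue v)).map v.subtype
  mem_or_inv_mem' := by
    intro y
    have key : ∀ z : K, z ∉ v →
        z⁻¹ ∈ (W.toSubring.comap (IsLocalRing.residue v)).map v.subtype := by
      intro z hz
      have h1 := valuation_inv_lt_one hz
      refine ⟨⟨z⁻¹, mem_of_valuation_lt_one h1⟩, ?_, rfl⟩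
      change IsLocalRing.residue v _ ∈ W
      rw [(valuation_lt_one_iff_residue (V := v) ⟨z⁻¹, mem_of_valuation_lt_one h1⟩).1 h1]
      exact W.zero_mem
    by_cases hy : y ∈ v
    · by_cases hy' : y⁻¹ ∈ v
      · by_cases hy0 : y = 0
        · left
          rw [hy0]
          exact Subring.zero_mem _
        · have hmul : IsLocalRing.residue v ⟨y, hy⟩ * IsLocalRing.residue v ⟨y⁻¹, hy'⟩ = 1 := by
            rw [← map_mul, ← map_one (IsLocalRing.residue v)]
            congr 1
            exact Subtype.ext (mul_inv_cancel₀ hy0)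
          rcases W.mem_or_inv_mem (IsLocalRing.residue v ⟨y, hy⟩) with h | h
          · exact Or.inl ⟨⟨y, hy⟩, h, rfl⟩
          · rw [inv_eq_of_mul_eq_one_right hmul] at h
            exact Or.inr ⟨⟨y⁻¹, hy'⟩, h, rfl⟩
      · left
        rw [← inv_inv y]
        exact key _ hy'
    · exact Or.inr (key y hy)

theorem mem_composite {v : ValuationSubring K} {W : ValuationSubring (IsLocalRing.ResidueField v)}
    (y : v) : (y : K) ∈ composite v W ↔ IsLocalRing.residue v y ∈ W := by
  constructor
  · rintro ⟨z, hz, h⟩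
    rwa [← Subtype.ext h]
  · exact fun h => ⟨y, h, rfl⟩

theorem composite_le (v : ValuationSubring K) (W : ValuationSubring (IsLocalRing.ResidueField v)) :
    composite v W ≤ v := by
  rintro _ ⟨z, -, rfl⟩
  exact z.2

theorem valuation_composite_eq_one {v : ValuationSubring K}
    {W : ValuationSubring (IsLocalRing.ResidueField v)} {E : Type*} [Field E]
    (φ : E →+* IsLocalRing.ResidueField v) (hφ : ∀ a, φ a ∈ W) {y : v}
    (hy : IsLocalRing.residue v y ∈ φ.range) (hy1 : v.valuation (y : K) = 1) :
    (composite v W).valuation (y : K) = 1 := by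
  obtain ⟨a, ha⟩ := hy
  have hy0 : (y : K) ≠ 0 := by
    intro h
    simp [h] at hy1
  have hinv : (y : K)⁻¹ ∈ v := mem_of_valuation_eq_one (by rw [map_inv₀, hy1, inv_one])
  have hmul : IsLocalRing.residue v y * IsLocalRing.residue v ⟨(y : K)⁻¹, hinv⟩ = 1 := by
    rw [← map_mul, ← map_one (IsLocalRing.residue v)]
    congr 1
    exact Subtype.ext (mul_inv_cancel₀ hy0)
  have h1 : (y : K) ∈ composite v W := (mem_composite y).2 (ha ▸ hφ a)
  have h2 : (y : K)⁻¹ ∈ composite v W := by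
    refine (mem_composite ⟨(y : K)⁻¹, hinv⟩).2 ?_
    rw [← inv_eq_of_mul_eq_one_right hmul, ← ha, ← map_inv₀]
    exact hφ _
  rw [← ValuationSubring.valuation_le_one_iff] at h1 h2
  rw [map_inv₀, inv_le_one₀ (by rw [zero_lt_iff]; simpa using hy0)] at h2
  exact le_antisymm h1 h2

/-- A transcendental element is a non-unit for a valuation that is trivial on the base field. -/
theorem exists_valuationSubring_of_transcendental {E R : Type*} [Field E] [Field R] [Algebra E R]
    {r : R} (hr : Transcendental E r) :
    ∃ W : ValuationSubring R, (∀ a : E, algebraMap E R a ∈ W) ∧ r⁻¹ ∉ W := by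
  have hnot : r⁻¹ ∉ (integralClosure E R).toSubring := by
    intro h
    have h' : IsIntegral E r⁻¹ := h
    exact hr (by simpa using h'.isAlgebraic.inv)
  have : IsIntegrallyClosedIn (integralClosure E R).toSubring R :=
    inferInstanceAs (IsIntegrallyClosedIn (integralClosure E R) R)
  obtain ⟨W, hW, hrW⟩ := Subring.exists_le_valuationSubring_of_isIntegrallyClosedIn hnot
  exact ⟨W, fun a => hW (isIntegral_algebraMap (R := E) (A := R) (x := a)), hrW⟩

/-- If `t` has independent residues at `v`, then `v` has a refinement, with the same restriction to
`k`, at which `t 0` is congruent to the integer `e` and the other `t i` still have independent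
residues. -/
theorem ResIndep.exists_refinement {v : ValuationSubring K} {m : ℕ} {t : Fin (m + 1) → K}
    (ht : ResIndep k v t) (e : ℕ) :
    v.valuation (t 0 - e) = 1 ∧ ∃ V ≤ v, V.valuation (t 0 - e) < 1 ∧
      ResIndep k V (fun i => t (Fin.succ i)) ∧
      ∀ c : k, v.valuation (algebraMap k K c) = 1 → V.valuation (algebraMap k K c) = 1 := by
  have hv : ∀ i, t i ∈ v := fun i => mem_of_valuation_eq_one (ht.valuation_eq_one i)
  let _ := (residueMap k v).toAlgebra
  set r : Fin (m + 1) → IsLocalRing.ResidueField v := fun i =>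
    IsLocalRing.residue v ⟨t i, hv i⟩ with hr
  have hind : AlgebraicIndependent (BaseResidueField k v) r :=
    (resIndep_iff (k := k) (V := v) (fun i => ⟨t i, hv i⟩)).1 ht
  set E := IntermediateField.adjoin (BaseResidueField k v) (r '' {0}ᶜ)
  have htr : Transcendental E (r 0) :=
    IntermediateField.transcendental_adjoin_iff.2 (hind.transcendental_adjoin (by simp))
  have htr' : Transcendental E (r 0 - e) := by
    intro h
    exact htr (by simpa using h.add (isAlgebraic_natCast e))
  obtain ⟨W, hEW, hrW⟩ := exists_valuationSubring_of_transcendental htr'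
  have he : t 0 - e ∈ v := v.toSubring.sub_mem (hv 0) (natCast_mem v.toSubring e)
  have hres : IsLocalRing.residue v ⟨t 0 - e, he⟩ = r 0 - e := by
    have h : (⟨t 0 - e, he⟩ : v) = ⟨t 0, hv 0⟩ - (e : v) := rfl
    rw [h, map_sub, map_natCast]
  have he1 : v.valuation (t 0 - e) = 1 := by
    refine le_antisymm ((ValuationSubring.valuation_le_one_iff _ _).2 he) (not_lt.1 fun h => ?_)
    rw [valuation_lt_one_iff_residue (V := v) ⟨t 0 - e, he⟩, hres] at h
    rw [h] at htr'
    exact htr' isAlgebraic_zero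
  have hE1 : ∀ y : v, IsLocalRing.residue v y ∈ E → v.valuation (y : K) = 1 →
      (composite v W).valuation (y : K) = 1 := fun y hy hy1 =>
    valuation_composite_eq_one (algebraMap E _) hEW ⟨⟨_, hy⟩, rfl⟩ hy1
  refine ⟨he1, composite v W, composite_le v W, ?_, ?_, ?_⟩
  · rw [← inv_inv (t 0 - (e : K))]
    refine valuation_inv_lt_one fun h => hrW ?_
    have hinv : (t 0 - (e : K))⁻¹ ∈ v := composite_le v W h
    have hmul : (r 0 - e) * IsLocalRing.residue v ⟨(t 0 - (e : K))⁻¹, hinv⟩ = 1 := by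
      rw [← hres, ← map_mul, ← map_one (IsLocalRing.residue v)]
      congr 1
      refine Subtype.ext (mul_inv_cancel₀ fun h0 => ?_)
      change t 0 - (e : K) = 0 at h0
      rw [h0, map_zero] at he1
      exact zero_ne_one he1
    rw [inv_eq_of_mul_eq_one_right hmul]
    exact (mem_composite ⟨(t 0 - (e : K))⁻¹, hinv⟩).1 h
  · intro P hP hP1
    have hPv : ∀ m, v.valuation (algebraMap k K (P.coeff m)) ≤ 1 := fun m =>
      (v.valuation_le_one_iff _).2 (composite_le v W
        (((composite v W).valuation_le_one_iff _).1 (hP m)))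
    have h1 := ht.comp _ (Fin.succ_injective m) P hPv
      (hP1.imp fun m => valuation_eq_one_of_le (composite_le v W))
    obtain ⟨Q, rfl⟩ := exists_map_subtype_eq hPv
    have h2 := aeval_map_subtype (k := k) (V := v) (fun i => ⟨t (Fin.succ i), hv _⟩) Q
    rw [h2]
    refine hE1 _ ?_ (h2 ▸ h1)
    rw [eval₂_residueMap]
    refine (Algebra.adjoin_le (S := E.toSubalgebra) ?_ :
      Algebra.adjoin (BaseResidueField k v) (Set.range fun i => r (Fin.succ i)) ≤ _) ?_
    · rintro _ ⟨i, rfl⟩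
      exact IntermediateField.subset_adjoin _ _ ⟨Fin.succ i, Fin.succ_ne_zero i, rfl⟩
    · rw [Algebra.adjoin_range_eq_range_aeval]
      exact ⟨_, rfl⟩
  · intro c hc
    have hcv : algebraMap k K c ∈ v := mem_of_valuation_eq_one hc
    refine hE1 ⟨algebraMap k K c, hcv⟩ ?_ hc
    exact E.algebraMap_mem (IsLocalRing.residue _ (⟨c, hcv⟩ : v.comap (algebraMap k K)))

/-- The new element has independent value because it is a unit for `v`. -/
theorem ValIndep.cons {v V : ValuationSubring K} (hVv : V ≤ v)
    (hk : ∀ c : k, v.valuation (algebraMap k K c) = 1 → V.valuation (algebraMap k K c) = 1)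
    {n : ℕ} {x : Fin n → K} (hx : ValIndep k v x) {y : K} (hyv : v.valuation y = 1)
    (hyV : V.valuation y < 1) : ValIndep k V (Fin.cons y x : Fin (n + 1) → K) := by
  have hy0 : y ≠ 0 := by
    rintro rfl
    simp at hyv
  refine ⟨fun i => ?_, fun a c h => ?_⟩
  · refine Fin.cases hy0 (fun j => ?_) i
    exact hx.1 j
  · have h1 := valuation_eq_one_of_le hVv h
    simp only [Fin.prod_univ_succ, Fin.cons_zero, Fin.cons_succ] at h h1
    have h2 := hx.2 (fun i => a (Fin.succ i)) c (by
      rw [map_mul, map_mul, map_zpow₀, hyv, one_zpow, one_mul] at h1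
      rw [map_mul, h1])
    have h3 : ∀ i, a (Fin.succ i) = 0 := fun i => congrFun h2 i
    simp only [h3, zpow_zero, Finset.prod_const_one, mul_one] at h h1
    rw [map_mul, map_zpow₀, hyv, one_zpow, mul_one] at h1
    rw [map_mul, hk c h1, one_mul, map_zpow₀] at h
    have h4 : a 0 = 0 := by
      by_contra hne
      rw [zpow_eq_one_iff_right₀ zero_le hyV.ne] at h
      exact hne h
    ext i
    exact Fin.cases h4 h3 i

/-- Repeated refinement turns independent residues into independent values. -/
theorem ValIndep.exists_refinement {m n : ℕ} {v : ValuationSubring K} {x : Fin n → K}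
    (hx : ValIndep k v x) {t : Fin m → K} (ht : ResIndep k v t) :
    ∃ V ≤ v, ∃ y : Fin (n + m) → K, ValIndep k V y := by
  induction m generalizing n v with
  | zero => exact ⟨v, le_rfl, x, hx⟩
  | succ m ih =>
    obtain ⟨h1, V, hV, h2, h3, h4⟩ := ht.exists_refinement 0
    obtain ⟨V', hV', y, hy⟩ := ih (hx.cons hV h4 h1 h2) h3
    refine ⟨V', hV'.trans hV, ?_⟩
    rw [← show n + 1 + m = n + (m + 1) by ring]
    exact ⟨y, hy⟩

end

/-! ### From alternating subspaces to valuations -/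

section

section LinearAlgebra

variable {F W : Type*} [Field F] [AddCommGroup W] [Module F W]

theorem exists_linearIndependent_mod (D N : Submodule F W) (hD : FiniteDimensional F D) :
    ∃ (s : ℕ) (f : Fin s → W), (∀ i, f i ∈ D) ∧ (∀ c : Fin s → F, ∑ i, c i • f i ∈ N → c = 0) ∧
      Module.finrank F D = Module.finrank F ↥(D ⊓ N) + s := by
  obtain ⟨Q, hQ⟩ := Submodule.exists_isCompl (N.comap D.subtype)
  have h1 : Module.finrank F (N.comap D.subtype) = Module.finrank F ↥(D ⊓ N) := by
    rw [← Submodule.map_comap_subtype]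
    exact (Submodule.equivMapOfInjective D.subtype D.injective_subtype _).finrank_eq
  refine ⟨Module.finrank F Q, fun i => (Module.finBasis F Q i : D), fun i => SetLike.coe_mem _,
    fun c hc => ?_, ?_⟩
  · have hmem : ∑ i, c i • Module.finBasis F Q i = 0 := by
      rw [← Submodule.coe_eq_zero]
      refine (Submodule.mem_bot F).1 (hQ.disjoint.le_bot ⟨?_, SetLike.coe_mem _⟩)
      change D.subtype _ ∈ N
      convert hc
      simp
    exact funext (Fintype.linearIndependent_iff.1 (Module.finBasis F Q).linearIndependent c hmem)
  · rw [← h1]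
    exact (Submodule.finrank_add_eq_of_isCompl hQ).symm

theorem finrank_add_finrank_le_of_le {A B C : Submodule F W} (hC : FiniteDimensional F C)
    (hA : A ≤ C) (hB : B ≤ C) (hAB : A ⊓ B = ⊥) :
    Module.finrank F A + Module.finrank F B ≤ Module.finrank F C := by
  have : FiniteDimensional F A := Submodule.finiteDimensional_of_le hA
  have : FiniteDimensional F B := Submodule.finiteDimensional_of_le hB
  rw [← Submodule.finrank_sup_add_finrank_inf_eq, hAB, finrank_bot, add_zero]
  exact Submodule.finrank_mono (sup_le hA hB)

theorem eq_bot_of_finrank_eq_one {I A : Submodule F W} (hI : Module.finrank F I = 1) (hA : A ≤ I)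
    {h : W} (hhI : h ∈ I) (hh : h ∉ A) : A = ⊥ := by
  have : FiniteDimensional F I := FiniteDimensional.of_finrank_pos (by rw [hI]; exact one_pos)
  have hlt : A < I := lt_of_le_of_ne hA (by rintro rfl; exact hh hhI)
  have := Submodule.finrank_lt_finrank_of_lt hlt
  have h0 : FiniteDimensional F A := Submodule.finiteDimensional_of_le hA
  exact Submodule.finrank_eq_zero.1 (by omega)

theorem eq_of_le_of_finrank_eq_one {I A : Submodule F W} (hI : Module.finrank F I = 1)
    (hA : A ≤ I) {g : W} (hgA : g ∈ A) (hg : g ≠ 0) : A = I := by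
  refine le_antisymm hA fun h hhI => ?_
  by_contra hh
  rw [eq_bot_of_finrank_eq_one hI hA hhI hh] at hgA
  exact hg ((Submodule.mem_bot F).1 hgA)

theorem exists_ne_zero_of_finrank_eq_one {I : Submodule F W} (hI : Module.finrank F I = 1) :
    ∃ h ∈ I, h ≠ 0 := by
  refine I.ne_bot_iff.1 ?_
  rintro rfl
  rw [finrank_bot] at hI
  exact zero_ne_one hI

end LinearAlgebra

variable {k : Type*} [Field k] {K : Type*} [Field K] [Algebra k K]
  {Λ : Type*} [CommRing Λ] [IsDomain Λ]

theorem IsQDCandidate.exists_mem_inertia {v : ValuationSubring K} (hv : IsQDCandidate k v) :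
    ∃ h ∈ inertia Λ v, h ≠ 0 := by
  obtain ⟨e⟩ := hv.valueGroup_iso
  let e' : RelValueGroup k v ≃+ ℤ := MulEquiv.toAdditiveLeft e
  refine ⟨ofRelValueGroup ((Int.castAddHom Λ).comp e'.toAddMonoidHom),
    ofRelValueGroup_mem_inertia _, fun h0 => ?_⟩
  obtain ⟨x, hx⟩ := valClass_surjective v (e'.symm 1)
  have h1 := ev_ofRelValueGroup ((Int.castAddHom Λ).comp e'.toAddMonoidHom) x.toMul
  rw [h0, ev_zero, ofMul_toMul, hx] at h1
  simp at h1

variable [IsAlgClosed k]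

/-- A subspace of `𝓓_V` of dimension one more than its intersection with `𝓘_V` gives, for every `v`
coarser than `V`, elements with independent residues at `v`: their number is the codimension of the
intersection with `𝓘_v`. -/
theorem exists_resIndep_of_le_decomposition {ℓ : ℕ} (hΛ : IsAdic ℓ Λ)
    {D : Submodule (FractionRing Λ) (G K Λ)}
    (hDfin : FiniteDimensional (FractionRing Λ) D) {V v : ValuationSubring K} (hVv : V ≤ v)
    (hD : D ≤ decomposition Λ V) (hrank : Module.finrank (FractionRing Λ) D ≤
      Module.finrank (FractionRing Λ) ↥(D ⊓ inertia Λ V) + 1) :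
    ∃ (κ : Type) (_ : Fintype κ) (t : κ → K), ResIndep k v t ∧
      Module.finrank (FractionRing Λ) D ≤
        Module.finrank (FractionRing Λ) ↥(D ⊓ inertia Λ v) + Fintype.card κ := by
  obtain ⟨s, f, hfD, hf, hs⟩ := exists_linearIndependent_mod (D ⊓ inertia Λ V) (inertia Λ v)
    (Submodule.finiteDimensional_of_le inf_le_left)
  obtain ⟨x, hxv, hx⟩ := exists_valIndep (k := k) hΛ (fun i => (hfD i).2) hf
  rw [inf_assoc, inf_eq_right.2 (inertia_anti hVv)] at hs
  by_cases hle : D ≤ inertia Λ V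
  · rw [inf_eq_left.2 hle] at hs
    refine ⟨Fin s ⊕ Empty, inferInstance, _,
      hx.resIndep_sumElim hVv (resIndep_of_isEmpty V Empty.elim) hxv, ?_⟩
    rw [hs]
    simp
  · obtain ⟨g, hgD, hg⟩ := SetLike.not_le_iff_exists.1 hle
    rw [mem_inertia_iff] at hg
    push Not at hg
    obtain ⟨u, hu, hgu⟩ := hg
    refine ⟨Fin s ⊕ Unit, inferInstance, _, hx.resIndep_sumElim hVv
      (resIndep_of_ev_ne_zero hΛ (hD hgD) hu hgu) hxv, ?_⟩
    rw [hs] at hrank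
    simpa [add_assoc] using hrank

/-- A quasi-divisorial valuation is determined by any nonzero element of `𝓘_v`. -/
theorem IsQuasiDivisorial.isGreatest {ℓ : ℕ} (hΛ : IsAdic ℓ Λ)
    (hK : (⊤ : IntermediateField k K).FG) {d : ℕ} (hd : Algebra.trdeg k K = d) (hd0 : 0 < d)
    {v : ValuationSubring K} (hv : IsQuasiDivisorial k v) {h : G K Λ} (hh : h ∈ inertia Λ v)
    (h0 : h ≠ 0) : IsGreatest {w : ValuationSubring K | h ∈ inertia Λ w} v := by
  obtain ⟨w, hw⟩ := exists_isGreatest_inertia ⟨v, hh⟩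
  have hvw : v ≤ w := hw.2 hh
  obtain ⟨t, ht⟩ := hv.prop.exists_resIndep hd
  have hwv := hv.le_of_ge (isQDCandidate_of_resIndep hΛ hK hd hd0 (ht.mono hvw) hw.1 h0) hvw
  rwa [le_antisymm hvw hwv]

/-- Two alternating subspaces of maximal dimension that meet in a line `I` give a quasi-divisorial
valuation: `I` is contained in some `𝓘_w`, and the coarsest such `w` is quasi-divisorial. -/
theorem exists_isQuasiDivisorial {ℓ : ℕ} (hΛ : IsAdic ℓ Λ)
    (hK : (⊤ : IntermediateField k K).FG) {d : ℕ} (hd : Algebra.trdeg k K = d) (hd2 : 2 ≤ d)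
    {I D₁ D₂ : Submodule (FractionRing Λ) (G K Λ)} (hI : Module.finrank (FractionRing Λ) I = 1)
    (hD₁ : Module.finrank (FractionRing Λ) D₁ = d) (hD₂ : Module.finrank (FractionRing Λ) D₂ = d)
    (hD : D₁ ⊓ D₂ = I) (hA₁ : IsAlternating (D₁ : Set (G K Λ)))
    (hA₂ : IsAlternating (D₂ : Set (G K Λ))) :
    ∃ v : ValuationSubring K, IsQuasiDivisorial k v ∧ inertia Λ v = I := by
  obtain ⟨V₁, hV₁, hr₁, hval₁⟩ := exists_valuation_of_isAlternating hΛ k D₁ hA₁ (hd2.trans hD₁.ge)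
  obtain ⟨V₂, hV₂, hr₂, hval₂⟩ := exists_valuation_of_isAlternating hΛ k D₂ hA₂ (hd2.trans hD₂.ge)
  obtain ⟨h, hhI, h0⟩ := exists_ne_zero_of_finrank_eq_one hI
  have hh₁ : h ∈ D₁ := (hD.ge hhI).1
  have hh₂ : h ∈ D₂ := (hD.ge hhI).2
  have hfin₁ : FiniteDimensional (FractionRing Λ) D₁ :=
    FiniteDimensional.of_finrank_pos (lt_of_lt_of_le Nat.two_pos (hd2.trans hD₁.ge))
  have hfin₂ : FiniteDimensional (FractionRing Λ) D₂ :=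
    FiniteDimensional.of_finrank_pos (lt_of_lt_of_le Nat.two_pos (hd2.trans hD₂.ge))
  have hfinI : FiniteDimensional (FractionRing Λ) I :=
    FiniteDimensional.of_finrank_pos (lt_of_lt_of_le Nat.one_pos hI.ge)
  -- Otherwise `V₁` and `V₂` are comparable, and `𝓘_V` is too large for the finer one.
  have hw : ∃ w, h ∈ inertia Λ w := by
    by_contra! hno
    have key : ∀ V : ValuationSubring K, h ∈ decomposition Λ V → inertia Λ V₁ ≤ inertia Λ V →
        inertia Λ V₂ ≤ inertia Λ V → False := by
      intro V hV h1 h2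
      have hu := hno V
      rw [mem_inertia_iff] at hu
      push Not at hu
      obtain ⟨u, hu, hhu⟩ := hu
      have hb := finiteDimensional_inertia hΛ hd (resIndep_of_ev_ne_zero (k := k) hΛ hV hu hhu)
      have hbot := eq_bot_of_finrank_eq_one hI (A := (D₁ ⊓ inertia Λ V₁) ⊓ (D₂ ⊓ inertia Λ V₂))
        ((inf_le_inf inf_le_left inf_le_left).trans hD.le) hhI fun hmem => hno _ hmem.1.2
      have := finrank_add_finrank_le_of_le hb.1 (inf_le_right.trans h1) (inf_le_right.trans h2) hbot
      rw [hD₁] at hr₁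
      rw [hD₂] at hr₂
      have hb2 := hb.2
      rw [Fintype.card_unit] at hb2
      omega
    by_cases h12 : V₁ ≤ V₂
    · exact key V₁ (hV₁ hh₁) le_rfl (inertia_anti h12)
    by_cases h21 : V₂ ≤ V₁
    · exact key V₂ (hV₂ hh₂) (inertia_anti h21) le_rfl
    exact hno _ (mem_inertia_sup h12 h21 (hV₁ hh₁) (hV₂ hh₂))
  obtain ⟨v, hv⟩ := exists_isGreatest_inertia hw
  have hhv : h ∈ inertia Λ v := hv.1
  have hle : ∀ {D : Submodule (FractionRing Λ) (G K Λ)}, Module.finrank (FractionRing Λ) D = d →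
      FiniteDimensional (FractionRing Λ) D → ∀ {V : ValuationSubring K}, D ≤ decomposition Λ V →
      Module.finrank (FractionRing Λ) D ≤
        Module.finrank (FractionRing Λ) ↥(D ⊓ inertia Λ V) + 1 → h ∈ inertia Λ V →
      inertia Λ v ≤ D ∧ ∃ (κ : Type) (_ : Fintype κ) (t : κ → K), ResIndep k v t ∧
        d ≤ Module.finrank (FractionRing Λ) (inertia Λ v) + Fintype.card κ := by
    intro D hDd hDfin V hDV hr hhV
    obtain ⟨κ, _, t, ht, hcard⟩ :=
      exists_resIndep_of_le_decomposition (k := k) hΛ hDfin (hv.2 hhV) hDV hr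
    obtain ⟨hfin, hb⟩ := finiteDimensional_inertia hΛ hd ht
    rw [hDd] at hcard
    have heq : D ⊓ inertia Λ v = inertia Λ v :=
      Submodule.eq_of_le_of_finrank_le inf_le_right (by
        have := hb.trans hcard
        exact Nat.le_of_add_le_add_right this)
    rw [heq] at hcard
    exact ⟨inf_eq_right.1 heq, κ, ‹_›, t, ht, hcard⟩
  obtain ⟨hle₁, κ, _, t, ht, hcard⟩ := hle hD₁ hfin₁ hV₁ hr₁ (hval₁ h hh₁ v hhv)
  obtain ⟨hle₂, -⟩ := hle hD₂ hfin₂ hV₂ hr₂ (hval₂ h hh₂ v hhv)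
  have hvI : inertia Λ v = I :=
    eq_of_le_of_finrank_eq_one hI ((le_inf hle₁ hle₂).trans hD.le) hhv h0
  have hb := (finiteDimensional_inertia hΛ hd ht).2
  rw [hvI, hI] at hcard hb
  have hκ : Fintype.card κ = d - 1 := by omega
  refine ⟨v, ⟨isQDCandidate_of_resIndep hΛ hK hd (by omega)
    (ht.comp _ (Fintype.equivFinOfCardEq hκ).symm.injective) hhv h0, ?_⟩, hvI⟩
  intro w hw hvw
  obtain ⟨g, hg, hg0⟩ := hw.exists_mem_inertia (Λ := Λ)
  have hwI : inertia Λ w = I :=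
    eq_of_le_of_finrank_eq_one hI ((inertia_anti hvw).trans hvI.le) hg hg0
  exact hv.2 (hwI.ge hhI)

/-! ### From valuations to alternating subspaces -/

theorem isAlternatingPair_of_mem_inertia {ℓ : ℕ} (hΛ : IsAdic ℓ Λ) (k : Type*) [Field k]
    [IsAlgClosed k] [Algebra k K] {v : ValuationSubring K} {f g : G K Λ} (hf : f ∈ inertia Λ v)
    (hg : g ∈ decomposition Λ v) : IsAlternatingPair f g :=
  isAlternatingPair_of_mem hf hg (isLog_ev hΛ k f).map_neg_one (isLog_ev hΛ k g).map_neg_one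

theorem finrank_inertia_eq {ℓ : ℕ} (hΛ : IsAdic ℓ Λ) (hK : (⊤ : IntermediateField k K).FG) {d : ℕ}
    (hd : Algebra.trdeg k K = d) {V : ValuationSubring K} {x : Fin d → K} (hx : ValIndep k V x) :
    Module.finrank (FractionRing Λ) (inertia Λ V) = d := by
  have hE : ResIndep k V (Empty.elim : Empty → K) := resIndep_of_isEmpty V _
  obtain ⟨h1, h2⟩ := finiteDimensional_inertia hΛ hd hE
  exact le_antisymm h2 (le_finrank_inertia h1 (finite_relValueGroup hK hd hx hE (by simp)) hx)

/-- If `v` satisfies the two conditions and `𝓘_v` is a line, then it is the intersection of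
`𝓘_{w₁}` and `𝓘_{w₂}`, for two refinements of `v` of maximal rational rank that have different
centers on the line with coordinate `t 0`. -/
theorem IsQDCandidate.exists_isAlternating {ℓ : ℕ} (hΛ : IsAdic ℓ Λ)
    (hK : (⊤ : IntermediateField k K).FG) {d : ℕ} (hd : Algebra.trdeg k K = d) (hd2 : 2 ≤ d)
    {v : ValuationSubring K} (hv : IsQDCandidate k v)
    (hI : Module.finrank (FractionRing Λ) (inertia Λ v) = 1) :
    ∃ D₁ D₂ : Submodule (FractionRing Λ) (G K Λ),
      Module.finrank (FractionRing Λ) D₁ = d ∧ Module.finrank (FractionRing Λ) D₂ = d ∧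
      D₁ ⊓ D₂ = inertia Λ v ∧
      IsAlternating (D₁ : Set (G K Λ)) ∧ IsAlternating (D₂ : Set (G K Λ)) := by
  obtain ⟨x, hx⟩ := hv.exists_valIndep
  obtain ⟨m, rfl⟩ : ∃ m, d = m + 2 := ⟨d - 2, by omega⟩
  obtain ⟨t, ht⟩ := hv.exists_resIndep hd
  change Fin (m + 1) → K at t
  change ResIndep k v t at ht
  have key : ∀ e : ℕ, ∃ V w : ValuationSubring K, w ≤ V ∧ V ≤ v ∧ v.valuation (t 0 - e) = 1 ∧
      V.valuation (t 0 - e) < 1 ∧ ResIndep k V (fun i => t (Fin.succ i)) ∧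
      (∀ c : k, v.valuation (algebraMap k K c) = 1 → V.valuation (algebraMap k K c) = 1) ∧
      Module.finrank (FractionRing Λ) (inertia Λ w) = m + 2 := by
    intro e
    obtain ⟨h1, V, hV, h2, h3, h4⟩ := ht.exists_refinement e
    obtain ⟨w, hw, y, hy⟩ := (hx.cons hV h4 h1 h2).exists_refinement h3
    have hm : 1 + 1 + m = m + 2 := by ring
    exact ⟨V, w, hw, hV, h1, h2, h3, h4, (finrank_inertia_eq hΛ hK (hm ▸ hd) hy).trans hm⟩
  obtain ⟨V₁, w₁, hw₁, hV₁, hu₁, ht₁, hres, hk, hr₁⟩ := key 0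
  obtain ⟨V₂, w₂, hw₂, hV₂, -, ht₂, -, -, hr₂⟩ := key 1
  rw [Nat.cast_zero, sub_zero] at ht₁ hu₁
  rw [Nat.cast_one] at ht₂
  have hunit : ∀ {w : ValuationSubring K}, w.valuation (t 0 - 1) < 1 → w.valuation (t 0) = 1 := by
    intro w hw
    have := valuation_one_add hw
    rwa [add_sub_cancel] at this
  have hnot : ∀ {w : ValuationSubring K}, w.valuation (t 0) < 1 → ¬ w.valuation (t 0 - 1) < 1 :=
    fun hw h => hw.ne (hunit h)
  have hw₁t := valuation_lt_one_of_le hw₁ ht₁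
  have hw₂t := valuation_lt_one_of_le hw₂ ht₂
  have h12 : ¬ w₁ ≤ w₂ := fun h => hnot hw₁t (valuation_lt_one_of_le h hw₂t)
  have h21 : ¬ w₂ ≤ w₁ := fun h => hnot (valuation_lt_one_of_le h hw₁t) hw₂t
  refine ⟨inertia Λ w₁, inertia Λ w₂, hr₁, hr₂, ?_,
    fun f hf g hg => isAlternatingPair_of_mem_inertia hΛ k hf (inertia_le_decomposition _ hg),
    fun f hf g hg => isAlternatingPair_of_mem_inertia hΛ k hf (inertia_le_decomposition _ hg)⟩
  -- The residues of `t` are independent at `w₁ ⊔ w₂` as well, so `𝓘` is a line there, too.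
  have hC : w₁ ⊔ w₂ ≤ v := sup_le (hw₁.trans hV₁) (hw₂.trans hV₂)
  have htC : (w₁ ⊔ w₂).valuation (t 0) = 1 := valuation_eq_one_of_le le_sup_right (hunit hw₂t)
  have hVC : V₁ ≤ w₁ ⊔ w₂ := by
    rcases w₁.le_total_ideal.total ⟨V₁, hw₁⟩ ⟨w₁ ⊔ w₂, le_sup_left⟩ with h | h
    · exact h
    · exact absurd hw₂t (hnot (valuation_lt_one_of_le (le_sup_right.trans h) ht₁))
  have hx0 : ValIndep k V₁ (Fin.cons (t 0) Fin.elim0 : Fin 1 → K) :=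
    (valIndep_of_isEmpty v Fin.elim0).cons hV₁ hk hu₁ ht₁
  have hresC := hx0.resIndep_sumElim hVC hres fun i => by
    rw [show i = 0 from Subsingleton.elim (α := Fin 1) i 0]
    exact htC
  obtain ⟨hfin, hb⟩ := finiteDimensional_inertia hΛ hd hresC
  have hle := inertia_anti (Λ := Λ) hC
  have heq : inertia Λ v = inertia Λ (w₁ ⊔ w₂) := Submodule.eq_of_le_of_finrank_le hle (by
    rw [hI]
    simp at hb
    omega)
  refine le_antisymm (fun f hf => ?_)
    (le_inf (inertia_anti (hw₁.trans hV₁)) (inertia_anti (hw₂.trans hV₂)))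
  rw [heq]
  exact mem_inertia_sup_of_mem hf.1 hf.2

end

end QuasiDivisorial

theorem mainTheorem4
    (ℓ : ℕ) [Fact ℓ.Prime]
    (Λ : Type*) [CommRing Λ] [IsDomain Λ] [Algebra ℤ_[ℓ] Λ]
    (hΛ : Function.Surjective (algebraMap ℤ_[ℓ] Λ))
    (k : Type*) [Field k] [IsAlgClosed k] (hk : ringChar k ≠ ℓ)
    (K : Type*) [Field K] [Algebra k K] (hK : (⊤ : IntermediateField k K).FG)
    (d : ℕ) (hd : Algebra.trdeg k K = d) (hd2 : 2 ≤ d)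
    (I : Submodule (FractionRing Λ) (QuasiDivisorial.G K Λ))
    (hI : Module.finrank (FractionRing Λ) I = 1) :
    ((∃ D₁ D₂ : Submodule (FractionRing Λ) (QuasiDivisorial.G K Λ),
        Module.finrank (FractionRing Λ) D₁ = d ∧ Module.finrank (FractionRing Λ) D₂ = d ∧
        D₁ ⊓ D₂ = I ∧
        QuasiDivisorial.IsAlternating (D₁ : Set (QuasiDivisorial.G K Λ)) ∧
        QuasiDivisorial.IsAlternating (D₂ : Set (QuasiDivisorial.G K Λ))) ↔
      ∃ v : ValuationSubring K,
        QuasiDivisorial.IsQuasiDivisorial k v ∧ QuasiDivisorial.inertia Λ v = I) ∧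
    (∀ v w : ValuationSubring K,
      QuasiDivisorial.IsQuasiDivisorial k v → QuasiDivisorial.inertia Λ v = I →
      QuasiDivisorial.IsQuasiDivisorial k w → QuasiDivisorial.inertia Λ w = I → v = w) ∧
    (∀ v : ValuationSubring K,
      QuasiDivisorial.IsQuasiDivisorial k v → QuasiDivisorial.inertia Λ v = I →
      ∀ h ∈ QuasiDivisorial.inertia Λ v, h ≠ 0 →
        (QuasiDivisorial.decomposition Λ v : Set (QuasiDivisorial.G K Λ)) =
          {f | QuasiDivisorial.IsAlternatingPair h f}) := by
  have hΛ' := QuasiDivisorial.isAdic_of_surjective ℓ Λ hΛ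
  have hd0 : 0 < d := lt_of_lt_of_le Nat.two_pos hd2
  have hgreatest : ∀ {v : ValuationSubring K} {h : QuasiDivisorial.G K Λ},
      QuasiDivisorial.IsQuasiDivisorial k v → h ∈ QuasiDivisorial.inertia Λ v → h ≠ 0 →
      IsGreatest {w : ValuationSubring K | h ∈ QuasiDivisorial.inertia Λ w} v :=
    fun hv hh h0 => hv.isGreatest hΛ' hK hd hd0 hh h0
  refine ⟨⟨?_, ?_⟩, ?_, ?_⟩
  · rintro ⟨D₁, D₂, hD₁, hD₂, hD, hA₁, hA₂⟩
    exact QuasiDivisorial.exists_isQuasiDivisorial hΛ' hK hd hd2 hI hD₁ hD₂ hD hA₁ hA₂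
  · rintro ⟨v, hv, rfl⟩
    exact hv.prop.exists_isAlternating hΛ' hK hd hd2 hI
  · intro v w hv hvI hw hwI
    obtain ⟨h, hh, h0⟩ := QuasiDivisorial.exists_ne_zero_of_finrank_eq_one hI
    exact (hgreatest hv (hvI.ge hh) h0).unique (hgreatest hw (hwI.ge hh) h0)
  · intro v hv _ h hh h0
    ext f
    exact ⟨QuasiDivisorial.isAlternatingPair_of_mem_inertia hΛ' k hh,
      QuasiDivisorial.mem_decomposition_of_isGreatest (hgreatest hv hh h0)⟩
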